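/- Let $n\ge 2$ and $\sigma\in(\tfrac12,1)$. For a measurable set $A\subset\mathbb R^n$ put $$I_{n,\sigma,A}[u]=\iint_{A\times A}\frac{(u(x)-u(y))^2}{|x-y|^{n+2\sigma}}\,dx\,dy ,$$ and for a bounded open set $\Omega\subset\mathbb R^n$ let $\mathring H^\sigma(\Omega)$ be the completion of $C^1_c(\Omega)$ with respect to $I_{n,\sigma,\Omega}$, regarded as a space of $L^2$ functions extended by zero outside $\Omega$. Write $B_N=\{|x|<N\}$, $B_R(x_0)=\{|x-x_0|<R\}$, and for $N>0$ let $$m(N)=\inf\Big\{\frac{I_{n,\sigma,\{u>0\}}[u]}{\|u\|_{L^2(B_N)}^2}+|\{u>0\}|\;:\;u\in\mathring H^\sigma(B_N),\ u\not\equiv0,\ u\ge0\Big\}.$$ Let $N_0>0$. There is a constant $C>0$, depending only on $n$, $\sigma$ and $N_0$ (so only on $n$ and $\sigma$ if one restricts to $N\ge 1$), such that for every real $N\ge N_0$ every nonnegative minimizer $u$ of $m(N)$ satisfies (i) $\displaystyle \|u\|_{L^\infty(\mathbb R^n)}\le C\,\|u\|_{L^2(\mathbb R^n)}$; in particular $u$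 is bounded; (ii) for all $x_0\in\mathbb R^n$, $R\in(0,1]$ and $\varepsilon\in(0,1]$, $$\operatorname*{ess\,sup}_{B_{R/2}(x_0)}u\;\le\;\varepsilon R^{2\sigma}\int_{\mathbb R^n}\frac{u(y)}{(R+|y-x_0|)^{n+2\sigma}}\,dy+C\,\varepsilon^{-\frac{n}{4\sigma}}R^{-\frac n2}\,\|u\|_{L^2(B_R(x_0))}.$$ -/

import Mathlib

open MeasureTheory Filter Topology
open scoped ENNReal

noncomputable section

namespace CensoredEnergy

/-- The Dirichlet form `I_{n,σ,A}[u] = ∬_{A × A} (u x - u y)² / |x - y|^{n + 2σ} dx dy`,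
as an extended nonnegative number. -/
def energy {n : ℕ} (σ : ℝ) (A : Set (EuclideanSpace ℝ (Fin n)))
    (u : EuclideanSpace ℝ (Fin n) → ℝ) : ℝ≥0∞ :=
  ∫⁻ z in A ×ˢ A, ENNReal.ofReal ((u z.1 - u z.2) ^ 2 / ‖z.1 - z.2‖ ^ ((n : ℝ) + 2 * σ))

/-- `φ ∈ C¹_c(Ω)` (extended by zero to the whole space). -/
structure IsTest {n : ℕ} (Ω : Set (EuclideanSpace ℝ (Fin n)))
    (φ : EuclideanSpace ℝ (Fin n) → ℝ) : Prop where
  contDiff : ContDiff ℝ 1 φ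
  hasCompactSupport : HasCompactSupport φ
  tsupport_subset : tsupport φ ⊆ Ω

/-- Membership in `H̊^σ(Ω)`, the completion of `C¹_c(Ω)` with respect to the form `I_{n,σ,Ω}`, for
a bounded open set `Ω` (and `n ≥ 2`, `1/2 < σ < 1`).  Since `H̊^σ(Ω)` embeds in `L²(Ω)`, the
completion is realised as a space of `L²` functions, extended by zero outside `Ω`: those that are
limits of test functions both in the form `I_{n,σ,Ω}` and in `L²`. -/
structure MemH0 {n : ℕ} (σ : ℝ) (Ω : Set (EuclideanSpace ℝ (Fin n)))
    (u : EuclideanSpace ℝ (Fin n) → ℝ) : Prop where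
  memLp : MemLp u 2 volume
  eq_zero : ∀ᵐ x ∂volume, x ∉ Ω → u x = 0
  approx : ∃ φ : ℕ → EuclideanSpace ℝ (Fin n) → ℝ, (∀ k, IsTest Ω (φ k)) ∧
    Tendsto (fun k => energy σ Ω (φ k - u)) atTop (𝓝 0) ∧
    Tendsto (fun k => eLpNorm (φ k - u) 2 volume) atTop (𝓝 0)

/-- The competitors for `m(N)`: `u ∈ H̊^σ(B_N)`, `u ≢ 0`, `u ≥ 0`. -/
structure Admissible {n : ℕ} (σ N : ℝ) (u : EuclideanSpace ℝ (Fin n) → ℝ) : Prop where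
  mem : MemH0 σ (Metric.ball 0 N) u
  ne_zero : ¬ u =ᵐ[volume] 0
  nonneg : 0 ≤ᵐ[volume] u

/-- The functional `I_{n,σ,{u>0}}[u] / ‖u‖²_{L²(B_N)} + |{u > 0}|`. -/
def functional {n : ℕ} (σ N : ℝ) (u : EuclideanSpace ℝ (Fin n) → ℝ) : ℝ≥0∞ :=
  energy σ {x | 0 < u x} u / eLpNorm u 2 (volume.restrict (Metric.ball 0 N)) ^ 2
    + volume {x | 0 < u x}

/-- `m(N)`, the infimum of the functional over all competitors. -/
def m (n : ℕ) (σ N : ℝ) : ℝ≥0∞ :=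
  ⨅ (v : EuclideanSpace ℝ (Fin n) → ℝ) (_ : Admissible σ N v), functional σ N v

/-- `u` is a nonnegative minimizer of `m(N)`. -/
def IsMinimizer {n : ℕ} (σ N : ℝ) (u : EuclideanSpace ℝ (Fin n) → ℝ) : Prop :=
  Admissible σ N u ∧ functional σ N u = m n σ N

end CensoredEnergy

end

/-! The proof is a De Giorgi iteration whose two ingredients, a Caccioppoli inequality and a
Sobolev-type inequality, both have to be obtained for the form restricted to the set `{u > 0}`,
about whose regularity nothing is known.

Caccioppoli: for `t ≤ 1/2` the competitor `u - t η² (u - K)₊` is at least `u / 2`, so it has the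
same positivity set as `u`. The measure terms cancel, both energies live on one set, and letting `t
→ 0` gives `IsStrictMinimizer.caccioppoli`, where the multiplier is at most `m(N)`. A fixed bump is
admissible for every `N ≥ N₀`, so `m(N)` is bounded uniformly (`exists_m_le`); this is the only
place where `N₀` enters.

Faber–Krahn: the restricted form does not control the jump across the boundary of the positivity
set, so the Sobolev inequality of the whole space is not directly available. Since `σ > 1/2`,
however, a one-dimensional fractional Hardy inequality holds along each ray up to its first zero
(`exists_hardy_ray`). Averaging over directions turns the ray energies into the form, and a positive
proportion of directions exit early, because the region visible from a point has measure at most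
`|{g > 0}|`. This gives `∫ g² ≤ C |{g > 0}|^(2σ/n) I[g]` for Lipschitz `g` (`exists_faberKrahn`),
and approximation carries it to `η (u - K)₊` (`exists_faberKrahn_excess`).

Iteration: the two inequalities combine in `exists_deGiorgi_step`. The nonlocal cross term splits
into a near part of size `R^(-2σ)` and a product of a local `L¹` norm with the tail of `u`. Choosing
the final level `k` above `ε R^(2σ)` times the tail absorbs the tail at the price of `ε⁻¹`, and
superlinear decay gives (ii). Part (i) is the case `R = ε = 1`, with Cauchy–Schwarz for the tail and
a countable cover. -/

open scoped Pointwise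

/-! ### Exit times along rays. -/

/-- The first time at which the ray from `x` in direction `z` meets the zero set of `g`
(junk value `0` if it never does). -/
noncomputable def exitTime {E : Type*} [AddCommGroup E] [Module ℝ E] (g : E → ℝ) (z x : E) : ℝ :=
  sInf {t : ℝ | 0 ≤ t ∧ g (x + t • z) = 0}

section ExitTime

variable {E : Type*} [NormedAddCommGroup E] [NormedSpace ℝ E] {g : E → ℝ}

theorem exitTime_nonneg (g : E → ℝ) (z x : E) : 0 ≤ exitTime g z x :=
  Real.sInf_nonneg fun _ h => h.1

theorem exitTime_le {z x : E} {t : ℝ} (ht : 0 ≤ t) (h0 : g (x + t • z) = 0) :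
    exitTime g z x ≤ t :=
  csInf_le ⟨0, fun _ h => h.1⟩ ⟨ht, h0⟩

theorem exitTime_mem (hg : Continuous g) {z x : E}
    (h : {t : ℝ | 0 ≤ t ∧ g (x + t • z) = 0}.Nonempty) : g (x + exitTime g z x • z) = 0 := by
  have hc : IsClosed {t : ℝ | 0 ≤ t ∧ g (x + t • z) = 0} :=
    (isClosed_le continuous_const continuous_id).inter
      (isClosed_eq (hg.comp (by fun_prop)) continuous_const)
  exact (hc.csInf_mem h ⟨0, fun _ h => h.1⟩).2

theorem ne_zero_of_lt_exitTime {z x : E} {t : ℝ} (ht : 0 ≤ t) (h : t < exitTime g z x) :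
    g (x + t • z) ≠ 0 := fun h0 =>
  absurd (csInf_le ⟨0, fun _ h => h.1⟩ (show t ∈ {t : ℝ | 0 ≤ t ∧ g (x + t • z) = 0} from ⟨ht, h0⟩))
    (not_le.mpr h)

theorem exists_ray_eq_zero {r : ℝ} (hr : ∀ x, g x ≠ 0 → ‖x‖ < r) {z : E} (hz : z ≠ 0) (x : E) :
    {t : ℝ | 0 ≤ t ∧ g (x + t • z) = 0}.Nonempty := by
  have hz' : 0 < ‖z‖ := norm_pos_iff.mpr hz
  refine ⟨(‖x‖ + |r|) / ‖z‖, by positivity, ?_⟩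
  by_contra h
  have h1 := hr _ h
  have h2 : ‖((‖x‖ + |r|) / ‖z‖) • z‖ = ‖x‖ + |r| := by
    rw [norm_smul, Real.norm_of_nonneg (by positivity)]; field_simp
  have h3 := norm_sub_norm_le (((‖x‖ + |r|) / ‖z‖) • z) (-x)
  rw [sub_neg_eq_add, add_comm _ x, norm_neg, h2] at h3
  have := le_abs_self r
  linarith

theorem exitTime_pos (hg : Continuous g) {z x : E}
    (h : {t : ℝ | 0 ≤ t ∧ g (x + t • z) = 0}.Nonempty) (hx : g x ≠ 0) : 0 < exitTime g z x := by
  refine lt_of_le_of_ne (exitTime_nonneg g z x) fun h0 => hx ?_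
  have := exitTime_mem hg h
  rwa [← h0, zero_smul, add_zero] at this

theorem exitTime_translate {z x : E} (h : {t : ℝ | 0 ≤ t ∧ g (x + t • z) = 0}.Nonempty)
    (hg : Continuous g) {t : ℝ} (ht : 0 ≤ t) (htd : t < exitTime g z x) :
    exitTime g z (x + t • z) = exitTime g z x - t := by
  have key : ∀ s : ℝ, x + t • z + s • z = x + (t + s) • z := fun s => by rw [add_smul, add_assoc]
  apply le_antisymm
  · refine exitTime_le (by linarith) ?_
    rw [key, add_sub_cancel]
    exact exitTime_mem hg h
  · refine le_csInf ⟨exitTime g z x - t, by linarith, ?_⟩ ?_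
    · rw [key, add_sub_cancel]; exact exitTime_mem hg h
    · rintro s ⟨hs, hs0⟩
      rw [key] at hs0
      linarith [exitTime_le (by linarith) hs0]

theorem exitTime_le_of_bounded {r : ℝ} (hr : ∀ x, g x ≠ 0 → ‖x‖ < r) {z : E} (hz : z ≠ 0) {x : E}
    (hx : g x ≠ 0) : exitTime g z x ≤ 2 * r / ‖z‖ := by
  have hz' : 0 < ‖z‖ := norm_pos_iff.mpr hz
  have hr0 : 0 < r := (norm_nonneg _).trans_lt (hr x hx)
  by_contra! h
  have h1 := hr _ (ne_zero_of_lt_exitTime (by positivity) h)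
  have h2 : ‖(2 * r / ‖z‖) • z‖ = 2 * r := by
    rw [norm_smul, Real.norm_of_nonneg (by positivity)]; field_simp
  have h3 := norm_sub_norm_le ((2 * r / ‖z‖) • z) (-x)
  rw [sub_neg_eq_add, add_comm _ x, norm_neg, h2] at h3
  have := hr x hx
  linarith

/-- Lipschitz functions vanish linearly at the exit point. Since `2 - 2σ > 0`, this makes the Hardy
integral finite beforehand, which the absorption argument in `exists_hardy_ray` requires. -/
theorem le_mul_exitTime {L : NNReal} (hg : LipschitzWith L g) {z x : E}
    (h : {t : ℝ | 0 ≤ t ∧ g (x + t • z) = 0}.Nonempty) :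
    g x ≤ L * ‖z‖ * exitTime g z x := by
  have h1 := hg.dist_le_mul x (x + exitTime g z x • z)
  rw [exitTime_mem hg.continuous h, Real.dist_eq, sub_zero, dist_eq_norm, sub_add_cancel_left,
    norm_neg, norm_smul, Real.norm_of_nonneg (exitTime_nonneg g z x)] at h1
  calc g x ≤ |g x| := le_abs_self _
    _ ≤ _ := h1
    _ = _ := by ring

/-- A sublevel set is the projection, along the compact interval `[0, s]`, of a closed set, hence
closed. The direction `z = 0` is treated apart: there the exit time is `0`, either genuinely or
through `sInf ∅ = 0`. -/
theorem measurable_exitTime [MeasurableSpace E] [BorelSpace E] [SecondCountableTopology E]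
    (hg : Continuous g) {r : ℝ} (hr : ∀ x, g x ≠ 0 → ‖x‖ < r) :
    Measurable fun q : E × E => exitTime g q.1 q.2 := by
  refine measurable_of_Iic fun s => ?_
  rcases lt_or_ge s 0 with hs | hs
  · convert MeasurableSet.empty
    ext q
    simp only [Set.mem_preimage, Set.mem_Iic, Set.mem_empty_iff_false, iff_false, not_le]
    exact hs.trans_le (exitTime_nonneg g _ _)
  have hE : (fun q : E × E => exitTime g q.1 q.2) ⁻¹' Set.Iic s =
      {q | q.1 = 0} ∪ Set.image Prod.snd
        {w : Set.Icc (0 : ℝ) s × (E × E) | g (w.2.2 + (w.1 : ℝ) • w.2.1) = 0} := by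
    ext ⟨z, x⟩
    simp only [Set.mem_preimage, Set.mem_Iic, Set.mem_union, Set.mem_ofPred_eq, Set.mem_image,
      Prod.exists, exists_eq_right, Subtype.exists]
    constructor
    · intro h
      by_cases hz : z = 0
      · exact Or.inl hz
      · exact Or.inr ⟨exitTime g z x, ⟨exitTime_nonneg g z x, h⟩,
          exitTime_mem hg (exists_ray_eq_zero hr hz x)⟩
    · rintro (rfl | ⟨t, ht, h0⟩)
      · by_cases hx : g x = 0
        · exact (exitTime_le le_rfl (by simpa using hx)).trans hs
        · have : {t : ℝ | 0 ≤ t ∧ g (x + t • (0 : E)) = 0} = ∅ := by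
            ext t; simp [hx]
          rw [exitTime, this, Real.sInf_empty]
          exact hs
      · exact (exitTime_le ht.1 h0).trans ht.2
  rw [hE]
  refine ((isClosed_eq continuous_fst continuous_const).measurableSet).union
    (IsClosed.measurableSet ?_)
  exact isClosedMap_snd_of_compactSpace _ (isClosed_eq (hg.comp (by fun_prop)) continuous_const)

theorem measurable_exitTime_left [MeasurableSpace E] [BorelSpace E] [SecondCountableTopology E]
    (hg : Continuous g) {r : ℝ} (hr : ∀ x, g x ≠ 0 → ‖x‖ < r) (x : E) :
    Measurable fun z => exitTime g z x :=
  (measurable_exitTime hg hr).comp (f := fun z => (z, x)) (by fun_prop)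

end ExitTime

/-! ### A fractional Hardy inequality along rays. -/

theorem sq_le_mul_sq_add (a b : ℝ) {κ : ℝ} (hκ : 1 < κ) :
    a ^ 2 ≤ κ * b ^ 2 + κ / (κ - 1) * (a - b) ^ 2 := by
  have h : 0 < κ - 1 := by linarith
  have : κ * b ^ 2 + κ / (κ - 1) * (a - b) ^ 2 - a ^ 2 = (κ * b - a) ^ 2 / (κ - 1) := by
    field_simp; ring
  have : 0 ≤ (κ * b - a) ^ 2 / (κ - 1) := by positivity
  linarith

/-- Because `1 - 2σ < 0`, the factor `(d + t)^(1 - 2σ)` is at most `(2d)^(1 - 2σ)`; what remains is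
`∫ (d + t)⁻²` over `(d, 3d)`, which is `1 / (4d)`. The resulting constant `2^(1 - 2σ)` is below `1`,
and the absorption in the Hardy inequality rests on this. -/
theorem lintegral_add_rpow_le {σ d : ℝ} (hσ : 1 / 2 < σ) (hd : 0 < d) (a : ℝ) :
    ∫⁻ t in Set.Ioo d (3 * d), ENNReal.ofReal (4 * a ^ 2 * (d + t) ^ (-1 - 2 * σ)) ≤
      ENNReal.ofReal ((2 : ℝ) ^ (1 - 2 * σ) * (a ^ 2 * d ^ (-(2 * σ)))) := by
  have h1 : ∫⁻ t in Set.Ioo d (3 * d), ENNReal.ofReal (4 * a ^ 2 * (d + t) ^ (-1 - 2 * σ)) ≤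
      ∫⁻ t in Set.Ioc d (3 * d),
        ENNReal.ofReal (4 * a ^ 2 * (2 * d) ^ (1 - 2 * σ) * ((d + t) ^ 2)⁻¹) := by
    refine (lintegral_mono_set Set.Ioo_subset_Ioc_self).trans ?_
    refine setLIntegral_mono' measurableSet_Ioc fun t ht => ENNReal.ofReal_le_ofReal ?_
    have hdt : 2 * d ≤ d + t := by linarith [ht.1]
    have e : (d + t) ^ (-1 - 2 * σ) = (d + t) ^ (1 - 2 * σ) * ((d + t) ^ 2)⁻¹ := by
      rw [← Real.rpow_natCast, ← Real.rpow_neg (by linarith), ← Real.rpow_add (by linarith)]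
      congr 1; push_cast; ring
    rw [e, mul_assoc (4 * a ^ 2)]
    gcongr 4 * a ^ 2 * (?_ * _)
    exact Real.rpow_le_rpow_of_nonpos (by linarith) hdt (by linarith)
  refine h1.trans ?_
  have hcont : ContinuousOn (fun t : ℝ => ((d + t) ^ 2)⁻¹) (Set.uIcc d (3 * d)) := by
    refine ContinuousOn.inv₀ (by fun_prop) fun t ht => ?_
    rw [Set.uIcc_of_le (by linarith)] at ht
    have : 0 < d + t := by linarith [ht.1]
    positivity
  have hval : ∫ t in d..(3 * d), ((d + t) ^ 2)⁻¹ = (4 * d)⁻¹ := by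
    rw [intervalIntegral.integral_eq_sub_of_hasDerivAt (f := fun t => -(d + t)⁻¹)
      (f' := fun t => ((d + t) ^ 2)⁻¹)]
    · field_simp; ring
    · intro t ht
      rw [Set.uIcc_of_le (by linarith)] at ht
      have : d + t ≠ 0 := by linarith [ht.1]
      have h := ((hasDerivAt_id t).const_add d).fun_inv this
      refine h.neg.congr_deriv ?_
      simp only [id, neg_div, neg_neg, one_div]
    · exact hcont.intervalIntegrable
  rw [← ofReal_integral_eq_lintegral_ofReal]
  · apply ENNReal.ofReal_le_ofReal
    rw [← intervalIntegral.integral_of_le (by linarith), intervalIntegral.integral_const_mul, hval,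
      Real.mul_rpow (by norm_num) hd.le]
    have e : d ^ (-(2 * σ)) = d ^ (1 - 2 * σ) * d⁻¹ := by
      rw [← Real.rpow_neg_one, ← Real.rpow_add hd]; congr 1; ring
    rw [e, mul_inv]
    apply le_of_eq; ring
  · have := (hcont.intervalIntegrable (μ := volume)).const_mul (4 * a ^ 2 * (2 * d) ^ (1 - 2 * σ))
    rwa [intervalIntegrable_iff_integrableOn_Ioc_of_le (by linarith)] at this
  · refine ae_of_all _ fun t => ?_
    have : 0 < (2 * d) ^ (1 - 2 * σ) := by positivity
    positivity

section Hardy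

variable {E : Type*} [NormedAddCommGroup E] [NormedSpace ℝ E] [FiniteDimensional ℝ E]
  [MeasureSpace E] [BorelSpace E]

/-- The integrand of the one-directional Dirichlet form on `{0 < g}`. -/
noncomputable def rayIntegrand (σ : ℝ) (g : E → ℝ) (z x : E) (t : ℝ) : ℝ≥0∞ :=
  {t : ℝ | 0 < g x ∧ 0 < t ∧ 0 < g (x + t • z)}.indicator
    (fun t => ENNReal.ofReal ((g x - g (x + t • z)) ^ 2 * t ^ (-1 - 2 * σ))) t

theorem measurable_rayIntegrand (σ : ℝ) {g : E → ℝ} (hg : Continuous g) :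
    Measurable fun q : E × E × ℝ => rayIntegrand σ g q.1 q.2.1 q.2.2 := by
  have h1 : Measurable fun q : E × E × ℝ => g q.2.1 := (hg.comp (by fun_prop)).measurable
  have h2 : Measurable fun q : E × E × ℝ => g (q.2.1 + q.2.2 • q.1) :=
    (hg.comp (by fun_prop)).measurable
  have h3 : Measurable fun q : E × E × ℝ => q.2.2 := by fun_prop
  have : (fun q : E × E × ℝ => rayIntegrand σ g q.1 q.2.1 q.2.2) =
      {q : E × E × ℝ | 0 < g q.2.1 ∧ 0 < q.2.2 ∧ 0 < g (q.2.1 + q.2.2 • q.1)}.indicator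
        fun q => ENNReal.ofReal ((g q.2.1 - g (q.2.1 + q.2.2 • q.1)) ^ 2 *
          q.2.2 ^ (-1 - 2 * σ)) := by
    ext q; simp only [rayIntegrand, Set.indicator_apply, Set.mem_ofPred_eq]
  rw [this]
  refine Measurable.indicator ?_ ?_
  · exact (((h1.sub h2).pow_const 2).mul (h3.pow_const _)).ennreal_ofReal
  · exact (measurableSet_lt measurable_const h1).inter
      ((measurableSet_lt measurable_const h3).inter (measurableSet_lt measurable_const h2))

variable [(volume : Measure E).IsAddHaarMeasure]

/-- A fractional Hardy inequality along the rays in a fixed direction, valid since `σ > 1/2`. -/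
theorem exists_hardy_ray {σ : ℝ} (hσ : 1 / 2 < σ) (hσ' : σ < 1) :
    ∃ C : ℝ, 0 < C ∧ ∀ (g : E → ℝ) (L : NNReal) (r : ℝ) (z : E), LipschitzWith L g →
      (∀ x, 0 ≤ g x) → (∀ x, g x ≠ 0 → ‖x‖ < r) → z ≠ 0 →
      ∫⁻ x in {x | 0 < g x}, ENNReal.ofReal (g x ^ 2 * exitTime g z x ^ (-(2 * σ))) ≤
        ENNReal.ofReal C * ∫⁻ x, ∫⁻ t, rayIntegrand σ g z x t := by
  -- `κ > 1` is the loss in comparing `g(x)²` with `g(x + tz)²`. It is chosen so that `κ 2^(1 - 2σ)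
  -- = q` is still below `1`.
  set κ : ℝ := 2 ^ (σ - 1 / 2) with hκ
  have hκ1 : 1 < κ := Real.one_lt_rpow (by norm_num) (by linarith)
  set q : ℝ := 2 ^ (1 / 2 - σ) with hq
  have hq0 : 0 < q := by positivity
  have hq1 : q < 1 := Real.rpow_lt_one_of_one_lt_of_neg (by norm_num) (by linarith)
  have hκq : κ * 2 ^ (1 - 2 * σ) = q := by
    rw [hκ, hq, ← Real.rpow_add (by norm_num)]; congr 1; ring
  set c : ℝ := 4 * (κ / (κ - 1)) with hc
  have hc0 : 0 < c := by have : 0 < κ - 1 := by linarith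
                         positivity
  refine ⟨c / (1 - q), div_pos hc0 (by linarith), fun g L r z hL hg0 hr hz => ?_⟩
  have hgc := hL.continuous
  set d := exitTime g z with hd
  have hne := exists_ray_eq_zero hr hz
  have hdm : Measurable d :=
    (measurable_exitTime hgc hr).comp (measurable_const.prodMk measurable_id)
  have hgm := hgc.measurable
  have hWm : MeasurableSet {x | 0 < g x} := measurableSet_lt measurable_const hgm
  set W := {x | 0 < g x} with hW
  set X := ∫⁻ x in W, ENNReal.ofReal (g x ^ 2 * d x ^ (-(2 * σ))) with hX
  set Z := ∫⁻ x, ∫⁻ t, rayIntegrand σ g z x t with hZ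
  have hdpos : ∀ x ∈ W, 0 < d x := fun x hx => exitTime_pos hgc (hne x) (ne_of_gt hx)
  -- a priori finiteness
  have hXfin : X ≠ ∞ := by
    have hWb : W ⊆ Metric.ball 0 r := fun x hx => by simpa using hr x (ne_of_gt hx)
    have hz' : 0 < ‖z‖ := norm_pos_iff.mpr hz
    have : X ≤ ∫⁻ x in W, ENNReal.ofReal ((L * ‖z‖) ^ 2 * (2 * r / ‖z‖) ^ (2 - 2 * σ)) := by
      refine setLIntegral_mono' hWm fun x hx => ENNReal.ofReal_le_ofReal ?_
      have h1 := le_mul_exitTime hL (hne x)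
      have h2 := exitTime_le_of_bounded hr hz (ne_of_gt hx)
      have h3 := hdpos x hx
      calc g x ^ 2 * d x ^ (-(2 * σ)) ≤ (L * ‖z‖ * d x) ^ 2 * d x ^ (-(2 * σ)) := by
            gcongr; exact hg0 x
        _ = (L * ‖z‖) ^ 2 * d x ^ (2 - 2 * σ) := by
            rw [mul_pow, mul_assoc, ← Real.rpow_natCast (d x) 2, ← Real.rpow_add h3]
            norm_num [sub_eq_add_neg]
        _ ≤ _ := by gcongr; linarith
    refine (this.trans_lt ?_).ne
    rw [setLIntegral_const]
    exact ENNReal.mul_lt_top ENNReal.ofReal_lt_top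
      ((measure_mono hWb).trans_lt (measure_ball_lt_top))
  -- the translated term
  set Ψ : E × ℝ → ℝ≥0∞ := {p : E × ℝ | p.1 ∈ W ∧ p.2 ∈ Set.Ioo (d p.1) (3 * d p.1)}.indicator
    fun p => ENNReal.ofReal (4 * g p.1 ^ 2 * (d p.1 + p.2) ^ (-1 - 2 * σ)) with hΨ
  have hΨm : Measurable Ψ := by
    have h1 : Measurable fun p : E × ℝ => g p.1 := hgm.comp measurable_fst
    have h2 : Measurable fun p : E × ℝ => d p.1 := hdm.comp measurable_fst
    refine Measurable.indicator ?_ ?_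
    · exact (((h1.pow_const 2).const_mul 4).mul
        ((h2.add measurable_snd).pow_const _)).ennreal_ofReal
    · exact (measurableSet_lt measurable_const h1).inter ((measurableSet_lt h2 measurable_snd).inter
        (measurableSet_lt measurable_snd (h2.const_mul 3)))
  -- For fixed `t` the shift by `t • z` preserves Lebesgue measure; afterwards the `t`-integral is
  -- evaluated at a fixed base point.
  have hY : ∫⁻ x, ∫⁻ t, Ψ (x + t • z, t) ≤ ENNReal.ofReal (2 ^ (1 - 2 * σ)) * X := by
    have hm2 : Measurable fun p : E × ℝ => Ψ (p.1 + p.2 • z, p.2) :=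
      hΨm.comp (by fun_prop)
    rw [lintegral_lintegral_swap (f := fun x t => Ψ (x + t • z, t)) hm2.aemeasurable]
    have : ∀ t : ℝ, ∫⁻ x, Ψ (x + t • z, t) = ∫⁻ x, Ψ (x, t) := fun t =>
      lintegral_add_right_eq_self (fun x => Ψ (x, t)) (t • z)
    simp_rw [this]
    rw [← lintegral_lintegral_swap (f := fun x t => Ψ (x, t)) hΨm.aemeasurable,
      hX, ← lintegral_const_mul' _ _ ENNReal.ofReal_ne_top, ← lintegral_indicator hWm]
    refine lintegral_mono fun x => ?_
    by_cases hx : x ∈ W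
    · rw [Set.indicator_of_mem hx, ← ENNReal.ofReal_mul (by positivity)]
      refine le_trans (le_of_eq ?_) (lintegral_add_rpow_le hσ (hdpos x hx) (g x))
      rw [← lintegral_indicator measurableSet_Ioo]
      refine lintegral_congr fun t => ?_
      simp only [hΨ, Set.indicator_apply, Set.mem_ofPred_eq, hx, true_and]
    · simp [hΨ, hx]
  have hmain : X ≤ ENNReal.ofReal κ * (∫⁻ x, ∫⁻ t, Ψ (x + t • z, t)) + ENNReal.ofReal c * Z := by
    have hm2 : Measurable fun p : E × ℝ => Ψ (p.1 + p.2 • z, p.2) :=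
      hΨm.comp (by fun_prop)
    have hm3 : Measurable fun p : E × ℝ => rayIntegrand σ g z p.1 p.2 :=
      (measurable_rayIntegrand σ hgc).comp (measurable_const.prodMk measurable_id)
    rw [hZ, ← lintegral_const_mul' _ _ ENNReal.ofReal_ne_top,
      ← lintegral_const_mul' _ _ ENNReal.ofReal_ne_top, ← lintegral_add_left
      (hm2.lintegral_prod_right'.const_mul _), hX, ← lintegral_indicator hWm]
    refine lintegral_mono fun x => ?_
    by_cases hx : x ∈ W
    swap
    · simp [hx]
    have hdx := hdpos x hx
    have hm4 : Measurable fun t : ℝ => ENNReal.ofReal κ * Ψ (x + t • z, t) :=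
      (hm2.comp (measurable_const.prodMk measurable_id)).const_mul _
    rw [Set.indicator_of_mem hx, ← lintegral_const_mul' _ _ ENNReal.ofReal_ne_top,
      ← lintegral_const_mul' _ _ ENNReal.ofReal_ne_top]
    simp only
    rw [← lintegral_add_left hm4]
    -- The value at `x` is averaged over a window in `t` of length `d x / 4`, whence the factor `4`.
    -- At `y = x + tz` the exit time is `d y = d x - t`, so the window reads `d y < t < 3 d y` and
    -- `d x = d y + t`: this is the shape of `Ψ`.
    have e1 : ENNReal.ofReal (g x ^ 2 * d x ^ (-(2 * σ))) = ∫⁻ t in Set.Ioo (d x / 2) (3 / 4 * d x),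
        ENNReal.ofReal (4 * g x ^ 2 * d x ^ (-1 - 2 * σ)) := by
      rw [setLIntegral_const, Real.volume_Ioo, ← ENNReal.ofReal_mul (by positivity)]
      congr 1
      have : d x ^ (-(2 * σ)) = d x ^ (-1 - 2 * σ) * d x := by
        nth_rw 3 [← Real.rpow_one (d x)]
        rw [← Real.rpow_add hdx]; congr 1; ring
      rw [this]; ring
    rw [e1, ← lintegral_indicator measurableSet_Ioo]
    refine lintegral_mono fun t => ?_
    by_cases ht : t ∈ Set.Ioo (d x / 2) (3 / 4 * d x)
    swap
    · simp [ht]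
    have ht0 : 0 < t := by linarith [ht.1]
    have htd : t < d x := by linarith [ht.2]
    have hy : 0 < g (x + t • z) := lt_of_le_of_ne (hg0 _) (ne_zero_of_lt_exitTime ht0.le htd).symm
    have hdy : d (x + t • z) = d x - t := exitTime_translate (hne x) hgc ht0.le htd
    rw [Set.indicator_of_mem ht]
    have e2 : Ψ (x + t • z, t) =
        ENNReal.ofReal (4 * g (x + t • z) ^ 2 * d x ^ (-1 - 2 * σ)) := by
      rw [hΨ, Set.indicator_of_mem]
      · simp [hdy]
      · refine ⟨hy, ?_⟩
        simp only [hdy, Set.mem_Ioo]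
        constructor <;> linarith [ht.1, ht.2]
    have e3 : rayIntegrand σ g z x t =
        ENNReal.ofReal ((g x - g (x + t • z)) ^ 2 * t ^ (-1 - 2 * σ)) := by
      rw [rayIntegrand, Set.indicator_of_mem]
      exact ⟨hx, ht0, hy⟩
    rw [e2, e3, ← ENNReal.ofReal_mul (by positivity), ← ENNReal.ofReal_mul hc0.le,
      ← ENNReal.ofReal_add (by positivity) (by positivity)]
    apply ENNReal.ofReal_le_ofReal
    have h5 := sq_le_mul_sq_add (g x) (g (x + t • z)) hκ1
    have h6 : d x ^ (-1 - 2 * σ) ≤ t ^ (-1 - 2 * σ) :=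
      Real.rpow_le_rpow_of_nonpos ht0 htd.le (by linarith)
    have h7 : 0 ≤ κ / (κ - 1) * (g x - g (x + t • z)) ^ 2 := by
      have : 0 < κ - 1 := by linarith
      positivity
    have h8 : 0 < d x ^ (-1 - 2 * σ) := by positivity
    rw [hc]
    nlinarith [mul_le_mul_of_nonneg_left h6 h7, mul_le_mul_of_nonneg_right h5 h8.le]
  have hfin : X ≤ ENNReal.ofReal q * X + ENNReal.ofReal c * Z := by
    refine hmain.trans (add_le_add_left ?_ _)
    rw [← hκq, ENNReal.ofReal_mul (by positivity), mul_assoc]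
    gcongr
  -- The term `q X` is moved to the left, which is legitimate because `X` is finite.
  have h9 : ENNReal.ofReal (1 - q) * X ≤ ENNReal.ofReal c * Z := by
    have hqX : ENNReal.ofReal q * X ≠ ∞ := ENNReal.mul_ne_top ENNReal.ofReal_ne_top hXfin
    rw [← ENNReal.add_le_add_iff_left hqX, ← add_mul, ← ENNReal.ofReal_add hq0.le (by linarith)]
    simpa using hfin
  rw [ENNReal.ofReal_div_of_pos (by linarith), ENNReal.mul_comm_div, mul_div_assoc',
    mul_comm, mul_comm Z]
  rw [ENNReal.le_div_iff_mul_le (by simp [hq1]) (by simp)]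
  rwa [mul_comm]

end Hardy

/-! ### From rays to a Faber–Krahn inequality. -/

theorem lintegral_Ioi_rpow_neg {a q : ℝ} (ha : 0 < a) (hq : 0 < q) :
    ∫⁻ t in Set.Ioi a, ENNReal.ofReal (t ^ (-q - 1)) = ENNReal.ofReal (a ^ (-q) / q) := by
  rw [← ofReal_integral_eq_lintegral_ofReal (integrableOn_Ioi_rpow_of_lt (by linarith) ha),
    integral_Ioi_rpow_of_lt (by linarith) ha]
  · congr 1
    rw [sub_add_cancel, neg_div_neg_eq]
  · filter_upwards [self_mem_ae_restrict measurableSet_Ioi] with t ht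
    exact Real.rpow_nonneg (ha.trans ht).le _

theorem lintegral_comp_smul_of_pos {E : Type*} [NormedAddCommGroup E] [NormedSpace ℝ E]
    [FiniteDimensional ℝ E] [MeasureSpace E] [BorelSpace E] [(volume : Measure E).IsAddHaarMeasure]
    {f : E → ℝ≥0∞} (hf : Measurable f) {t : ℝ} (ht : 0 < t) :
    ∫⁻ z, f (t • z) = ENNReal.ofReal (t ^ (-(Module.finrank ℝ E : ℝ))) * ∫⁻ y, f y := by
  rw [← lintegral_map hf (measurable_const_smul t), Measure.map_addHaar_smul _ ht.ne',
    lintegral_smul_measure, smul_eq_mul, Real.rpow_neg ht.le, Real.rpow_natCast, abs_of_pos]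
  positivity

theorem le_ofReal_inv_mul {k : ℝ} (hk : 0 < k) {X Y : ℝ≥0∞} (h : ENNReal.ofReal k * X ≤ Y) :
    X ≤ ENNReal.ofReal k⁻¹ * Y := by
  refine le_trans (le_of_eq ?_) (mul_le_mul_right h _)
  rw [← mul_assoc, ← ENNReal.ofReal_mul (by positivity), inv_mul_cancel₀ hk.ne', ENNReal.ofReal_one,
    one_mul]

section EuclideanHardy

variable {n : ℕ}

local notation "𝔼" => EuclideanSpace ℝ (Fin n)

theorem energy_eq_lintegral (σ : ℝ) {A : Set 𝔼} (hA : MeasurableSet A) {g : 𝔼 → ℝ}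
    (hg : Measurable g) :
    CensoredEnergy.energy σ A g = ∫⁻ x, ∫⁻ y, (A ×ˢ A).indicator (fun z : 𝔼 × 𝔼 =>
      ENNReal.ofReal ((g z.1 - g z.2) ^ 2 / ‖z.1 - z.2‖ ^ ((n : ℝ) + 2 * σ))) (x, y) := by
  have hm : Measurable (fun z : 𝔼 × 𝔼 =>
      ENNReal.ofReal ((g z.1 - g z.2) ^ 2 / ‖z.1 - z.2‖ ^ ((n : ℝ) + 2 * σ))) :=
    ((((hg.comp measurable_fst).sub (hg.comp measurable_snd)).pow_const 2).div
      ((measurable_fst.sub measurable_snd).norm.pow_const _)).ennreal_ofReal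
  rw [CensoredEnergy.energy, ← lintegral_indicator (hA.prod hA), Measure.volume_eq_prod,
    lintegral_prod _ (hm.indicator (hA.prod hA)).aemeasurable]

/-- For fixed `x` and `t`, substitute `y = tz`, with Jacobian `t^(-n)`. The condition `|z| < 1`
becomes `t > |y|`, and integrating `t^(-(n + 2σ) - 1)` over `(|y|, ∞)` yields the kernel with the
factor `1 / (n + 2σ)`. -/
theorem lintegral_rayIntegrand_le {σ : ℝ} (hσ : 0 < σ) {g : 𝔼 → ℝ} (hg : Continuous g) :
    ∫⁻ z in Metric.ball (0 : 𝔼) 1, ∫⁻ x, ∫⁻ t, rayIntegrand σ g z x t ≤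
      ENNReal.ofReal (1 / (n + 2 * σ)) * CensoredEnergy.energy σ {x | 0 < g x} g := by
  classical
  have hgm := hg.measurable
  have hp : 0 < (n : ℝ) + 2 * σ := by positivity
  have hWm : MeasurableSet {x | 0 < g x} := measurableSet_lt measurable_const hgm
  have hrm := measurable_rayIntegrand σ hg
  set F : 𝔼 → 𝔼 → ℝ≥0∞ := fun x y => {y | 0 < g x ∧ 0 < g (x + y)}.indicator
    (fun y => ENNReal.ofReal ((g x - g (x + y)) ^ 2)) y with hF
  have hFm : Measurable fun q : 𝔼 × 𝔼 => F q.1 q.2 := by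
    have h1 : Measurable fun q : 𝔼 × 𝔼 => g q.1 := hgm.comp measurable_fst
    have h2 : Measurable fun q : 𝔼 × 𝔼 => g (q.1 + q.2) := hgm.comp (by fun_prop)
    have : (fun q : 𝔼 × 𝔼 => F q.1 q.2) = {q : 𝔼 × 𝔼 | 0 < g q.1 ∧ 0 < g (q.1 + q.2)}.indicator
        fun q => ENNReal.ofReal ((g q.1 - g (q.1 + q.2)) ^ 2) := by
      ext q; simp only [hF, Set.indicator_apply, Set.mem_ofPred_eq]
    rw [this]
    exact Measurable.indicator ((h1.sub h2).pow_const 2).ennreal_ofReal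
      ((measurableSet_lt measurable_const h1).inter (measurableSet_lt measurable_const h2))
  have hFx : ∀ x, Measurable (F x) := fun x => hFm.comp (measurable_const.prodMk measurable_id)
  -- the inner integral after the substitution `y = t z`
  have hsub : ∀ x, ∀ t : ℝ, ∫⁻ z in Metric.ball (0 : 𝔼) 1, rayIntegrand σ g z x t =
      ∫⁻ y, F x y * (Set.Ioi ‖y‖).indicator
        (fun t => ENNReal.ofReal (t ^ (-((n : ℝ) + 2 * σ) - 1))) t := by
    intro x t
    rcases le_or_gt t 0 with ht | ht
    · have h1 : ∀ z, rayIntegrand σ g z x t = 0 := fun z => by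
        simp [rayIntegrand, not_lt.mpr ht]
      have h2 : ∀ y : 𝔼, t ∉ Set.Ioi ‖y‖ := fun y h =>
        absurd (lt_of_le_of_lt (norm_nonneg y) h) (not_lt.mpr ht)
      simp [h1, h2]
    · have hfm : Measurable fun y => (Metric.ball (0 : 𝔼) t).indicator (F x) y :=
        (hFx x).indicator Metric.isOpen_ball.measurableSet
      have h1 := lintegral_comp_smul_of_pos hfm ht
      rw [finrank_euclideanSpace_fin] at h1
      rw [← lintegral_indicator Metric.isOpen_ball.measurableSet]
      have h2 : ∀ z : 𝔼, (Metric.ball (0 : 𝔼) 1).indicator (fun z => rayIntegrand σ g z x t) z =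
          ENNReal.ofReal (t ^ (-1 - 2 * σ)) * (Metric.ball (0 : 𝔼) t).indicator (F x) (t • z) := by
        intro z
        have h3 : t • z ∈ Metric.ball (0 : 𝔼) t ↔ z ∈ Metric.ball (0 : 𝔼) 1 := by
          simp only [mem_ball_zero_iff, norm_smul, Real.norm_of_nonneg ht.le]
          constructor <;> intro h <;> nlinarith
        simp only [Set.indicator_apply, h3, rayIntegrand, hF, Set.mem_ofPred_eq, ht, true_and]
        split_ifs
        · rw [mul_comm, ENNReal.ofReal_mul' (by positivity)]
        · simp
        · simp
      simp_rw [h2]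
      rw [lintegral_const_mul' _ _ ENNReal.ofReal_ne_top, h1, ← mul_assoc,
        ← ENNReal.ofReal_mul (by positivity), ← Real.rpow_add ht,
        ← lintegral_const_mul' _ _ ENNReal.ofReal_ne_top]
      refine lintegral_congr fun y => ?_
      have e : (-1 - 2 * σ + -(n : ℝ)) = (-((n : ℝ) + 2 * σ) - 1) := by ring
      simp only [Set.indicator_apply, mem_ball_zero_iff, Set.mem_Ioi, e]
      split_ifs
      · rw [mul_comm]
      · simp
  have hIm : Measurable fun q : 𝔼 × 𝔼 × ℝ => F q.1 q.2.1 * (Set.Ioi ‖q.2.1‖).indicator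
        (fun t => ENNReal.ofReal (t ^ (-((n : ℝ) + 2 * σ) - 1))) q.2.2 := by
    refine (hFm.comp (measurable_fst.prodMk (measurable_fst.comp measurable_snd))).mul ?_
    have : (fun q : 𝔼 × 𝔼 × ℝ => (Set.Ioi ‖q.2.1‖).indicator
        (fun t => ENNReal.ofReal (t ^ (-((n : ℝ) + 2 * σ) - 1))) q.2.2) =
        {q : 𝔼 × 𝔼 × ℝ | ‖q.2.1‖ < q.2.2}.indicator
          fun q => ENNReal.ofReal (q.2.2 ^ (-((n : ℝ) + 2 * σ) - 1)) := by
      ext q; simp only [Set.indicator_apply, Set.mem_ofPred_eq, Set.mem_Ioi]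
    rw [this]
    exact Measurable.indicator ((measurable_snd.comp measurable_snd).pow_const _).ennreal_ofReal
      (measurableSet_lt (measurable_fst.comp measurable_snd).norm (measurable_snd.comp
        measurable_snd))
  have hIm' : Measurable fun p : 𝔼 × 𝔼 => ∫⁻ t, rayIntegrand σ g p.1 p.2 t :=
    Measurable.lintegral_prod_right' (f := fun p : (𝔼 × 𝔼) × ℝ => rayIntegrand σ g p.1.1 p.1.2 p.2)
      (hrm.comp (f := fun p : (𝔼 × 𝔼) × ℝ => (p.1.1, p.1.2, p.2)) (by fun_prop))
  rw [lintegral_lintegral_swap (f := fun z x => ∫⁻ t, rayIntegrand σ g z x t) hIm'.aemeasurable]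
  rw [energy_eq_lintegral σ hWm hgm, ← lintegral_const_mul' _ _ ENNReal.ofReal_ne_top]
  refine lintegral_mono fun x => ?_
  rw [lintegral_lintegral_swap (f := fun z t => rayIntegrand σ g z x t)
    (hrm.comp (f := fun q : 𝔼 × ℝ => (q.1, x, q.2)) (by fun_prop)).aemeasurable]
  simp_rw [hsub]
  rw [lintegral_lintegral_swap (f := fun (t : ℝ) (y : 𝔼) => F x y * (Set.Ioi ‖y‖).indicator
        (fun t => ENNReal.ofReal (t ^ (-((n : ℝ) + 2 * σ) - 1))) t)
    (hIm.comp (f := fun q : ℝ × 𝔼 => (x, q.2, q.1)) (by fun_prop)).aemeasurable]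
  rw [← lintegral_const_mul' _ _ ENNReal.ofReal_ne_top]
  conv_rhs => rw [← lintegral_add_left_eq_self _ x]
  refine lintegral_mono fun y => ?_
  have hFtop : F x y ≠ ∞ := by
    simp only [hF, Set.indicator_apply]; split_ifs <;> simp
  rw [lintegral_const_mul' _ _ hFtop, lintegral_indicator measurableSet_Ioi]
  rcases eq_or_ne y 0 with rfl | hy
  · have : F x 0 = 0 := by simp [hF, Set.indicator_apply]
    rw [this, zero_mul]
    exact zero_le
  rw [lintegral_Ioi_rpow_neg (norm_pos_iff.mpr hy) hp]
  simp only [hF, Set.indicator_apply, Set.mem_ofPred_eq, Set.mem_prod]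
  split_ifs
  · rw [← ENNReal.ofReal_mul (by positivity), ← ENNReal.ofReal_mul (by positivity)]
    apply le_of_eq
    congr 1
    rw [sub_add_cancel_left, norm_neg, Real.rpow_neg (norm_nonneg _)]
    have := Real.rpow_pos_of_pos (norm_pos_iff.mpr hy) (n + 2 * σ)
    field_simp
  · simp

/-- With `b` the volume of the unit ball, `s` is the dilation for which half of that volume scales
to exactly `V`. -/
theorem exists_radius {n : ℕ} (hn : (0 : ℝ) < n) {b V : ℝ} (hb : 0 < b) (hV : 0 < V) :
    ∃ s : ℝ, 0 < s ∧ s ^ n = 2 * V / b ∧ ∀ σ : ℝ,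
      b / 2 * (2 / b) ^ (-(2 * σ / n)) * V ^ (-(2 * σ / n)) = s ^ (-(2 * σ)) * (b / 2) := by
  refine ⟨(2 * V / b) ^ (1 / (n : ℝ)), by positivity, ?_, fun σ => ?_⟩
  · rw [← Real.rpow_natCast, ← Real.rpow_mul (by positivity), one_div_mul_cancel hn.ne',
      Real.rpow_one]
  · rw [mul_assoc, ← Real.mul_rpow (by positivity) hV.le, ← Real.rpow_mul (by positivity), mul_comm,
      div_mul_eq_mul_div]
    congr 2; ring

/-- If `Z` is the set of directions not exiting before time `s`, then `x + s Z` lies in the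
positivity set, so `sⁿ |Z| ≤ V`. For `s` as in `exists_radius`, at least half of the unit ball exits
by time `s`, and there the integrand is at least `s^(-2σ)`. -/
theorem exists_lintegral_exitTime_ge (hn : 0 < n) {σ : ℝ} (hσ : 0 < σ) :
    ∃ c : ℝ, 0 < c ∧ ∀ (g : 𝔼 → ℝ) (r V : ℝ) (x : 𝔼), Continuous g → (∀ x, 0 ≤ g x) →
      (∀ x, g x ≠ 0 → ‖x‖ < r) → 0 < V → volume {x | 0 < g x} ≤ ENNReal.ofReal V → 0 < g x →
      ENNReal.ofReal (c * V ^ (-(2 * σ / n))) ≤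
        ∫⁻ z in Metric.ball (0 : 𝔼) 1, ENNReal.ofReal (exitTime g z x ^ (-(2 * σ))) := by
  have : Nonempty (Fin n) := ⟨⟨0, hn⟩⟩
  set B := Metric.ball (0 : 𝔼) 1 with hB
  set b := (volume B).toReal with hb
  have hBtop : volume B ≠ ∞ := measure_ball_lt_top.ne
  have hb0 : 0 < b := ENNReal.toReal_pos (Metric.measure_ball_pos _ _ one_pos).ne' hBtop
  have hBb : volume B = ENNReal.ofReal b := (ENNReal.ofReal_toReal hBtop).symm
  refine ⟨b / 2 * (2 / b) ^ (-(2 * σ / n)), by positivity, fun g r V x hg hg0 hr hV hW hx => ?_⟩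
  have hn' : (0 : ℝ) < n := by exact_mod_cast hn
  obtain ⟨s, hs0, hsn, hs⟩ := exists_radius hn' hb0 hV
  have hdm : Measurable fun z => exitTime g z x := measurable_exitTime_left hg hr x
  set Z : Set 𝔼 := {z | s < exitTime g z x} with hZ
  have hZm : MeasurableSet Z := measurableSet_lt measurable_const hdm
  have hZv : volume Z ≤ ENNReal.ofReal (b / 2) := by
    have h1 : s • Z ⊆ (fun y => x + y) ⁻¹' {x | 0 < g x} := by
      rintro _ ⟨z, hz, rfl⟩
      exact lt_of_le_of_ne (hg0 _) (ne_zero_of_lt_exitTime hs0.le hz).symm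
    have h2 := measure_mono (μ := volume) h1
    rw [measure_preimage_add, Measure.addHaar_smul_of_nonneg _ hs0.le,
      finrank_euclideanSpace_fin, hsn] at h2
    have h3 : ENNReal.ofReal (2 * V / b) * volume Z ≤
        ENNReal.ofReal (2 * V / b) * ENNReal.ofReal (b / 2) := by
      refine (h2.trans hW).trans (le_of_eq ?_)
      rw [← ENNReal.ofReal_mul (by positivity)]
      congr 1; field_simp
    exact (ENNReal.mul_le_mul_iff_right (by simp; positivity) ENNReal.ofReal_ne_top).mp h3
  -- The origin, a null set, is removed because positivity of the exit time needs a ray that leaves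
  -- the support.
  have hv : ENNReal.ofReal (b / 2) ≤ volume (B \ (Z ∪ {0})) := by
    have h1 : volume B ≤ volume (B \ (Z ∪ {0})) + volume (Z ∪ {0}) :=
      (measure_mono fun z hz => by
        by_cases h : z ∈ Z ∪ {0}
        exacts [Or.inr h, Or.inl ⟨hz, h⟩]).trans
        (measure_union_le _ _)
    have h2 : volume (Z ∪ {0}) ≤ ENNReal.ofReal (b / 2) :=
      (measure_union_le _ _).trans (by simpa using hZv)
    have h3 := h1.trans (add_le_add_right h2 _)
    have h4 : ENNReal.ofReal b = ENNReal.ofReal (b / 2) + ENNReal.ofReal (b / 2) := by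
      rw [← ENNReal.ofReal_add (by positivity) (by positivity), add_halves]
    rw [hBb, h4] at h3
    exact (ENNReal.add_le_add_iff_right ENNReal.ofReal_ne_top).mp h3
  calc ENNReal.ofReal (b / 2 * (2 / b) ^ (-(2 * σ / n)) * V ^ (-(2 * σ / n)))
      = ENNReal.ofReal (s ^ (-(2 * σ))) * ENNReal.ofReal (b / 2) := by
        rw [← ENNReal.ofReal_mul (by positivity), hs]
    _ ≤ ENNReal.ofReal (s ^ (-(2 * σ))) * volume (B \ (Z ∪ {0})) := by gcongr
    _ = ∫⁻ z in B \ (Z ∪ {0}), ENNReal.ofReal (s ^ (-(2 * σ))) := by rw [setLIntegral_const]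
    _ ≤ ∫⁻ z in B \ (Z ∪ {0}), ENNReal.ofReal (exitTime g z x ^ (-(2 * σ))) := by
        refine setLIntegral_mono' (Metric.isOpen_ball.measurableSet.diff
          (hZm.union (measurableSet_singleton 0))) fun z hz => ENNReal.ofReal_le_ofReal ?_
        have hz1 : ¬ s < exitTime g z x := fun h => hz.2 (Or.inl h)
        have hz2 : z ≠ 0 := fun h => hz.2 (Or.inr h)
        exact Real.rpow_le_rpow_of_nonpos (exitTime_pos hg (exists_ray_eq_zero hr hz2 x) hx.ne')
          (not_lt.mp hz1) (by linarith)
    _ ≤ _ := lintegral_mono_set Set.sdiff_subset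

/-- A Faber–Krahn inequality for the form restricted to the positivity set. -/
theorem exists_faberKrahn (hn : 0 < n) {σ : ℝ} (hσ : 1 / 2 < σ) (hσ' : σ < 1) :
    ∃ C : ℝ, 0 < C ∧ ∀ (g : 𝔼 → ℝ) (L : NNReal) (r V : ℝ), LipschitzWith L g → (∀ x, 0 ≤ g x) →
      (∀ x, g x ≠ 0 → ‖x‖ < r) → 0 < V → volume {x | 0 < g x} ≤ ENNReal.ofReal V →
      ∫⁻ x, ENNReal.ofReal (g x ^ 2) ≤ ENNReal.ofReal (C * V ^ (2 * σ / n)) *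
        CensoredEnergy.energy σ {x | 0 < g x} g := by
  have : Nonempty (Fin n) := ⟨⟨0, hn⟩⟩
  obtain ⟨c, hc, hcW⟩ := exists_lintegral_exitTime_ge hn (σ := σ) (by linarith)
  obtain ⟨C, hC, hCW⟩ := exists_hardy_ray (E := 𝔼) hσ hσ'
  have hp : 0 < (n : ℝ) + 2 * σ := by positivity
  refine ⟨C * (1 / (n + 2 * σ)) / c, by positivity, fun g L r V hL hg0 hr hV hW => ?_⟩
  have hg := hL.continuous
  have hgm := hg.measurable
  have hWm : MeasurableSet {x | 0 < g x} := measurableSet_lt measurable_const hgm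
  set W := {x | 0 < g x}
  have hdm := measurable_exitTime hg hr
  have h1 : ENNReal.ofReal (c * V ^ (-(2 * σ / n))) * ∫⁻ x, ENNReal.ofReal (g x ^ 2) ≤
      ∫⁻ x in W, ∫⁻ z in Metric.ball (0 : 𝔼) 1,
        ENNReal.ofReal (g x ^ 2 * exitTime g z x ^ (-(2 * σ))) := by
    rw [← lintegral_const_mul' _ _ ENNReal.ofReal_ne_top, ← lintegral_indicator hWm]
    refine lintegral_mono fun x => ?_
    by_cases hx : x ∈ W
    · rw [Set.indicator_of_mem hx]
      simp_rw [ENNReal.ofReal_mul (sq_nonneg (g x))]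
      rw [lintegral_const_mul' _ _ ENNReal.ofReal_ne_top, mul_comm]
      gcongr
      exact hcW g r V x hg hg0 hr hV hW hx
    · have : g x = 0 := le_antisymm (not_lt.mp hx) (hg0 x)
      simp [this]
  have h2 : ∫⁻ x in W, ∫⁻ z in Metric.ball (0 : 𝔼) 1,
        ENNReal.ofReal (g x ^ 2 * exitTime g z x ^ (-(2 * σ))) ≤
      ENNReal.ofReal C * ∫⁻ z in Metric.ball (0 : 𝔼) 1, ∫⁻ x, ∫⁻ t, rayIntegrand σ g z x t := by
    rw [lintegral_lintegral_swap (f := fun x z =>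
      ENNReal.ofReal (g x ^ 2 * exitTime g z x ^ (-(2 * σ))))]
    · rw [← lintegral_const_mul' _ _ ENNReal.ofReal_ne_top]
      refine lintegral_mono_ae ?_
      have : ∀ᵐ z : 𝔼, z ≠ 0 := by simp [ae_iff]
      filter_upwards [ae_restrict_of_ae this] with z hz
      exact hCW g L r z hL hg0 hr hz
    · exact (((hgm.comp measurable_fst).pow_const 2).mul
        ((hdm.comp measurable_swap).pow_const _)).ennreal_ofReal.aemeasurable
  have h3 := (h1.trans h2).trans (mul_le_mul_right (lintegral_rayIntegrand_le (by linarith) hg) _)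
  rw [← mul_assoc, ← ENNReal.ofReal_mul hC.le] at h3
  have hk : 0 < c * V ^ (-(2 * σ / n)) := by positivity
  have h4 : C * (1 / (n + 2 * σ)) / c * V ^ (2 * σ / n) =
      (c * V ^ (-(2 * σ / n)))⁻¹ * (C * (1 / (n + 2 * σ))) := by
    rw [Real.rpow_neg hV.le, mul_inv, inv_inv]; ring
  rw [h4, ENNReal.ofReal_mul (by positivity), mul_assoc]
  exact le_ofReal_inv_mul hk h3

end EuclideanHardy

/-! ### Limits of integrals with an almost dominating function. -/

/-- Reverse Fatou when the bound is a fixed integrable `G` plus a remainder whose integral tends to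
zero: `f k` is replaced by `min (f k) G`, at the cost of the remainder. In the applications `G`
comes from `u` and the remainder from `φ k - u`. -/
theorem limsup_lintegral_le_of_le_add {α : Type*} [MeasurableSpace α] {μ : Measure α}
    {f g' : ℕ → α → ℝ≥0∞} {F G : α → ℝ≥0∞} (hf : ∀ k, Measurable (f k)) (hG : Measurable G)
    (hle : ∀ k, ∀ᵐ x ∂μ, f k x ≤ G x + g' k x) (hGfin : ∫⁻ x, G x ∂μ ≠ ∞)
    (hg' : Tendsto (fun k => ∫⁻ x, g' k x ∂μ) atTop (𝓝 0))
    (hlim : ∀ᵐ x ∂μ, limsup (fun k => f k x) atTop ≤ F x) :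
    limsup (fun k => ∫⁻ x, f k x ∂μ) atTop ≤ ∫⁻ x, F x ∂μ := by
  have hm : ∀ k, Measurable fun x => min (f k x) (G x) := fun k => (hf k).min hG
  have h1 : ∀ k, ∫⁻ x, f k x ∂μ ≤ ∫⁻ x, min (f k x) (G x) ∂μ + ∫⁻ x, g' k x ∂μ := fun k => by
    rw [← lintegral_add_left (hm k)]
    refine lintegral_mono_ae ?_
    filter_upwards [hle k] with x hx
    rcases le_total (f k x) (G x) with h | h
    · rw [min_eq_left h]; exact le_self_add
    · rw [min_eq_right h]; exact hx
  calc limsup (fun k => ∫⁻ x, f k x ∂μ) atTop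
      ≤ limsup (fun k => ∫⁻ x, min (f k x) (G x) ∂μ + ∫⁻ x, g' k x ∂μ) atTop :=
        limsup_le_limsup (Eventually.of_forall h1)
    _ = limsup (fun k => ∫⁻ x, min (f k x) (G x) ∂μ) atTop :=
        ENNReal.limsup_add_of_right_tendsto_zero hg' _
    _ ≤ ∫⁻ x, limsup (fun k => min (f k x) (G x)) atTop ∂μ :=
        limsup_lintegral_le G hm (fun k => ae_of_all _ fun x => min_le_right _ _) hGfin
    _ ≤ ∫⁻ x, F x ∂μ := by
        refine lintegral_mono_ae ?_
        filter_upwards [hlim] with x hx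
        exact (limsup_le_limsup (Eventually.of_forall fun k => min_le_left _ _)).trans hx

theorem tendsto_lintegral_zero_of_le_add {α : Type*} [MeasurableSpace α] {μ : Measure α}
    {f g' : ℕ → α → ℝ≥0∞} {G : α → ℝ≥0∞} (hf : ∀ k, Measurable (f k)) (hG : Measurable G)
    (hle : ∀ k, ∀ᵐ x ∂μ, f k x ≤ G x + g' k x) (hGfin : ∫⁻ x, G x ∂μ ≠ ∞)
    (hg' : Tendsto (fun k => ∫⁻ x, g' k x ∂μ) atTop (𝓝 0))
    (hlim : ∀ᵐ x ∂μ, Tendsto (fun k => f k x) atTop (𝓝 0)) :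
    Tendsto (fun k => ∫⁻ x, f k x ∂μ) atTop (𝓝 0) := by
  have h := limsup_lintegral_le_of_le_add (F := fun _ => 0) hf hG hle hGfin hg'
    (hlim.mono fun x hx => hx.limsup_eq.le)
  rw [lintegral_zero] at h
  exact tendsto_of_le_liminf_of_limsup_le zero_le h

theorem eLpNorm_two_sq {α : Type*} [MeasurableSpace α] (μ : Measure α) (f : α → ℝ) :
    eLpNorm f 2 μ ^ 2 = ∫⁻ x, ENNReal.ofReal (f x ^ 2) ∂μ := by
  have h := eLpNorm_nnreal_pow_eq_lintegral (f := f) (μ := μ) (p := 2) (by norm_num)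
  norm_num at h
  rw [h]
  refine lintegral_congr fun x => ?_
  rw [← ofReal_norm, ← ENNReal.ofReal_pow (norm_nonneg _), Real.norm_eq_abs, sq_abs]

theorem tendsto_eLpNorm_two_zero_iff {α : Type*} [MeasurableSpace α] {μ : Measure α}
    {f : ℕ → α → ℝ} : Tendsto (fun k => eLpNorm (f k) 2 μ) atTop (𝓝 0) ↔
      Tendsto (fun k => ∫⁻ x, ENNReal.ofReal (f k x ^ 2) ∂μ) atTop (𝓝 0) := by
  simp_rw [← eLpNorm_two_sq]
  constructor
  · intro h
    have := ((ENNReal.continuous_pow 2).tendsto 0).comp h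
    simpa [Function.comp_def] using this
  · intro h
    have := ((ENNReal.continuous_rpow_const (y := (1 / 2 : ℝ))).tendsto 0).comp h
    simp only [Function.comp_def,
      ENNReal.zero_rpow_of_pos (show (0 : ℝ) < 1 / 2 by norm_num)] at this
    refine this.congr fun k => ?_
    rw [← ENNReal.rpow_natCast, ← ENNReal.rpow_mul]
    norm_num

/-! ### The kernel and its truncation. -/

section Kernel

variable {n : ℕ}

local notation "𝔼" => EuclideanSpace ℝ (Fin n)

/-- The quotient `c / |x - y|^{n + 2σ}` at `z = (x, y)`. -/
noncomputable def kernelQuot (σ c : ℝ) (z : 𝔼 × 𝔼) : ℝ≥0∞ :=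
  ENNReal.ofReal (c / ‖z.1 - z.2‖ ^ ((n : ℝ) + 2 * σ))

theorem energy_eq_kernelQuot (σ : ℝ) (A : Set 𝔼) (u : 𝔼 → ℝ) :
    CensoredEnergy.energy σ A u =
      ∫⁻ z in A ×ˢ A, kernelQuot σ ((u z.1 - u z.2) ^ 2) z := rfl

theorem kernelQuot_mono (σ : ℝ) {c c' : ℝ} (h : c ≤ c') (z : 𝔼 × 𝔼) :
    kernelQuot σ c z ≤ kernelQuot σ c' z :=
  ENNReal.ofReal_le_ofReal (div_le_div_of_nonneg_right h (by positivity))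

theorem kernelQuot_add (σ : ℝ) {c c' : ℝ} (h : 0 ≤ c) (h' : 0 ≤ c') (z : 𝔼 × 𝔼) :
    kernelQuot σ (c + c') z = kernelQuot σ c z + kernelQuot σ c' z := by
  rw [kernelQuot, add_div, ENNReal.ofReal_add (by positivity) (by positivity)]; rfl

theorem kernelQuot_mul (σ : ℝ) {k : ℝ} (hk : 0 ≤ k) (c : ℝ) (z : 𝔼 × 𝔼) :
    kernelQuot σ (k * c) z = ENNReal.ofReal k * kernelQuot σ c z := by
  rw [kernelQuot, mul_div_assoc, ENNReal.ofReal_mul hk]; rfl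

theorem Measurable.kernelQuot (σ : ℝ) {c : 𝔼 × 𝔼 → ℝ} (hc : Measurable c) :
    Measurable fun z => kernelQuot σ (c z) z :=
  (hc.div ((measurable_fst.sub measurable_snd).norm.pow_const _)).ennreal_ofReal

theorem kernelQuot_swap (σ c : ℝ) (z : 𝔼 × 𝔼) : kernelQuot σ c z.swap = kernelQuot σ c z := by
  simp [kernelQuot, norm_sub_rev]

/-- In polar coordinates the radial integrand is `r^(1 - 2σ)` near zero, integrable as `σ < 1`, and
`r^(-1 - 2σ)` near infinity, integrable as `σ > 0`. -/
theorem lintegral_truncatedKernel_lt_top (hn : 0 < n) {σ : ℝ} (hσ : 0 < σ) (hσ' : σ < 1) :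
    ∫⁻ w : 𝔼, ENNReal.ofReal (min 1 (‖w‖ ^ 2) / ‖w‖ ^ ((n : ℝ) + 2 * σ)) < ∞ := by
  have : Nonempty (Fin n) := ⟨⟨0, hn⟩⟩
  have hn' : (1 : ℝ) ≤ n := by exact_mod_cast hn
  set f : ℝ → ℝ := fun r => min 1 (r ^ 2) / r ^ ((n : ℝ) + 2 * σ) with hf
  have hpow : ∀ r : ℝ, 0 < r → r ^ (n - 1) = r ^ ((n : ℝ) - 1) := fun r hr => by
    rw [← Real.rpow_natCast, Nat.cast_sub hn, Nat.cast_one]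
  have hval : IntegrableOn (fun y : ℝ => y ^ (n - 1) • f y) (Set.Ioi 0) := by
    rw [← Set.Ioc_union_Ioi_eq_Ioi zero_le_one]
    refine IntegrableOn.union ?_ ?_
    · have h1 : IntegrableOn (fun y : ℝ => y ^ (1 - 2 * σ)) (Set.Ioc 0 1) := by
        rw [← intervalIntegrable_iff_integrableOn_Ioc_of_le zero_le_one]
        exact intervalIntegral.intervalIntegrable_rpow' (by linarith)
      refine h1.congr_fun (fun y hy => ?_) measurableSet_Ioc
      have hy0 : 0 < y := hy.1
      have : min 1 (y ^ 2) = y ^ (2 : ℝ) := by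
        rw [min_eq_right (pow_le_one₀ hy0.le hy.2)]; norm_num
      simp only [hf, smul_eq_mul, this, hpow y hy0]
      rw [← Real.rpow_sub hy0, ← Real.rpow_add hy0]; congr 1; ring
    · have h1 : IntegrableOn (fun y : ℝ => y ^ (-1 - 2 * σ)) (Set.Ioi 1) :=
        integrableOn_Ioi_rpow_of_lt (by linarith) one_pos
      refine h1.congr_fun (fun y hy => ?_) measurableSet_Ioi
      have hy1 : (1 : ℝ) < y := hy
      have hy0 : 0 < y := by linarith
      have : min 1 (y ^ 2) = y ^ (0 : ℝ) := by
        rw [min_eq_left (one_le_pow₀ hy1.le), Real.rpow_zero]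
      simp only [hf, smul_eq_mul, this, hpow y hy0]
      rw [← Real.rpow_sub hy0, ← Real.rpow_add hy0]; congr 1; ring
  have h := (integrable_fun_norm_addHaar (volume : Measure 𝔼) (f := f)).mpr
    (by rwa [finrank_euclideanSpace_fin])
  have h2 := h.2
  rw [HasFiniteIntegral] at h2
  refine lt_of_le_of_lt (lintegral_mono fun w => ?_) h2
  exact Real.ofReal_le_enorm _

/-- The integral of the kernel truncated at scale `R`. -/
theorem exists_lintegral_kernelQuot_le (hn : 0 < n) {σ : ℝ} (hσ : 0 < σ) (hσ' : σ < 1) :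
    ∃ J : ℝ, 0 < J ∧ ∀ (R : ℝ) (y : 𝔼), 0 < R →
      ∫⁻ x : 𝔼, kernelQuot σ (min 1 (16 * ‖x - y‖ ^ 2 / R ^ 2)) (x, y) ≤
        ENNReal.ofReal (J * R ^ (-(2 * σ))) := by
  set I := ∫⁻ w : 𝔼, ENNReal.ofReal (min 1 (‖w‖ ^ 2) / ‖w‖ ^ ((n : ℝ) + 2 * σ)) with hI
  have hIfin : I ≠ ∞ := (lintegral_truncatedKernel_lt_top hn hσ hσ').ne
  -- The dilation by `4 / R` reduces to scale one; adding `1` only makes the constant positive.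
  refine ⟨(1 / 4 : ℝ) ^ (-(2 * σ)) * (I.toReal + 1), by positivity, fun R y hR => ?_⟩
  have h1 : ∫⁻ x : 𝔼, kernelQuot σ (min 1 (16 * ‖x - y‖ ^ 2 / R ^ 2)) (x, y) =
      ∫⁻ w : 𝔼, ENNReal.ofReal (min 1 (16 * ‖w‖ ^ 2 / R ^ 2) / ‖w‖ ^ ((n : ℝ) + 2 * σ)) :=
    lintegral_sub_right_eq_self (fun w : 𝔼 =>
      ENNReal.ofReal (min 1 (16 * ‖w‖ ^ 2 / R ^ 2) / ‖w‖ ^ ((n : ℝ) + 2 * σ))) y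
  have hm : Measurable fun w : 𝔼 =>
      ENNReal.ofReal (min 1 (‖w‖ ^ 2) / ‖w‖ ^ ((n : ℝ) + 2 * σ)) := by fun_prop
  have ht : 0 < 4 / R := by positivity
  have h2 := lintegral_comp_smul_of_pos hm ht
  rw [finrank_euclideanSpace_fin] at h2
  have h3 : ∀ w : 𝔼, ENNReal.ofReal (min 1 (16 * ‖w‖ ^ 2 / R ^ 2) / ‖w‖ ^ ((n : ℝ) + 2 * σ)) =
      ENNReal.ofReal ((4 / R) ^ ((n : ℝ) + 2 * σ)) *
      ENNReal.ofReal (min 1 (‖(4 / R) • w‖ ^ 2) / ‖(4 / R) • w‖ ^ ((n : ℝ) + 2 * σ)) := by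
    intro w
    rw [← ENNReal.ofReal_mul (by positivity), norm_smul, Real.norm_of_nonneg ht.le,
      Real.mul_rpow ht.le (norm_nonneg w)]
    have e : 16 * ‖w‖ ^ 2 / R ^ 2 = (4 / R * ‖w‖) ^ 2 := by ring
    rw [e]
    have := Real.rpow_pos_of_pos ht ((n : ℝ) + 2 * σ)
    congr 1
    rw [← mul_div_assoc, mul_div_mul_left _ _ this.ne']
  rw [h1]
  simp_rw [h3]
  rw [lintegral_const_mul' _ _ ENNReal.ofReal_ne_top, h2, ← mul_assoc,
    ← ENNReal.ofReal_mul (by positivity), ← Real.rpow_add ht, mul_assoc, mul_comm _ (R ^ _),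
    ← mul_assoc, ENNReal.ofReal_mul (by positivity)]
  refine mul_le_mul' (ENNReal.ofReal_le_ofReal (le_of_eq ?_)) ?_
  · rw [mul_comm, ← Real.mul_rpow (by norm_num) hR.le, add_neg_cancel_comm,
      Real.rpow_neg (by positivity), ← Real.inv_rpow (by positivity)]
    congr 1
    field_simp
  · rw [← hI]
    exact ENNReal.le_ofReal_iff_toReal_le hIfin (by positivity) |>.mpr (by linarith)

end Kernel

/-! ### Cutoffs, test functions and finiteness of energies. -/

section Approximation

variable {n : ℕ}

local notation "𝔼" => EuclideanSpace ℝ (Fin n)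

/-- A cutoff function with values in `[0, 1]` varying at scale `R`. -/
structure IsCutoff (R : ℝ) (ζ : 𝔼 → ℝ) : Prop where
  pos : 0 < R
  nonneg : ∀ x, 0 ≤ ζ x
  le_one : ∀ x, ζ x ≤ 1
  lip : ∀ x y, |ζ x - ζ y| ≤ 4 / R * ‖x - y‖

theorem IsCutoff.lipschitzWith {R : ℝ} {ζ : 𝔼 → ℝ} (h : IsCutoff R ζ) :
    LipschitzWith (4 / R).toNNReal ζ :=
  LipschitzWith.of_dist_le_mul fun x y => by
    rw [Real.dist_eq, dist_eq_norm, Real.coe_toNNReal _ (div_nonneg (by norm_num) h.pos.le)]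
    exact h.lip x y

theorem IsCutoff.measurable {R : ℝ} {ζ : 𝔼 → ℝ} (h : IsCutoff R ζ) : Measurable ζ :=
  h.lipschitzWith.continuous.measurable

theorem IsCutoff.sq_sub_le {R : ℝ} {ζ : 𝔼 → ℝ} (h : IsCutoff R ζ) (x y : 𝔼) :
    (ζ x - ζ y) ^ 2 ≤ min 1 (16 * ‖x - y‖ ^ 2 / R ^ 2) := by
  refine le_min ?_ ?_
  · rw [sq_le_one_iff_abs_le_one, abs_le]
    constructor <;> linarith [h.nonneg x, h.nonneg y, h.le_one x, h.le_one y]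
  · calc (ζ x - ζ y) ^ 2 = |ζ x - ζ y| ^ 2 := (sq_abs _).symm
      _ ≤ (4 / R * ‖x - y‖) ^ 2 := by gcongr; exact h.lip x y
      _ = _ := by ring

theorem IsCutoff.const_mul {R : ℝ} {ζ : 𝔼 → ℝ} (h : IsCutoff R ζ) {t : ℝ} (ht : 0 ≤ t)
    (ht' : t ≤ 1) : IsCutoff R fun x => t * ζ x where
  pos := h.pos
  nonneg x := mul_nonneg ht (h.nonneg x)
  le_one x := mul_le_one₀ ht' (h.nonneg x) (h.le_one x)
  lip x y := by
    rw [← mul_sub, abs_mul, abs_of_nonneg ht]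
    exact (mul_le_of_le_one_left (abs_nonneg _) ht').trans (h.lip x y)

/-- The variations of a minimizer involve `η²`. Squaring at most doubles the Lipschitz constant,
hence the scale `R / 2`. -/
theorem IsCutoff.sq {R : ℝ} {ζ : 𝔼 → ℝ} (h : IsCutoff R ζ) :
    IsCutoff (R / 2) fun x => ζ x ^ 2 where
  pos := half_pos h.pos
  nonneg x := sq_nonneg _
  le_one x := pow_le_one₀ (h.nonneg x) (h.le_one x)
  lip x y := by
    have h1 : |ζ x + ζ y| ≤ 2 := by
      rw [abs_of_nonneg (add_nonneg (h.nonneg x) (h.nonneg y))]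
      linarith [h.le_one x, h.le_one y]
    rw [sq_sub_sq, abs_mul]
    calc |ζ x + ζ y| * |ζ x - ζ y| ≤ 2 * (4 / R * ‖x - y‖) :=
          mul_le_mul h1 (h.lip x y) (abs_nonneg _) (by norm_num)
      _ = _ := by field_simp

theorem lintegral_kernelQuot_mul_le {σ J R : ℝ}
    (hJ : ∀ y : 𝔼, ∫⁻ x : 𝔼, kernelQuot σ (min 1 (16 * ‖x - y‖ ^ 2 / R ^ 2)) (x, y) ≤
        ENNReal.ofReal (J * R ^ (-(2 * σ)))) {h : 𝔼 → ℝ} (hh : Measurable h) :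
    ∫⁻ z : 𝔼 × 𝔼, kernelQuot σ (min 1 (16 * ‖z.1 - z.2‖ ^ 2 / R ^ 2) * h z.2 ^ 2) z ≤
      ENNReal.ofReal (J * R ^ (-(2 * σ))) * ∫⁻ y, ENNReal.ofReal (h y ^ 2) := by
  have h1 : Measurable fun z : 𝔼 × 𝔼 => h z.2 := hh.comp measurable_snd
  have h2 : Measurable fun z : 𝔼 × 𝔼 => min 1 (16 * ‖z.1 - z.2‖ ^ 2 / R ^ 2) := by fun_prop
  have hm : Measurable fun z : 𝔼 × 𝔼 =>
      kernelQuot σ (min 1 (16 * ‖z.1 - z.2‖ ^ 2 / R ^ 2) * h z.2 ^ 2) z :=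
    Measurable.kernelQuot σ (h2.mul (h1.pow_const 2))
  rw [Measure.volume_eq_prod, lintegral_prod_symm _ hm.aemeasurable,
    ← lintegral_const_mul' _ _ ENNReal.ofReal_ne_top]
  refine lintegral_mono fun y => ?_
  simp_rw [mul_comm (min _ _) (h y ^ 2), kernelQuot_mul σ (sq_nonneg (h y))]
  rw [lintegral_const_mul' _ _ ENNReal.ofReal_ne_top, mul_comm]
  gcongr
  exact hJ y

theorem IsCutoff.lintegral_kernelQuot_le {σ J R : ℝ} {ζ : 𝔼 → ℝ} (hζ : IsCutoff R ζ)
    (hJ : ∀ y : 𝔼, ∫⁻ x : 𝔼, kernelQuot σ (min 1 (16 * ‖x - y‖ ^ 2 / R ^ 2)) (x, y) ≤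
        ENNReal.ofReal (J * R ^ (-(2 * σ)))) {h : 𝔼 → ℝ} (hh : Measurable h) :
    ∫⁻ z : 𝔼 × 𝔼, kernelQuot σ ((ζ z.1 - ζ z.2) ^ 2 * h z.2 ^ 2) z ≤
      ENNReal.ofReal (J * R ^ (-(2 * σ))) * ∫⁻ y, ENNReal.ofReal (h y ^ 2) := by
  have h1 := lintegral_kernelQuot_mul_le (σ := σ) (J := J) (R := R) hJ hh
  refine le_trans (lintegral_mono fun z => ?_) h1
  have h2 := hζ.sq_sub_le z.1 z.2
  exact kernelQuot_mono σ (mul_le_mul_of_nonneg_right h2 (sq_nonneg _)) z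

/-- Split `α a' - β b' = α (a' - b') + (α - β) b'`. Here `a', b'` stand for images of `a, b` under a
1-Lipschitz map fixing `0`, so the bound serves the exact truncation and its smooth approximations
alike. -/
theorem sq_cutoff_mul_sub_le {α β a b a' b' : ℝ} (hα : 0 ≤ α) (hα' : α ≤ 1)
    (h1 : |a' - b'| ≤ |a - b|) (h2 : |b'| ≤ |b|) :
    (α * a' - β * b') ^ 2 ≤ 2 * (a - b) ^ 2 + 2 * ((α - β) ^ 2 * b ^ 2) := by
  have h1' := sq_le_sq.mpr h1
  have h2' := sq_le_sq.mpr h2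
  have e : α * a' - β * b' = α * (a' - b') + (α - β) * b' := by ring
  have h3 : α ^ 2 * (a' - b') ^ 2 ≤ 1 * (a - b) ^ 2 :=
    mul_le_mul (pow_le_one₀ hα hα') h1' (sq_nonneg _) zero_le_one
  have h4 : (α - β) ^ 2 * b' ^ 2 ≤ (α - β) ^ 2 * b ^ 2 := by gcongr
  rw [e]
  nlinarith [sq_nonneg (α * (a' - b') - (α - β) * b')]

theorem sq_sub_cutoff_mul_sub_le {α β a b a' b' : ℝ} (hα : 0 ≤ α) (hα' : α ≤ 1)
    (h1 : |a' - b'| ≤ |a - b|) (h2 : |b'| ≤ |b|) :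
    ((a - α * a') - (b - β * b')) ^ 2 ≤ 6 * (a - b) ^ 2 + 4 * ((α - β) ^ 2 * b ^ 2) := by
  have := sq_cutoff_mul_sub_le (β := β) hα hα' h1 h2
  nlinarith [sq_nonneg ((a - b) + (α * a' - β * b'))]

theorem CensoredEnergy.MemH0.exists_approx {σ : ℝ} {Ω : Set 𝔼} {u : 𝔼 → ℝ}
    (hu : CensoredEnergy.MemH0 σ Ω u) :
    ∃ φ : ℕ → 𝔼 → ℝ, (∀ k, CensoredEnergy.IsTest Ω (φ k)) ∧
      Tendsto (fun k => CensoredEnergy.energy σ Ω (φ k - u)) atTop (𝓝 0) ∧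
      Tendsto (fun k => ∫⁻ x, ENNReal.ofReal ((φ k x - u x) ^ 2)) atTop (𝓝 0) ∧
      ∀ᵐ x, Tendsto (fun k => φ k x) atTop (𝓝 (u x)) := by
  obtain ⟨φ, h1, h2, h3⟩ := hu.approx
  have h4 : TendstoInMeasure volume φ atTop u :=
    tendstoInMeasure_of_tendsto_eLpNorm (p := 2) (by norm_num)
      (fun k => (h1 k).contDiff.continuous.aestronglyMeasurable) hu.memLp.1 h3
  obtain ⟨s, hs, hae⟩ := h4.exists_seq_tendsto_ae
  exact ⟨fun k => φ (s k), fun k => h1 _, h2.comp hs.tendsto_atTop,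
    (tendsto_eLpNorm_two_zero_iff.mp h3).comp hs.tendsto_atTop, hae⟩

theorem CensoredEnergy.IsTest.measurable {Ω : Set 𝔼} {φ : 𝔼 → ℝ} (h : CensoredEnergy.IsTest Ω φ) :
    Measurable φ := h.contDiff.continuous.measurable

theorem CensoredEnergy.IsTest.eq_zero {Ω : Set 𝔼} {φ : 𝔼 → ℝ} (h : CensoredEnergy.IsTest Ω φ)
    {x : 𝔼} (hx : x ∉ Ω) : φ x = 0 :=
  image_eq_zero_of_notMem_tsupport fun h' => hx (h.tsupport_subset h')

theorem CensoredEnergy.IsTest.exists_lipschitzWith {Ω : Set 𝔼} {φ : 𝔼 → ℝ}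
    (h : CensoredEnergy.IsTest Ω φ) : ∃ L, LipschitzWith L φ :=
  h.contDiff.lipschitzWith_of_hasCompactSupport h.hasCompactSupport one_ne_zero

theorem energy_lt_top_of_isTest (hn : 0 < n) {σ : ℝ} (hσ : 0 < σ) (hσ' : σ < 1) {Ω : Set 𝔼}
    {A : Set 𝔼} {φ : 𝔼 → ℝ} (h : CensoredEnergy.IsTest Ω φ) (hA : volume A < ∞)
    (hAm : MeasurableSet A) : CensoredEnergy.energy σ A φ < ∞ := by
  obtain ⟨J, hJ0, hJ⟩ := exists_lintegral_kernelQuot_le hn hσ hσ'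
  obtain ⟨L, hL⟩ := h.exists_lipschitzWith
  obtain ⟨M, hM⟩ := h.hasCompactSupport.exists_bound_of_continuous h.contDiff.continuous
  have hM0 : 0 ≤ M := (norm_nonneg _).trans (hM 0)
  set k : ℝ := 4 * M ^ 2 + (L : ℝ) ^ 2
  have hk : 0 ≤ k := by positivity
  have hb : ∀ z : 𝔼 × 𝔼, (φ z.1 - φ z.2) ^ 2 ≤ k * min 1 (16 * ‖z.1 - z.2‖ ^ 2 / 4 ^ 2) := by
    intro z
    have h1 := hM z.1
    have h2 := hM z.2
    rw [Real.norm_eq_abs, abs_le] at h1 h2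
    have h3 := hL.dist_le_mul z.1 z.2
    rw [Real.dist_eq, dist_eq_norm] at h3
    have h4 : (φ z.1 - φ z.2) ^ 2 ≤ (L * ‖z.1 - z.2‖) ^ 2 := by
      rw [← sq_abs]; gcongr
    have e : (16 : ℝ) * ‖z.1 - z.2‖ ^ 2 / 4 ^ 2 = ‖z.1 - z.2‖ ^ 2 := by ring
    rw [e]
    rcases min_choice 1 (‖z.1 - z.2‖ ^ 2) with h5 | h5 <;> rw [h5]
    · have h6 : (φ z.1 - φ z.2) ^ 2 ≤ (2 * M) ^ 2 := by
        apply sq_le_sq' <;> linarith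
      nlinarith [sq_nonneg (L : ℝ)]
    · nlinarith [sq_nonneg M, mul_nonneg (sq_nonneg M) (sq_nonneg ‖z.1 - z.2‖)]
  -- The indicator of `A` plays the part of the square integrable factor in
  -- `lintegral_kernelQuot_mul_le`; the scale `R = 4` turns `16 |x - y|² / R²` into `|x - y|²`.
  have hone : Measurable (A.indicator (1 : 𝔼 → ℝ)) := measurable_one.indicator hAm
  calc CensoredEnergy.energy σ A φ
      = ∫⁻ z in A ×ˢ A, kernelQuot σ ((φ z.1 - φ z.2) ^ 2) z := rfl
    _ ≤ ∫⁻ z in A ×ˢ A, ENNReal.ofReal k *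
          kernelQuot σ (min 1 (16 * ‖z.1 - z.2‖ ^ 2 / 4 ^ 2) * A.indicator 1 z.2 ^ 2) z := by
        refine setLIntegral_mono' (hAm.prod hAm) fun z hz => ?_
        rw [← kernelQuot_mul σ hk, Set.indicator_of_mem hz.2]
        exact kernelQuot_mono σ (by simpa using hb z) z
    _ ≤ ∫⁻ z, ENNReal.ofReal k *
          kernelQuot σ (min 1 (16 * ‖z.1 - z.2‖ ^ 2 / 4 ^ 2) * A.indicator 1 z.2 ^ 2) z :=
        setLIntegral_le_lintegral _ _
    _ ≤ ENNReal.ofReal k * (ENNReal.ofReal (J * 4 ^ (-(2 * σ))) *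
          ∫⁻ y, ENNReal.ofReal (A.indicator 1 y ^ 2)) := by
        rw [lintegral_const_mul' _ _ ENNReal.ofReal_ne_top]
        gcongr
        exact lintegral_kernelQuot_mul_le (fun y => hJ 4 y (by norm_num)) hone
    _ < ∞ := by
        refine ENNReal.mul_lt_top ENNReal.ofReal_lt_top
          (ENNReal.mul_lt_top ENNReal.ofReal_lt_top ?_)
        refine lt_of_le_of_lt (le_of_eq ?_) hA
        rw [← lintegral_indicator_one hAm]
        refine lintegral_congr fun y => ?_
        by_cases hy : y ∈ A <;> simp [hy]

theorem CensoredEnergy.MemH0.energy_lt_top (hn : 0 < n) {σ : ℝ} (hσ : 0 < σ) (hσ' : σ < 1)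
    {Ω : Set 𝔼} {u : 𝔼 → ℝ} (hu : CensoredEnergy.MemH0 σ Ω u) (hΩ : volume Ω < ∞)
    (hΩm : MeasurableSet Ω) : CensoredEnergy.energy σ Ω u < ∞ := by
  obtain ⟨φ, h1, h2, -, -⟩ := hu.exists_approx
  obtain ⟨k, hk⟩ := (h2.eventually (gt_mem_nhds (show (0 : ℝ≥0∞) < 1 by norm_num))).exists
  have hφ := energy_lt_top_of_isTest hn hσ hσ' (h1 k) hΩ hΩm
  have hle : CensoredEnergy.energy σ Ω u ≤
      ENNReal.ofReal 2 * CensoredEnergy.energy σ Ω (φ k) +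
      ENNReal.ofReal 2 * CensoredEnergy.energy σ Ω (φ k - u) := by
    simp only [energy_eq_kernelQuot]
    have hm := (h1 k).measurable
    have hm' : Measurable fun z : 𝔼 × 𝔼 =>
        ENNReal.ofReal 2 * kernelQuot σ ((φ k z.1 - φ k z.2) ^ 2) z :=
      (Measurable.kernelQuot σ (((hm.comp measurable_fst).sub (hm.comp measurable_snd)).pow_const
        2)).const_mul _
    rw [← lintegral_const_mul' _ _ ENNReal.ofReal_ne_top,
      ← lintegral_const_mul' _ _ ENNReal.ofReal_ne_top, ← lintegral_add_left hm']
    refine lintegral_mono fun z => ?_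
    simp only [Pi.sub_apply]
    rw [← kernelQuot_mul σ (by norm_num), ← kernelQuot_mul σ (by norm_num),
      ← kernelQuot_add σ (by positivity) (by positivity)]
    refine kernelQuot_mono σ ?_ z
    nlinarith [sq_nonneg ((φ k z.1 - φ k z.2) + ((φ k z.1 - u z.1) - (φ k z.2 - u z.2)))]
  refine hle.trans_lt (ENNReal.add_lt_top.mpr ⟨ENNReal.mul_lt_top ENNReal.ofReal_lt_top hφ,
    ENNReal.mul_lt_top ENNReal.ofReal_lt_top (hk.trans ENNReal.one_lt_top)⟩)

end Approximation

/-! ### Smoothed truncations and admissibility of the competitors. -/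

theorem hasDerivAt_max_zero_sq (s : ℝ) :
    HasDerivAt (fun s : ℝ => max s 0 ^ 2) (2 * max s 0) s := by
  rcases lt_trichotomy s 0 with h | rfl | h
  · have : (fun s : ℝ => max s 0 ^ 2) =ᶠ[𝓝 s] fun _ => 0 := by
      filter_upwards [gt_mem_nhds h] with r hr
      simp [max_eq_right hr.le]
    simpa [max_eq_right h.le] using (hasDerivAt_const s (0 : ℝ)).congr_of_eventuallyEq this
  · rw [hasDerivAt_iff_isLittleO_nhds_zero]
    simp only [zero_add, max_self, mul_zero, smul_zero, sub_zero, ne_eq, OfNat.ofNat_ne_zero,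
      not_false_eq_true, zero_pow]
    have h1 : (fun h : ℝ => max h 0 ^ 2) =O[𝓝 0] fun h => h ^ 2 :=
      Asymptotics.IsBigO.of_bound 1 (Eventually.of_forall fun h => by
        rw [one_mul, Real.norm_of_nonneg (sq_nonneg _), Real.norm_of_nonneg (sq_nonneg _), sq_le_sq,
          abs_of_nonneg (le_max_right _ _)]
        exact max_le (le_abs_self _) (abs_nonneg _))
    refine h1.trans_isLittleO ?_
    simpa using Asymptotics.isLittleO_pow_id (𝕜 := ℝ) (n := 2) (by norm_num)
  · have : (fun s : ℝ => max s 0 ^ 2) =ᶠ[𝓝 s] fun s => s ^ 2 := by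
      filter_upwards [lt_mem_nhds h] with r hr
      rw [max_eq_left hr.le]
    simpa [max_eq_left h.le] using (hasDerivAt_pow 2 s).congr_of_eventuallyEq this

theorem contDiff_max_zero_sq : ContDiff ℝ 1 fun s : ℝ => max s 0 ^ 2 := by
  rw [contDiff_one_iff_deriv]
  refine ⟨fun s => (hasDerivAt_max_zero_sq s).differentiableAt, ?_⟩
  rw [show deriv (fun s : ℝ => max s 0 ^ 2) = fun s => 2 * max s 0 from
    funext fun s => (hasDerivAt_max_zero_sq s).deriv]
  fun_prop

/-- A `C¹` approximation of `s ↦ (s - K)₊`. -/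
noncomputable def smoothExcess (K ε s : ℝ) : ℝ := √(max (s - K) 0 ^ 2 + ε ^ 2) - ε

theorem contDiff_smoothExcess (K : ℝ) {ε : ℝ} (hε : 0 < ε) : ContDiff ℝ 1 (smoothExcess K ε) := by
  have h1 : ContDiff ℝ 1 fun s : ℝ => max (s - K) 0 ^ 2 + ε ^ 2 :=
    (contDiff_max_zero_sq.comp (contDiff_id.sub contDiff_const)).add contDiff_const
  exact (h1.sqrt fun s => by positivity).sub contDiff_const

theorem abs_max_sub_sub_le (K s s' : ℝ) : |max (s - K) 0 - max (s' - K) 0| ≤ |s - s'| := by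
  simpa using abs_max_sub_max_le_abs (s - K) (s' - K) 0

theorem abs_sqrt_sq_add_sub_le {a b ε : ℝ} (hε : 0 < ε) :
    |√(a ^ 2 + ε ^ 2) - √(b ^ 2 + ε ^ 2)| ≤ |a - b| := by
  have h1 : 0 < √(a ^ 2 + ε ^ 2) := by positivity
  have h2 : 0 < √(b ^ 2 + ε ^ 2) := by positivity
  have e1 := Real.sq_sqrt (show 0 ≤ a ^ 2 + ε ^ 2 by positivity)
  have e2 := Real.sq_sqrt (show 0 ≤ b ^ 2 + ε ^ 2 by positivity)
  have h3 : |a| ≤ √(a ^ 2 + ε ^ 2) := Real.abs_le_sqrt (by nlinarith)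
  have h4 : |b| ≤ √(b ^ 2 + ε ^ 2) := Real.abs_le_sqrt (by nlinarith)
  have key : |√(a ^ 2 + ε ^ 2) - √(b ^ 2 + ε ^ 2)| * (√(a ^ 2 + ε ^ 2) + √(b ^ 2 + ε ^ 2)) =
      |a - b| * |a + b| := by
    rw [← abs_mul, ← abs_of_pos (add_pos h1 h2), ← abs_mul]
    congr 1; nlinarith
  have h5 : |a + b| ≤ √(a ^ 2 + ε ^ 2) + √(b ^ 2 + ε ^ 2) :=
    (abs_add_le a b).trans (add_le_add h3 h4)
  refine le_of_mul_le_mul_right ?_ (add_pos h1 h2)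
  rw [key]
  exact mul_le_mul_of_nonneg_left h5 (abs_nonneg _)

theorem abs_smoothExcess_sub_le (K : ℝ) {ε : ℝ} (hε : 0 < ε) (s s' : ℝ) :
    |smoothExcess K ε s - smoothExcess K ε s'| ≤ |s - s'| := by
  rw [smoothExcess, smoothExcess, sub_sub_sub_cancel_right]
  exact (abs_sqrt_sq_add_sub_le hε).trans (abs_max_sub_sub_le K s s')

/-- Subtracting `ε` makes the smoothing vanish at `0`, so composing it with a test function does not
enlarge the support. -/
theorem smoothExcess_zero {K ε : ℝ} (hK : 0 ≤ K) (hε : 0 < ε) : smoothExcess K ε 0 = 0 := by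
  rw [smoothExcess, max_eq_right (by linarith)]
  simp [Real.sqrt_sq hε.le]

theorem abs_smoothExcess_le {K ε : ℝ} (hK : 0 ≤ K) (hε : 0 < ε) (s : ℝ) :
    |smoothExcess K ε s| ≤ |s| := by
  simpa [smoothExcess_zero hK hε] using abs_smoothExcess_sub_le K hε s 0

theorem abs_max_sub_zero_le {K : ℝ} (hK : 0 ≤ K) (s : ℝ) : |max (s - K) 0| ≤ |s| := by
  simpa [max_eq_right (show -K ≤ 0 by linarith)] using abs_max_sub_sub_le K s 0

theorem abs_smoothExcess_sub_max_le {K ε : ℝ} (hε : 0 < ε) (s : ℝ) :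
    |smoothExcess K ε s - max (s - K) 0| ≤ ε := by
  set a := max (s - K) 0
  have ha : 0 ≤ a := le_max_right _ _
  have h1 : a ≤ √(a ^ 2 + ε ^ 2) := Real.le_sqrt_of_sq_le (by nlinarith)
  have h2 : √(a ^ 2 + ε ^ 2) ≤ a + ε := Real.sqrt_le_iff.mpr ⟨by linarith, by nlinarith⟩
  rw [smoothExcess, abs_le]
  constructor <;> linarith

theorem tendsto_smoothExcess {K : ℝ} {ε s : ℕ → ℝ} {s₀ : ℝ} (hε : ∀ k, 0 < ε k)
    (h : Tendsto ε atTop (𝓝 0)) (hs : Tendsto s atTop (𝓝 s₀)) :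
    Tendsto (fun k => smoothExcess K (ε k) (s k)) atTop (𝓝 (max (s₀ - K) 0)) := by
  have h1 : Tendsto (fun k => max (s k - K) 0) atTop (𝓝 (max (s₀ - K) 0)) :=
    (hs.sub_const K).max tendsto_const_nhds
  have h2 : Tendsto (fun k => smoothExcess K (ε k) (s k) - max (s k - K) 0) atTop (𝓝 0) :=
    squeeze_zero_norm (fun k => abs_smoothExcess_sub_max_le (hε k) (s k)) h
  simpa using h2.add h1

section Competitor

variable {n : ℕ}

local notation "𝔼" => EuclideanSpace ℝ (Fin n)

theorem ae_prod_of_ae {p q : 𝔼 → Prop} (hp : ∀ᵐ x, p x) (hq : ∀ᵐ x, q x) (A : Set (𝔼 × 𝔼)) :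
    ∀ᵐ z ∂(volume.restrict A : Measure (𝔼 × 𝔼)), p z.1 ∧ q z.2 := by
  refine ae_restrict_of_ae ?_
  have h1 := Measure.quasiMeasurePreserving_fst (μ := (volume : Measure 𝔼))
    (ν := (volume : Measure 𝔼)) |>.ae hp
  have h2 := Measure.quasiMeasurePreserving_snd (μ := (volume : Measure 𝔼))
    (ν := (volume : Measure 𝔼)) |>.ae hq
  exact h1.and h2

theorem tendsto_kernelQuot_zero (σ : ℝ) {c : ℕ → ℝ} (h : Tendsto c atTop (𝓝 0)) (z : 𝔼 × 𝔼) :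
    Tendsto (fun k => kernelQuot σ (c k) z) atTop (𝓝 0) := by
  have := (ENNReal.continuous_ofReal.tendsto _).comp
    (h.div_const (‖z.1 - z.2‖ ^ ((n : ℝ) + 2 * σ)))
  simpa [Function.comp_def, kernelQuot] using this

/-- Domination of the form along a sequence converging to `u`, with weights from a cutoff. -/
theorem tendsto_lintegral_remainder {σ J R : ℝ} {ζ : 𝔼 → ℝ} (hζ : IsCutoff R ζ)
    (hJ : ∀ y : 𝔼, ∫⁻ x : 𝔼, kernelQuot σ (min 1 (16 * ‖x - y‖ ^ 2 / R ^ 2)) (x, y) ≤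
        ENNReal.ofReal (J * R ^ (-(2 * σ)))) {Ω : Set 𝔼} {φ : ℕ → 𝔼 → ℝ} {u : 𝔼 → ℝ}
    (hφm : ∀ k, Measurable (φ k)) (hum : Measurable u)
    (h1 : Tendsto (fun k => CensoredEnergy.energy σ Ω (φ k - u)) atTop (𝓝 0))
    (h2 : Tendsto (fun k => ∫⁻ x, ENNReal.ofReal ((φ k x - u x) ^ 2)) atTop (𝓝 0))
    {a b : ℝ} (ha : 0 ≤ a) (hb : 0 ≤ b) :
    Tendsto (fun k => ∫⁻ z in Ω ×ˢ Ω, kernelQuot σ (a * ((φ k z.1 - u z.1) - (φ k z.2 - u z.2)) ^ 2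
      + b * ((ζ z.1 - ζ z.2) ^ 2 * (φ k z.2 - u z.2) ^ 2)) z) atTop (𝓝 0) := by
  have hle : ∀ k, ∫⁻ z in Ω ×ˢ Ω, kernelQuot σ (a * ((φ k z.1 - u z.1) - (φ k z.2 - u z.2)) ^ 2
      + b * ((ζ z.1 - ζ z.2) ^ 2 * (φ k z.2 - u z.2) ^ 2)) z ≤
      ENNReal.ofReal a * CensoredEnergy.energy σ Ω (φ k - u) + ENNReal.ofReal b *
        (ENNReal.ofReal (J * R ^ (-(2 * σ))) * ∫⁻ x, ENNReal.ofReal ((φ k x - u x) ^ 2)) := by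
    intro k
    have hm : Measurable fun x => φ k x - u x := (hφm k).sub hum
    have hm' : Measurable fun z : 𝔼 × 𝔼 => ENNReal.ofReal a *
        kernelQuot σ (((φ k z.1 - u z.1) - (φ k z.2 - u z.2)) ^ 2) z :=
      (Measurable.kernelQuot σ (((hm.comp measurable_fst).sub
        (hm.comp measurable_snd)).pow_const 2)).const_mul _
    have h3 := hζ.lintegral_kernelQuot_le hJ hm
    calc _ = ∫⁻ z in Ω ×ˢ Ω, (ENNReal.ofReal a *
          kernelQuot σ (((φ k z.1 - u z.1) - (φ k z.2 - u z.2)) ^ 2) z + ENNReal.ofReal b *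
          kernelQuot σ ((ζ z.1 - ζ z.2) ^ 2 * (φ k z.2 - u z.2) ^ 2) z) := by
          refine lintegral_congr fun z => ?_
          rw [kernelQuot_add σ (by positivity) (by positivity), kernelQuot_mul σ ha,
            kernelQuot_mul σ hb]
      _ = ENNReal.ofReal a * CensoredEnergy.energy σ Ω (φ k - u) + ENNReal.ofReal b *
          ∫⁻ z in Ω ×ˢ Ω, kernelQuot σ ((ζ z.1 - ζ z.2) ^ 2 * (φ k z.2 - u z.2) ^ 2) z := by
          rw [lintegral_add_left hm', lintegral_const_mul' _ _ ENNReal.ofReal_ne_top,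
            lintegral_const_mul' _ _ ENNReal.ofReal_ne_top]
          rfl
      _ ≤ _ := by
          gcongr
          exact (setLIntegral_le_lintegral _ _).trans h3
  refine tendsto_of_tendsto_of_tendsto_of_le_of_le tendsto_const_nhds ?_ (fun k => zero_le) hle
  have h5 := ENNReal.Tendsto.const_mul h1 (Or.inr (ENNReal.ofReal_ne_top (r := a)))
  have h6 := ENNReal.Tendsto.const_mul (ENNReal.Tendsto.const_mul h2
    (Or.inr (ENNReal.ofReal_ne_top (r := J * R ^ (-(2 * σ))))))
    (Or.inr (ENNReal.ofReal_ne_top (r := b)))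
  simpa using h5.add h6

theorem lintegral_dominant_ne_top {σ J R : ℝ} {ζ : 𝔼 → ℝ} (hζ : IsCutoff R ζ)
    (hJ : ∀ y : 𝔼, ∫⁻ x : 𝔼, kernelQuot σ (min 1 (16 * ‖x - y‖ ^ 2 / R ^ 2)) (x, y) ≤
        ENNReal.ofReal (J * R ^ (-(2 * σ)))) {Ω : Set 𝔼} {u : 𝔼 → ℝ} (hum : Measurable u)
    (h1 : CensoredEnergy.energy σ Ω u < ∞) (h2 : ∫⁻ x, ENNReal.ofReal (u x ^ 2) < ∞)
    {a b : ℝ} (ha : 0 ≤ a) (hb : 0 ≤ b) :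
    ∫⁻ z in Ω ×ˢ Ω, kernelQuot σ (a * (u z.1 - u z.2) ^ 2
      + b * ((ζ z.1 - ζ z.2) ^ 2 * u z.2 ^ 2)) z ≠ ∞ := by
  have hm' : Measurable fun z : 𝔼 × 𝔼 => ENNReal.ofReal a *
      kernelQuot σ ((u z.1 - u z.2) ^ 2) z :=
    (Measurable.kernelQuot σ (((hum.comp measurable_fst).sub
      (hum.comp measurable_snd)).pow_const 2)).const_mul _
  have h3 := hζ.lintegral_kernelQuot_le hJ hum
  refine ne_of_lt ?_
  calc _ = ∫⁻ z in Ω ×ˢ Ω, (ENNReal.ofReal a * kernelQuot σ ((u z.1 - u z.2) ^ 2) z +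
        ENNReal.ofReal b * kernelQuot σ ((ζ z.1 - ζ z.2) ^ 2 * u z.2 ^ 2) z) := by
        refine lintegral_congr fun z => ?_
        rw [kernelQuot_add σ (by positivity) (by positivity), kernelQuot_mul σ ha,
          kernelQuot_mul σ hb]
    _ = ENNReal.ofReal a * CensoredEnergy.energy σ Ω u + ENNReal.ofReal b *
        ∫⁻ z in Ω ×ˢ Ω, kernelQuot σ ((ζ z.1 - ζ z.2) ^ 2 * u z.2 ^ 2) z := by
        rw [lintegral_add_left hm', lintegral_const_mul' _ _ ENNReal.ofReal_ne_top,
          lintegral_const_mul' _ _ ENNReal.ofReal_ne_top]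
        rfl
    _ ≤ ENNReal.ofReal a * CensoredEnergy.energy σ Ω u + ENNReal.ofReal b *
        (ENNReal.ofReal (J * R ^ (-(2 * σ))) * ∫⁻ x, ENNReal.ofReal (u x ^ 2)) := by
        gcongr
        exact (setLIntegral_le_lintegral _ _).trans h3
    _ < ∞ := ENNReal.add_lt_top.mpr ⟨ENNReal.mul_lt_top ENNReal.ofReal_lt_top h1,
        ENNReal.mul_lt_top ENNReal.ofReal_lt_top (ENNReal.mul_lt_top ENNReal.ofReal_lt_top h2)⟩

theorem lintegral_sq_lt_top {u : 𝔼 → ℝ} (hu : MemLp u 2 volume) :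
    ∫⁻ x, ENNReal.ofReal (u x ^ 2) < ∞ := by
  rw [← eLpNorm_two_sq]
  exact ENNReal.pow_lt_top hu.2

/-- Truncations `u - ζ (u - K)₊` stay in the space. -/
theorem CensoredEnergy.MemH0.sub_cutoff_mul (hn : 0 < n) {σ : ℝ} (hσ : 0 < σ) (hσ' : σ < 1)
    {Ω : Set 𝔼} {u : 𝔼 → ℝ} (hu : CensoredEnergy.MemH0 σ Ω u) (hum : Measurable u)
    (hΩ : volume Ω < ∞) (hΩm : MeasurableSet Ω) {R : ℝ} {ζ : 𝔼 → ℝ} (hζ : IsCutoff R ζ)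
    (hζc : ContDiff ℝ 1 ζ) {K : ℝ} (hK : 0 ≤ K) :
    CensoredEnergy.MemH0 σ Ω fun x => u x - ζ x * max (u x - K) 0 := by
  obtain ⟨J, hJ0, hJ⟩ := exists_lintegral_kernelQuot_le hn hσ hσ'
  obtain ⟨φ, hφ, hφE, hφL, hφae⟩ := hu.exists_approx
  have hE := hu.energy_lt_top hn hσ hσ' hΩ hΩm
  have hL := lintegral_sq_lt_top hu.memLp
  set v : 𝔼 → ℝ := fun x => u x - ζ x * max (u x - K) 0 with hv
  have hvm : Measurable v := hum.sub (hζ.measurable.mul ((hum.sub_const K).max measurable_const))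
  have hbound : ∀ (s z : ℝ) (h : ℝ), 0 ≤ z → z ≤ 1 → |h| ≤ |s| → |s - z * h| ≤ 2 * |s| := by
    intro s z h hz hz' hh
    have h1 := abs_sub s (z * h)
    have h2 : |z * h| ≤ |h| := by
      rw [abs_mul, abs_of_nonneg hz]; exact mul_le_of_le_one_left (abs_nonneg _) hz'
    linarith
  have hvu : ∀ x, |v x| ≤ 2 * |u x| := fun x =>
    hbound _ _ _ (hζ.nonneg x) (hζ.le_one x) (abs_max_sub_zero_le hK _)
  refine ⟨?_, ?_, ?_⟩
  · exact hu.memLp.of_le_mul (c := 2) hvm.aestronglyMeasurable (ae_of_all _ hvu)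
  · filter_upwards [hu.eq_zero] with x hx hxΩ
    simp [hv, hx hxΩ, hK]
  set ε : ℕ → ℝ := fun k => 1 / ((k : ℝ) + 1) with hε
  have hε0 : ∀ k, 0 < ε k := fun k => by positivity
  have hεt : Tendsto ε atTop (𝓝 0) := tendsto_one_div_add_atTop_nhds_zero_nat
  -- The truncation `(· - K)₊` is only Lipschitz, so the approximants use its `C¹` regularization
  -- with parameter `1 / (k + 1)`.
  set ψ : ℕ → 𝔼 → ℝ := fun k x => φ k x - ζ x * smoothExcess K (ε k) (φ k x) with hψ
  have hψc : ∀ k, ContDiff ℝ 1 (ψ k) := fun k =>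
    (hφ k).contDiff.sub (hζc.mul ((contDiff_smoothExcess K (hε0 k)).comp (hφ k).contDiff))
  have hψm : ∀ k, Measurable (ψ k) := fun k => (hψc k).continuous.measurable
  have hψs : ∀ k, Function.support (ψ k) ⊆ Function.support (φ k) := fun k x hx h0 => hx (by
    simp only [hψ]; rw [h0, smoothExcess_zero hK (hε0 k)]; simp)
  have hψφ : ∀ k x, |ψ k x| ≤ 2 * |φ k x| := fun k x =>
    hbound _ _ _ (hζ.nonneg x) (hζ.le_one x) (abs_smoothExcess_le hK (hε0 k) _)
  have hψae : ∀ᵐ x, Tendsto (fun k => ψ k x) atTop (𝓝 (v x)) := by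
    filter_upwards [hφae] with x hx
    exact hx.sub ((tendsto_smoothExcess hε0 hεt hx).const_mul (ζ x))
  refine ⟨ψ, fun k => ⟨hψc k, ?_, ?_⟩, ?_, ?_⟩
  · exact (hφ k).hasCompactSupport.mono (hψs k)
  · exact (closure_mono (hψs k)).trans (hφ k).tsupport_subset
  -- `sq_sub_cutoff_mul_sub_le` for `ψ k` and `v` gives coefficients `12` and `8`; writing `φ k = (φ
  -- k - u) + u` then produces `36, 24` for `u` and `24, 16` for the remainder.
  · have hdom := lintegral_dominant_ne_top hζ (fun y => hJ R y hζ.pos) hum hE hL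
      (a := 36) (b := 24) (by norm_num) (by norm_num)
    have hrem := tendsto_lintegral_remainder hζ (fun y => hJ R y hζ.pos)
      (fun k => (hφ k).measurable) hum hφE hφL (a := 24) (b := 16) (by norm_num) (by norm_num)
    simp only [energy_eq_kernelQuot]
    refine tendsto_lintegral_zero_of_le_add (fun k => ?_) ?_ (fun k => ae_of_all _ fun z => ?_)
      hdom hrem ?_
    · have hm : Measurable (ψ k - v) := (hψm k).sub hvm
      exact Measurable.kernelQuot σ (((hm.comp measurable_fst).sub
        (hm.comp measurable_snd)).pow_const 2)
    · have hz := hζ.measurable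
      exact Measurable.kernelQuot σ (((((hum.comp measurable_fst).sub
        (hum.comp measurable_snd)).pow_const 2).const_mul _).add
        (((((hz.comp measurable_fst).sub (hz.comp measurable_snd)).pow_const 2).mul
          ((hum.comp measurable_snd).pow_const 2)).const_mul _))
    · have e1 := sq_sub_cutoff_mul_sub_le (β := ζ z.2) (hζ.nonneg z.1) (hζ.le_one z.1)
        (abs_smoothExcess_sub_le K (hε0 k) (φ k z.1) (φ k z.2)) (abs_smoothExcess_le hK (hε0 k) _)
      have e2 := sq_sub_cutoff_mul_sub_le (β := ζ z.2) (hζ.nonneg z.1) (hζ.le_one z.1)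
        (abs_max_sub_sub_le K (u z.1) (u z.2)) (abs_max_sub_zero_le hK _)
      rw [← kernelQuot_add σ (by positivity) (by positivity)]
      refine kernelQuot_mono σ ?_ z
      simp only [Pi.sub_apply]
      have e3 : (ψ k z.1 - v z.1 - (ψ k z.2 - v z.2)) ^ 2 ≤
          2 * (ψ k z.1 - ψ k z.2) ^ 2 + 2 * (v z.1 - v z.2) ^ 2 := by
        nlinarith [sq_nonneg ((ψ k z.1 - ψ k z.2) + (v z.1 - v z.2))]
      have e4 : (φ k z.1 - φ k z.2) ^ 2 ≤ 2 * ((φ k z.1 - u z.1) - (φ k z.2 - u z.2)) ^ 2 +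
          2 * (u z.1 - u z.2) ^ 2 := by
        nlinarith [sq_nonneg (((φ k z.1 - u z.1) - (φ k z.2 - u z.2)) - (u z.1 - u z.2))]
      have e5 : φ k z.2 ^ 2 ≤ 2 * (φ k z.2 - u z.2) ^ 2 + 2 * u z.2 ^ 2 := by
        nlinarith [sq_nonneg ((φ k z.2 - u z.2) - u z.2)]
      have e6 := mul_le_mul_of_nonneg_left e5 (sq_nonneg (ζ z.1 - ζ z.2))
      simp only [hψ, hv] at e3 ⊢
      linarith
    · filter_upwards [ae_prod_of_ae hψae hψae (Ω ×ˢ Ω)] with z hz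
      refine tendsto_kernelQuot_zero σ ?_ z
      have := ((hz.1.sub_const (v z.1)).sub (hz.2.sub_const (v z.2))).pow 2
      simpa using this
  · rw [tendsto_eLpNorm_two_zero_iff]
    refine tendsto_lintegral_zero_of_le_add (G := fun x => ENNReal.ofReal (24 * u x ^ 2))
      (g' := fun k x => ENNReal.ofReal (16 * (φ k x - u x) ^ 2)) (fun k => ?_) ?_
      (fun k => ae_of_all _ fun x => ?_) ?_ ?_ ?_
    · exact (((hψm k).sub hvm).pow_const 2).ennreal_ofReal
    · exact ((hum.pow_const 2).const_mul 24).ennreal_ofReal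
    · rw [← ENNReal.ofReal_add (by positivity) (by positivity)]
      apply ENNReal.ofReal_le_ofReal
      have e1 := pow_le_pow_left₀ (abs_nonneg _) (hψφ k x) 2
      have e2 := pow_le_pow_left₀ (abs_nonneg _) (hvu x) 2
      rw [mul_pow, sq_abs, sq_abs] at e1 e2
      simp only [Pi.sub_apply]
      nlinarith [sq_nonneg (ψ k x + v x), sq_nonneg ((φ k x - u x) - u x)]
    · simp_rw [ENNReal.ofReal_mul (show (0 : ℝ) ≤ 24 by norm_num)]
      rw [lintegral_const_mul' _ _ ENNReal.ofReal_ne_top]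
      exact (ENNReal.mul_lt_top ENNReal.ofReal_lt_top hL).ne
    · simp_rw [ENNReal.ofReal_mul (show (0 : ℝ) ≤ 16 by norm_num)]
      have : ∀ k, ∫⁻ x, ENNReal.ofReal 16 * ENNReal.ofReal ((φ k x - u x) ^ 2) =
          ENNReal.ofReal 16 * ∫⁻ x, ENNReal.ofReal ((φ k x - u x) ^ 2) := fun k =>
        lintegral_const_mul' _ _ ENNReal.ofReal_ne_top
      simp_rw [this]
      simpa using ENNReal.Tendsto.const_mul hφL (Or.inr (ENNReal.ofReal_ne_top (r := 16)))
    · filter_upwards [hψae] with x hx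
      have := (ENNReal.continuous_ofReal.tendsto _).comp ((hx.sub_const (v x)).pow 2)
      simpa [Function.comp_def] using this

end Competitor

/-! ### Faber–Krahn for localized truncations. -/

section FaberKrahnTransfer

variable {n : ℕ}

local notation "𝔼" => EuclideanSpace ℝ (Fin n)

theorem tendsto_kernelQuot (σ : ℝ) {c : ℕ → ℝ} {c₀ : ℝ} (h : Tendsto c atTop (𝓝 c₀)) (z : 𝔼 × 𝔼) :
    Tendsto (fun k => kernelQuot σ (c k) z) atTop (𝓝 (kernelQuot σ c₀ z)) :=
  (ENNReal.continuous_ofReal.tendsto _).comp (h.div_const (‖z.1 - z.2‖ ^ ((n : ℝ) + 2 * σ)))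

/-- This puts the truncated test functions within reach of `exists_faberKrahn`, which needs a
Lipschitz function but no quantitative constant. -/
theorem IsCutoff.exists_lipschitzWith_mul_excess {R : ℝ} {η : 𝔼 → ℝ} (hη : IsCutoff R η) {K : ℝ}
    (hK : 0 ≤ K) {Ω : Set 𝔼} {φ : 𝔼 → ℝ} (hφ : CensoredEnergy.IsTest Ω φ) :
    ∃ L, LipschitzWith L fun x => η x * max (φ x - K) 0 := by
  obtain ⟨L, hL⟩ := hφ.exists_lipschitzWith
  obtain ⟨M, hM⟩ := hφ.hasCompactSupport.exists_bound_of_continuous hφ.contDiff.continuous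
  have hM0 : 0 ≤ M := (norm_nonneg _).trans (hM 0)
  have hR := hη.pos
  refine ⟨L + (4 / R * M).toNNReal, LipschitzWith.of_dist_le_mul fun x y => ?_⟩
  have h1 := hL.dist_le_mul x y
  have h2 := abs_max_sub_sub_le K (φ x) (φ y)
  have h3 := abs_max_sub_zero_le hK (φ y)
  have h4 := hM y
  rw [Real.dist_eq, dist_eq_norm] at *
  rw [Real.norm_eq_abs] at h4
  rw [NNReal.coe_add, Real.coe_toNNReal _ (by positivity)]
  have e : η x * max (φ x - K) 0 - η y * max (φ y - K) 0 =
      η x * (max (φ x - K) 0 - max (φ y - K) 0) + (η x - η y) * max (φ y - K) 0 := by ring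
  rw [e]
  refine (abs_add_le _ _).trans ?_
  rw [abs_mul, abs_mul, abs_of_nonneg (hη.nonneg x), add_mul]
  refine add_le_add ?_ ?_
  · exact (mul_le_of_le_one_left (abs_nonneg _) (hη.le_one x)).trans (h2.trans h1)
  · calc |η x - η y| * |max (φ y - K) 0| ≤ (4 / R * ‖x - y‖) * M :=
        mul_le_mul (hη.lip x y) (h3.trans h4) (abs_nonneg _) (by positivity)
      _ = _ := by ring

theorem mul_excess_pos_iff {R : ℝ} {η : 𝔼 → ℝ} (hη : IsCutoff R η) {K s : ℝ} {x : 𝔼} :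
    0 < η x * max (s - K) 0 ↔ η x ≠ 0 ∧ K < s := by
  have h1 := hη.nonneg x
  constructor
  · intro h
    refine ⟨fun h0 => by simp [h0] at h, ?_⟩
    by_contra! hs
    rw [max_eq_right (by linarith)] at h
    simp at h
  · rintro ⟨h2, h3⟩
    exact mul_pos (lt_of_le_of_ne h1 h2.symm) (lt_max_of_lt_left (by linarith))

/-- The Faber–Krahn inequality for localized truncations of functions in the space. -/
theorem exists_faberKrahn_excess (hn : 0 < n) {σ : ℝ} (hσ : 1 / 2 < σ) (hσ' : σ < 1) :
    ∃ C : ℝ, 0 < C ∧ ∀ (N : ℝ) (u : 𝔼 → ℝ) (R : ℝ) (η : 𝔼 → ℝ) (K V : ℝ),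
      CensoredEnergy.MemH0 σ (Metric.ball 0 N) u → Measurable u → IsCutoff R η → 0 < K → 0 < V →
      volume ({x | K ≤ u x} ∩ {x | η x ≠ 0}) < ENNReal.ofReal V →
      ∫⁻ x, ENNReal.ofReal ((η x * max (u x - K) 0) ^ 2) ≤ ENNReal.ofReal (C * V ^ (2 * σ / n)) *
        CensoredEnergy.energy σ {x | 0 < u x} fun x => η x * max (u x - K) 0 := by
  classical
  obtain ⟨C, hC, hFK⟩ := exists_faberKrahn hn hσ hσ'
  have hσ0 : 0 < σ := by linarith
  obtain ⟨J, hJ0, hJ⟩ := exists_lintegral_kernelQuot_le hn hσ0 hσ'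
  refine ⟨C, hC, fun N u R η K V hu hum hη hK hV hvol => ?_⟩
  set Ω := Metric.ball (0 : 𝔼) N with hΩ
  have hΩv : volume Ω < ∞ := measure_ball_lt_top
  have hΩm : MeasurableSet Ω := Metric.isOpen_ball.measurableSet
  obtain ⟨φ, hφ, hφE, hφL, hφae⟩ := hu.exists_approx
  have hE := hu.energy_lt_top hn hσ0 hσ' hΩv hΩm
  have hL := lintegral_sq_lt_top hu.memLp
  have hηm := hη.measurable
  set v : 𝔼 → ℝ := fun x => η x * max (u x - K) 0 with hv
  set g : ℕ → 𝔼 → ℝ := fun k x => η x * max (φ k x - K) 0 with hg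
  have hgm : ∀ k, Measurable (g k) := fun k =>
    hηm.mul (((hφ k).measurable.sub_const K).max measurable_const)
  have hg0 : ∀ k x, 0 ≤ g k x := fun k x => mul_nonneg (hη.nonneg x) (le_max_right _ _)
  have hgpos : ∀ k x, 0 < g k x ↔ η x ≠ 0 ∧ K < φ k x := fun k x => mul_excess_pos_iff hη
  have hgΩ : ∀ k x, 0 < g k x → x ∈ Ω := fun k x hx => by
    by_contra h
    have := ((hgpos k x).mp hx).2
    rw [(hφ k).eq_zero h] at this
    linarith
  have hgae : ∀ᵐ x, Tendsto (fun k => g k x) atTop (𝓝 (v x)) := by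
    filter_upwards [hφae] with x hx
    exact ((hx.sub_const K).max tendsto_const_nhds).const_mul (η x)
  have hWm : ∀ k, MeasurableSet {x | 0 < g k x} := fun k =>
    measurableSet_lt measurable_const (hgm k)
  -- the measures of the positivity sets
  have hvol' : ∀ᶠ k in atTop, volume {x | 0 < g k x} ≤ ENNReal.ofReal V := by
    have hTm : MeasurableSet ({x | K ≤ u x} ∩ {x | η x ≠ 0}) :=
      (measurableSet_le measurable_const hum).inter (hηm (measurableSet_singleton 0).compl)
    have h1 := limsup_lintegral_le_of_le_add (μ := volume)
      (f := fun k => ({x | 0 < g k x} : Set 𝔼).indicator (1 : 𝔼 → ℝ≥0∞)) (g' := fun _ _ => 0)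
      (F := ({x | K ≤ u x} ∩ {x | η x ≠ 0}).indicator (1 : 𝔼 → ℝ≥0∞))
      (G := Ω.indicator 1) (fun k => measurable_one.indicator (hWm k))
      (measurable_one.indicator hΩm) (fun k => ae_of_all _ fun x => ?_) ?_ ?_ ?_
    · simp_rw [lintegral_indicator_one (hWm _), lintegral_indicator_one hTm] at h1
      exact (eventually_lt_of_limsup_lt (h1.trans_lt hvol)).mono fun k hk => hk.le
    · rw [add_zero]
      exact Set.indicator_le_indicator_of_subset (hgΩ k) (fun _ => zero_le) x
    · rw [lintegral_indicator_one hΩm]; exact hΩv.ne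
    · simp
    · filter_upwards [hφae] with x hx
      -- Where `u x < K`, eventually `φ k x < K`; on the level `u = K` nothing is known. Hence the
      -- closed superlevel set as limit, and the strict volume hypothesis, which passes to all large
      -- `k`.
      by_cases hxT : K ≤ u x ∧ η x ≠ 0
      · rw [Set.indicator_of_mem (show x ∈ {x | K ≤ u x} ∩ {x | η x ≠ 0} from hxT)]
        refine limsup_le_of_le (by isBoundedDefault) (Eventually.of_forall fun k => ?_)
        exact Set.indicator_le_self' (fun _ _ => zero_le) x
      · have : ∀ᶠ k in atTop, ({x | 0 < g k x} : Set 𝔼).indicator (1 : 𝔼 → ℝ≥0∞) x = 0 := by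
          by_cases h0 : η x = 0
          · refine Eventually.of_forall fun k => Set.indicator_of_notMem (fun h => ?_) _
            exact ((hgpos k x).mp h).1 h0
          · have : u x < K := by by_contra! h; exact hxT ⟨h, h0⟩
            filter_upwards [hx.eventually (gt_mem_nhds this)] with k hk
            refine Set.indicator_of_notMem (fun h => ?_) _
            exact absurd ((hgpos k x).mp h).2 (not_lt.mpr hk.le)
        rw [limsup_congr this]
        simp
  -- the energies
  have hen : limsup (fun k => CensoredEnergy.energy σ {x | 0 < g k x} (g k)) atTop ≤
      CensoredEnergy.energy σ {x | 0 < u x} v := by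
    have hdom := lintegral_dominant_ne_top hη (fun y => hJ R y hη.pos) hum hE hL
      (a := 4) (b := 4) (by norm_num) (by norm_num)
    have hrem := tendsto_lintegral_remainder hη (fun y => hJ R y hη.pos)
      (fun k => (hφ k).measurable) hum hφE hφL (a := 4) (b := 4) (by norm_num) (by norm_num)
    have hAm : MeasurableSet {x | 0 < u x} := measurableSet_lt measurable_const hum
    have hΩΩ := hΩm.prod hΩm
    rw [← lintegral_indicator hΩΩ] at hdom
    simp_rw [← lintegral_indicator hΩΩ] at hrem
    simp only [energy_eq_kernelQuot]
    simp_rw [← lintegral_indicator ((hWm _).prod (hWm _)), ← lintegral_indicator (hAm.prod hAm)]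
    refine limsup_lintegral_le_of_le_add (fun k => ?_) ?_ (fun k => ae_of_all _ fun z => ?_)
      hdom hrem ?_
    · exact (Measurable.kernelQuot σ ((((hgm k).comp measurable_fst).sub
        ((hgm k).comp measurable_snd)).pow_const 2)).indicator ((hWm k).prod (hWm k))
    · exact (Measurable.kernelQuot σ (((((hum.comp measurable_fst).sub
        (hum.comp measurable_snd)).pow_const 2).const_mul _).add
        (((((hηm.comp measurable_fst).sub (hηm.comp measurable_snd)).pow_const 2).mul
          ((hum.comp measurable_snd).pow_const 2)).const_mul _))).indicator hΩΩ
    · by_cases hz : z ∈ ({x | 0 < g k x} ×ˢ {x | 0 < g k x} : Set (𝔼 × 𝔼))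
      swap
      · rw [Set.indicator_of_notMem hz]; exact zero_le
      have hzΩ : z ∈ Ω ×ˢ Ω := ⟨hgΩ k _ hz.1, hgΩ k _ hz.2⟩
      rw [Set.indicator_of_mem hz, Set.indicator_of_mem hzΩ, Set.indicator_of_mem hzΩ,
        ← kernelQuot_add σ (by positivity) (by positivity)]
      refine kernelQuot_mono σ ?_ z
      have e1 := sq_cutoff_mul_sub_le (β := η z.2) (hη.nonneg z.1) (hη.le_one z.1)
        (abs_max_sub_sub_le K (φ k z.1) (φ k z.2)) (abs_max_sub_zero_le hK.le _)
      have e4 : (φ k z.1 - φ k z.2) ^ 2 ≤ 2 * ((φ k z.1 - u z.1) - (φ k z.2 - u z.2)) ^ 2 +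
          2 * (u z.1 - u z.2) ^ 2 := by
        nlinarith [sq_nonneg (((φ k z.1 - u z.1) - (φ k z.2 - u z.2)) - (u z.1 - u z.2))]
      have e5 : φ k z.2 ^ 2 ≤ 2 * (φ k z.2 - u z.2) ^ 2 + 2 * u z.2 ^ 2 := by
        nlinarith [sq_nonneg ((φ k z.2 - u z.2) - u z.2)]
      have e6 := mul_le_mul_of_nonneg_left e5 (sq_nonneg (η z.1 - η z.2))
      simp only [hg]
      linarith
    · have hpair := ae_prod_of_ae (hφae.and hgae) (hφae.and hgae) Set.univ
      rw [Measure.restrict_univ] at hpair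
      filter_upwards [hpair] with z hz
      obtain ⟨⟨h1, h2⟩, h3, h4⟩ := hz
      -- Positivity of `K` enters here: pairs that survive in the limit have both values at least
      -- `K`, so they lie in `{u > 0} × {u > 0}`.
      by_cases hzA : K ≤ u z.1 ∧ K ≤ u z.2
      · have hzA' : z ∈ ({x | 0 < u x} ×ˢ {x | 0 < u x} : Set (𝔼 × 𝔼)) :=
          ⟨hK.trans_le hzA.1, hK.trans_le hzA.2⟩
        rw [Set.indicator_of_mem hzA']
        have := tendsto_kernelQuot σ ((h2.sub h4).pow 2) z
        rw [← this.limsup_eq]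
        exact limsup_le_limsup (Eventually.of_forall fun k =>
          Set.indicator_le_self' (fun _ _ => zero_le) z)
      · have : ∀ᶠ k in atTop, ({x | 0 < g k x} ×ˢ {x | 0 < g k x} : Set (𝔼 × 𝔼)).indicator
            (fun z => kernelQuot σ ((g k z.1 - g k z.2) ^ 2) z) z = 0 := by
          rw [not_and_or, not_le, not_le] at hzA
          rcases hzA with h | h
          · filter_upwards [h1.eventually (gt_mem_nhds h)] with k hk
            exact Set.indicator_of_notMem
              (fun h => absurd ((hgpos k _).mp h.1).2 (not_lt.mpr hk.le)) _
          · filter_upwards [h3.eventually (gt_mem_nhds h)] with k hk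
            exact Set.indicator_of_notMem
              (fun h => absurd ((hgpos k _).mp h.2).2 (not_lt.mpr hk.le)) _
        rw [limsup_congr this]
        simp
  have hFKk : ∀ᶠ k in atTop, ∫⁻ x, ENNReal.ofReal (g k x ^ 2) ≤
      ENNReal.ofReal (C * V ^ (2 * σ / n)) * CensoredEnergy.energy σ {x | 0 < g k x} (g k) := by
    filter_upwards [hvol'] with k hk
    obtain ⟨L, hL⟩ := hη.exists_lipschitzWith_mul_excess hK.le (hφ k)
    refine hFK (g k) L N V hL (hg0 k) (fun x hx => ?_) hV hk
    simpa [hΩ] using hgΩ k x (lt_of_le_of_ne (hg0 k x) hx.symm)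
  have hfatou : ∫⁻ x, ENNReal.ofReal (v x ^ 2) ≤
      liminf (fun k => ∫⁻ x, ENNReal.ofReal (g k x ^ 2)) atTop := by
    refine le_trans (lintegral_mono_ae ?_)
      (lintegral_liminf_le fun k => ((hgm k).pow_const 2).ennreal_ofReal)
    filter_upwards [hgae] with x hx
    exact ((ENNReal.continuous_ofReal.tendsto _).comp (hx.pow 2)).liminf_eq.ge
  calc ∫⁻ x, ENNReal.ofReal (v x ^ 2)
      ≤ liminf (fun k => ∫⁻ x, ENNReal.ofReal (g k x ^ 2)) atTop := hfatou
    _ ≤ limsup (fun k => ∫⁻ x, ENNReal.ofReal (g k x ^ 2)) atTop := liminf_le_limsup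
    _ ≤ limsup (fun k => ENNReal.ofReal (C * V ^ (2 * σ / n)) *
          CensoredEnergy.energy σ {x | 0 < g k x} (g k)) atTop := limsup_le_limsup hFKk
    _ = ENNReal.ofReal (C * V ^ (2 * σ / n)) *
          limsup (fun k => CensoredEnergy.energy σ {x | 0 < g k x} (g k)) atTop :=
        ENNReal.limsup_const_mul_of_ne_top ENNReal.ofReal_ne_top
    _ ≤ _ := by gcongr

end FaberKrahnTransfer

/-! ### The Caccioppoli inequality. -/

/-- It is an identity when both values exceed `K`. When only `b` does, the defect is `β² (b - K)(K -
a) ≥ 0`, and symmetrically. -/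
theorem caccioppoli_pointwise (a b α β K : ℝ) :
    (α * max (a - K) 0 - β * max (b - K) 0) ^ 2 ≤
      (a - b) * (α ^ 2 * max (a - K) 0 - β ^ 2 * max (b - K) 0) +
        (α - β) ^ 2 * (max (a - K) 0 * max (b - K) 0) := by
  rcases le_total a K with ha | ha <;> rcases le_total b K with hb | hb
  · simp [max_eq_right (sub_nonpos.mpr ha), max_eq_right (sub_nonpos.mpr hb)]
  · rw [max_eq_right (sub_nonpos.mpr ha), max_eq_left (sub_nonneg.mpr hb)]
    nlinarith [mul_nonneg (sq_nonneg β) (mul_nonneg (sub_nonneg.mpr hb) (sub_nonneg.mpr ha))]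
  · rw [max_eq_left (sub_nonneg.mpr ha), max_eq_right (sub_nonpos.mpr hb)]
    nlinarith [mul_nonneg (sq_nonneg α) (mul_nonneg (sub_nonneg.mpr hb) (sub_nonneg.mpr ha))]
  · rw [max_eq_left (sub_nonneg.mpr ha), max_eq_left (sub_nonneg.mpr hb)]
    apply le_of_eq; ring

section Caccioppoli

variable {n : ℕ}

local notation "𝔼" => EuclideanSpace ℝ (Fin n)

theorem functional_eq (σ N : ℝ) (u : 𝔼 → ℝ) :
    CensoredEnergy.functional σ N u = CensoredEnergy.energy σ {x | 0 < u x} u /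
      (∫⁻ x in Metric.ball 0 N, ENNReal.ofReal (u x ^ 2)) + volume {x | 0 < u x} := by
  rw [CensoredEnergy.functional, eLpNorm_two_sq]

/-- A minimizer that is measurable, nonnegative and supported in `B_N` everywhere, not just almost
everywhere. -/
structure IsStrictMinimizer (σ N : ℝ) (u : 𝔼 → ℝ) : Prop where
  isMinimizer : CensoredEnergy.IsMinimizer σ N u
  measurable : Measurable u
  nonneg : ∀ x, 0 ≤ u x
  eq_zero : ∀ x, x ∉ Metric.ball (0 : 𝔼) N → u x = 0

theorem IsStrictMinimizer.pos_subset {σ N : ℝ} {u : 𝔼 → ℝ} (h : IsStrictMinimizer σ N u) :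
    {x | 0 < u x} ⊆ Metric.ball 0 N := fun x hx => by
  by_contra h'
  exact (ne_of_gt hx) (h.eq_zero x h')

theorem IsStrictMinimizer.lintegral_ne_zero {σ N : ℝ} {u : 𝔼 → ℝ} (h : IsStrictMinimizer σ N u) :
    ∫⁻ x in Metric.ball 0 N, ENNReal.ofReal (u x ^ 2) ≠ 0 := by
  intro h0
  rw [lintegral_eq_zero_iff (h.measurable.pow_const 2).ennreal_ofReal,
    Filter.EventuallyEq, ae_restrict_iff' Metric.isOpen_ball.measurableSet] at h0
  refine h.isMinimizer.1.ne_zero ?_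
  filter_upwards [h0] with x hx
  by_cases hxN : x ∈ Metric.ball (0 : 𝔼) N
  · have := hx hxN
    simp only [Pi.zero_apply, ENNReal.ofReal_eq_zero] at this
    simpa using le_antisymm this (sq_nonneg _)
  · exact h.eq_zero x hxN

theorem energy_mono {σ : ℝ} {A B : Set 𝔼} (h : A ⊆ B) (u : 𝔼 → ℝ) :
    CensoredEnergy.energy σ A u ≤ CensoredEnergy.energy σ B u :=
  lintegral_mono_set (Set.prod_mono h h)

/-- The Caccioppoli inequality for minimizers. -/
theorem IsStrictMinimizer.caccioppoli (hn : 0 < n) {σ : ℝ} (hσ : 0 < σ) (hσ' : σ < 1) {N : ℝ}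
    {u : 𝔼 → ℝ} (hu : IsStrictMinimizer σ N u) {R : ℝ} {η : 𝔼 → ℝ} (hη : IsCutoff R η)
    (hηc : ContDiff ℝ 1 fun x => η x ^ 2) {K : ℝ} (hK : 0 < K) :
    CensoredEnergy.energy σ {x | 0 < u x} (fun x => η x * max (u x - K) 0) ≤
      CensoredEnergy.m n σ N * (∫⁻ x, ENNReal.ofReal (η x ^ 2 * (u x * max (u x - K) 0))) +
      ∫⁻ z in {x | 0 < u x} ×ˢ {x | 0 < u x}, kernelQuot σ ((η z.1 - η z.2) ^ 2 *
        (max (u z.1 - K) 0 * max (u z.2 - K) 0)) z := by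
  obtain ⟨J, hJ0, hJ⟩ := exists_lintegral_kernelQuot_le hn hσ hσ'
  have hum := hu.measurable
  have hmem := hu.isMinimizer.1.mem
  set Ω := Metric.ball (0 : 𝔼) N with hΩ
  have hΩv : volume Ω < ∞ := measure_ball_lt_top
  have hΩm : MeasurableSet Ω := Metric.isOpen_ball.measurableSet
  set A := {x | 0 < u x} with hA
  have hAm : MeasurableSet A := measurableSet_lt measurable_const hum
  have hAΩ : A ⊆ Ω := hu.pos_subset
  have hAv : volume A ≠ ∞ := ((measure_mono hAΩ).trans_lt hΩv).ne
  have hE : CensoredEnergy.energy σ Ω u < ∞ := hmem.energy_lt_top hn hσ hσ' hΩv hΩm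
  have hL := lintegral_sq_lt_top hmem.memLp
  set w : 𝔼 → ℝ := fun x => max (u x - K) 0 with hw
  have hwm : Measurable w := (hum.sub_const K).max measurable_const
  have hw0 : ∀ x, 0 ≤ w x := fun x => le_max_right _ _
  have hwu : ∀ x, w x ≤ u x := fun x => max_le (by linarith) (hu.nonneg x)
  have hηm := hη.measurable
  set P := ∫⁻ x, ENNReal.ofReal (η x ^ 2 * (u x * w x)) with hP
  set S := ∫⁻ z in A ×ˢ A, kernelQuot σ ((η z.1 - η z.2) ^ 2 * (w z.1 * w z.2)) z with hS
  set D := ∫⁻ x in Ω, ENNReal.ofReal (u x ^ 2) with hD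
  have hD0 : D ≠ 0 := hu.lintegral_ne_zero
  have hDtop : D ≠ ∞ := ((setLIntegral_le_lintegral _ _).trans_lt hL).ne
  set φ : 𝔼 → ℝ := fun x => η x ^ 2 * w x with hφ
  have hφm : Measurable φ := (hηm.pow_const 2).mul hwm
  set v : 𝔼 → ℝ := fun x => η x * w x with hv
  have hvm : Measurable v := hηm.mul hwm
  have hIφ : CensoredEnergy.energy σ A φ ≠ ∞ := by
    have hdom := lintegral_dominant_ne_top hη.sq (fun y => hJ (R / 2) y hη.sq.pos) hum hE hL
      (a := 2) (b := 2) (by norm_num) (by norm_num)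
    refine (lt_of_le_of_lt ?_ hdom.lt_top).ne
    refine (energy_mono hAΩ φ).trans ?_
    rw [energy_eq_kernelQuot]
    exact lintegral_mono fun z => kernelQuot_mono σ (sq_cutoff_mul_sub_le (hη.sq.nonneg z.1)
      (hη.sq.le_one z.1) (abs_max_sub_sub_le K _ _) (abs_max_sub_zero_le hK.le _)) z
  -- The Rayleigh quotient acts as the Lagrange multiplier; it is at most `m(N)` since the volume
  -- term is nonnegative.
  set lam := CensoredEnergy.energy σ A u / D with hlam
  have hlam_le : lam ≤ CensoredEnergy.m n σ N := by
    rw [← hu.isMinimizer.2, functional_eq]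
    exact le_self_add
  have key : ∀ t : ℝ, 0 < t → t ≤ 1 / 2 → CensoredEnergy.energy σ A v ≤
      lam * P + S + ENNReal.ofReal (t / 2) * CensoredEnergy.energy σ A φ := by
    intro t ht ht'
    have ht1 : t ≤ 1 := by linarith
    set ut : 𝔼 → ℝ := fun x => u x - t * η x ^ 2 * w x with hut
    have hutm : Measurable ut := hum.sub (((hηm.pow_const 2).const_mul t).mul hwm)
    have hhalf : ∀ x, u x ≤ 2 * ut x := by
      intro x
      have h1 : t * η x ^ 2 ≤ 1 / 2 * 1 :=
        mul_le_mul ht' (hη.sq.le_one x) (sq_nonneg _) (by norm_num)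
      have h2 : t * η x ^ 2 * w x ≤ 1 / 2 * 1 * u x :=
        mul_le_mul h1 (hwu x) (hw0 x) (by norm_num)
      simp only [hut]; linarith
    have hutu : ∀ x, ut x ≤ u x := fun x => by
      have : 0 ≤ t * η x ^ 2 * w x := mul_nonneg (by positivity) (hw0 x)
      simp only [hut]; linarith
    -- From `u / 2 ≤ ut ≤ u`. Equality of the positivity sets cancels the finite measure terms and
    -- leaves a comparison of Rayleigh quotients on one set.
    have hset : {x | 0 < ut x} = A := by
      ext x
      simp only [hA, Set.mem_ofPred_eq]
      constructor
      · intro h; linarith [hutu x]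
      · intro h; linarith [hhalf x]
    have hadm : CensoredEnergy.Admissible σ N ut := by
      refine ⟨hmem.sub_cutoff_mul hn hσ hσ' hum hΩv hΩm (hη.sq.const_mul ht.le ht1)
        (contDiff_const.mul hηc) hK.le, fun h0 => hu.isMinimizer.1.ne_zero ?_, ?_⟩
      · filter_upwards [h0] with x hx
        have h1 := hhalf x
        rw [hx] at h1
        exact le_antisymm (by simpa using h1) (hu.nonneg x)
      · exact ae_of_all _ fun x => by
          have := hhalf x
          have := hu.nonneg x
          simp only [Pi.zero_apply]; linarith
    set Dt := ∫⁻ x in Ω, ENNReal.ofReal (ut x ^ 2) with hDt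
    have hDt_top : Dt ≠ ∞ := ne_top_of_le_ne_top hDtop (lintegral_mono fun x =>
      ENNReal.ofReal_le_ofReal (pow_le_pow_left₀ (by linarith [hhalf x, hu.nonneg x]) (hutu x) 2))
    have hDt0 : Dt ≠ 0 := by
      intro h0
      have h1 : D ≤ ENNReal.ofReal 4 * Dt := by
        rw [hD, hDt, ← lintegral_const_mul' _ _ ENNReal.ofReal_ne_top]
        refine lintegral_mono fun x => ?_
        rw [← ENNReal.ofReal_mul (by norm_num)]
        refine ENNReal.ofReal_le_ofReal ?_
        have := pow_le_pow_left₀ (hu.nonneg x) (hhalf x) 2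
        linarith [mul_pow 2 (ut x) 2]
      rw [h0, mul_zero] at h1
      exact hD0 (le_antisymm h1 zero_le)
    have hmin : lam ≤ CensoredEnergy.energy σ A ut / Dt := by
      have h1 : CensoredEnergy.functional σ N u ≤ CensoredEnergy.functional σ N ut := by
        rw [hu.isMinimizer.2]
        exact iInf₂_le ut hadm
      rw [functional_eq, functional_eq, hset] at h1
      exact (ENNReal.add_le_add_iff_right hAv).mp h1
    have hmin' : lam * Dt ≤ CensoredEnergy.energy σ A ut := by
      rwa [ENNReal.le_div_iff_mul_le (Or.inl hDt0) (Or.inl hDt_top)] at hmin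
    have hlamD : CensoredEnergy.energy σ A u = lam * D :=
      (ENNReal.div_mul_cancel hD0 hDtop).symm
    have hDle : D ≤ Dt + ENNReal.ofReal (2 * t) * P := by
      have hm : Measurable fun x => ENNReal.ofReal (ut x ^ 2) :=
        (hutm.pow_const 2).ennreal_ofReal
      calc D ≤ ∫⁻ x in Ω, (ENNReal.ofReal (ut x ^ 2) + ENNReal.ofReal (2 * t) *
            ENNReal.ofReal (η x ^ 2 * (u x * w x))) := by
            refine lintegral_mono fun x => ?_
            have h1 : 0 ≤ η x ^ 2 * (u x * w x) :=
              mul_nonneg (sq_nonneg _) (mul_nonneg (hu.nonneg x) (hw0 x))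
            rw [← ENNReal.ofReal_mul (by positivity), ← ENNReal.ofReal_add (sq_nonneg _)
              (by positivity)]
            refine ENNReal.ofReal_le_ofReal ?_
            simp only [hut]
            nlinarith [sq_nonneg (t * η x ^ 2 * w x)]
        _ = Dt + ENNReal.ofReal (2 * t) * ∫⁻ x in Ω, ENNReal.ofReal (η x ^ 2 * (u x * w x)) := by
            rw [lintegral_add_left hm, lintegral_const_mul' _ _ ENNReal.ofReal_ne_top]
        _ ≤ _ := by gcongr; exact setLIntegral_le_lintegral _ _
    -- Expand the square in `t`; the cross term is estimated by `caccioppoli_pointwise` multiplied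
    -- by `2t`. The negative term is moved to the left, so that no subtraction of extended numbers
    -- occurs.
    have hIut : CensoredEnergy.energy σ A ut + ENNReal.ofReal (2 * t) *
        CensoredEnergy.energy σ A v ≤ CensoredEnergy.energy σ A u + ENNReal.ofReal (2 * t) * S +
          ENNReal.ofReal (t ^ 2) * CensoredEnergy.energy σ A φ := by
      have hsq : ∀ {f : 𝔼 → ℝ}, Measurable f → Measurable fun z : 𝔼 × 𝔼 =>
          kernelQuot σ ((f z.1 - f z.2) ^ 2) z := fun {f} hf =>
        Measurable.kernelQuot σ (((hf.comp measurable_fst).sub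
          (hf.comp measurable_snd)).pow_const 2)
      have hSm : Measurable fun z : 𝔼 × 𝔼 =>
          kernelQuot σ ((η z.1 - η z.2) ^ 2 * (w z.1 * w z.2)) z :=
        Measurable.kernelQuot σ ((((hηm.comp measurable_fst).sub
          (hηm.comp measurable_snd)).pow_const 2).mul
          ((hwm.comp measurable_fst).mul (hwm.comp measurable_snd)))
      simp only [energy_eq_kernelQuot, hS]
      rw [← lintegral_const_mul' _ _ ENNReal.ofReal_ne_top,
        ← lintegral_const_mul' _ _ ENNReal.ofReal_ne_top,
        ← lintegral_const_mul' _ _ ENNReal.ofReal_ne_top, ← lintegral_add_left (hsq hutm),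
        ← lintegral_add_left (hsq hum), ← lintegral_add_right _ ((hsq hφm).const_mul _)]
      refine lintegral_mono fun z => ?_
      have h0 : 0 ≤ (η z.1 - η z.2) ^ 2 * (w z.1 * w z.2) :=
        mul_nonneg (sq_nonneg _) (mul_nonneg (hw0 _) (hw0 _))
      rw [← kernelQuot_mul σ (by positivity), ← kernelQuot_mul σ (by positivity),
        ← kernelQuot_mul σ (by positivity), ← kernelQuot_add σ (by positivity) (by positivity),
        ← kernelQuot_add σ (by positivity) (by positivity),
        ← kernelQuot_add σ (by positivity) (by positivity)]
      refine kernelQuot_mono σ ?_ z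
      have h1 := caccioppoli_pointwise (u z.1) (u z.2) (η z.1) (η z.2) K
      simp only [hut, hv, hφ]
      change (η z.1 * w z.1 - η z.2 * w z.2) ^ 2 ≤ (u z.1 - u z.2) *
        (η z.1 ^ 2 * w z.1 - η z.2 ^ 2 * w z.2) + (η z.1 - η z.2) ^ 2 * (w z.1 * w z.2) at h1
      have h2 := mul_le_mul_of_nonneg_left h1 (show 0 ≤ 2 * t by positivity)
      linarith [show (u z.1 - t * η z.1 ^ 2 * w z.1 - (u z.2 - t * η z.2 ^ 2 * w z.2)) ^ 2 =
        (u z.1 - u z.2) ^ 2 - 2 * t * ((u z.1 - u z.2) *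
        (η z.1 ^ 2 * w z.1 - η z.2 ^ 2 * w z.2)) +
        t ^ 2 * (η z.1 ^ 2 * w z.1 - η z.2 ^ 2 * w z.2) ^ 2 by ring]
    have hIt_top : CensoredEnergy.energy σ A ut ≠ ∞ :=
      ((energy_mono hAΩ ut).trans_lt (hadm.mem.energy_lt_top hn hσ hσ' hΩv hΩm)).ne
    have hfin : CensoredEnergy.energy σ A ut + ENNReal.ofReal (2 * t) *
        CensoredEnergy.energy σ A v ≤ CensoredEnergy.energy σ A ut + ENNReal.ofReal (2 * t) *
          (lam * P + S + ENNReal.ofReal (t / 2) * CensoredEnergy.energy σ A φ) := by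
      refine hIut.trans ?_
      have h1 : CensoredEnergy.energy σ A u ≤
          CensoredEnergy.energy σ A ut + ENNReal.ofReal (2 * t) * (lam * P) := by
        rw [hlamD]
        calc lam * D ≤ lam * (Dt + ENNReal.ofReal (2 * t) * P) := by gcongr
          _ = lam * Dt + ENNReal.ofReal (2 * t) * (lam * P) := by ring
          _ ≤ _ := by gcongr
      have h2 : ENNReal.ofReal (t ^ 2) = ENNReal.ofReal (2 * t) * ENNReal.ofReal (t / 2) := by
        rw [← ENNReal.ofReal_mul (by positivity)]; congr 1; ring
      calc _ ≤ CensoredEnergy.energy σ A ut + ENNReal.ofReal (2 * t) * (lam * P) +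
            ENNReal.ofReal (2 * t) * S +
            ENNReal.ofReal (t ^ 2) * CensoredEnergy.energy σ A φ := by gcongr
        _ = _ := by rw [h2]; ring
    rw [ENNReal.add_le_add_iff_left hIt_top] at hfin
    exact (ENNReal.mul_le_mul_iff_right (by simp [ht]) ENNReal.ofReal_ne_top).mp hfin
  -- After division by `2t` the quadratic error carries the factor `t / 2`, and `φ` has finite
  -- energy, so it disappears in the limit.
  have hlim : CensoredEnergy.energy σ A v ≤ lam * P + S := by
    have ht : Tendsto (fun k : ℕ => lam * P + S + ENNReal.ofReal (1 / 2 * (1 / ((k : ℝ) + 1)) / 2) *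
        CensoredEnergy.energy σ A φ) atTop (𝓝 (lam * P + S + 0)) := by
      refine tendsto_const_nhds.add ?_
      have h1 : Tendsto (fun k : ℕ => ENNReal.ofReal (1 / 2 * (1 / ((k : ℝ) + 1)) / 2)) atTop
          (𝓝 (ENNReal.ofReal (1 / 2 * 0 / 2))) :=
        (ENNReal.continuous_ofReal.tendsto _).comp
          ((tendsto_one_div_add_atTop_nhds_zero_nat.const_mul _).div_const _)
      simpa using ENNReal.Tendsto.mul_const h1 (Or.inr hIφ)
    rw [add_zero] at ht
    refine ge_of_tendsto' ht fun k => key _ (by positivity) ?_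
    have : 1 / ((k : ℝ) + 1) ≤ 1 := by
      rw [div_le_one (by positivity)]; linarith [(Nat.cast_nonneg k : (0 : ℝ) ≤ k)]
    linarith
  refine hlim.trans ?_
  gcongr

end Caccioppoli

/-! ### One De Giorgi step. -/

theorem abs_max_one_sub_sq_sub_le {a b : ℝ} (ha : 0 ≤ a) (hb : 0 ≤ b) :
    |max (1 - a ^ 2) 0 - max (1 - b ^ 2) 0| ≤ 2 * |a - b| := by
  wlog hab : a ≤ b generalizing a b
  · rw [abs_sub_comm, abs_sub_comm a b]
    exact this hb ha (le_of_not_ge hab)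
  rw [abs_of_nonpos (sub_nonpos.mpr hab), abs_of_nonneg (sub_nonneg.mpr
    (max_le_max_right 0 (by nlinarith)))]
  rcases le_total a 1 with h1 | h1
  · rw [max_eq_left (by nlinarith)]
    rcases le_total b 1 with h2 | h2
    · rw [max_eq_left (by nlinarith)]; nlinarith
    · rw [max_eq_right (by nlinarith)]; nlinarith
  · rw [max_eq_right (by nlinarith), max_eq_right (by nlinarith)]
    linarith

section Step

variable {n : ℕ}

local notation "𝔼" => EuclideanSpace ℝ (Fin n)

/-- The cutoff `(1 - |x - x₀|² / ρ²)₊`, whose square is of class `C¹`. -/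
noncomputable def quadCutoff (x₀ : 𝔼) (ρ : ℝ) (x : 𝔼) : ℝ := max (1 - (‖x - x₀‖ / ρ) ^ 2) 0

theorem isCutoff_quadCutoff (x₀ : 𝔼) {R ρ : ℝ} (hR : 0 < R) (hρ : R / 2 ≤ ρ) :
    IsCutoff R (quadCutoff x₀ ρ) where
  pos := hR
  nonneg x := le_max_right _ _
  le_one x := max_le (by linarith [sq_nonneg (‖x - x₀‖ / ρ)]) zero_le_one
  lip x y := by
    have hρ0 : 0 < ρ := by linarith
    refine (abs_max_one_sub_sq_sub_le (by positivity) (by positivity)).trans ?_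
    rw [← sub_div, abs_div, abs_of_pos hρ0]
    have h1 : |‖x - x₀‖ - ‖y - x₀‖| ≤ ‖x - y‖ := by
      simpa using abs_norm_sub_norm_le (x - x₀) (y - x₀)
    calc 2 * (|‖x - x₀‖ - ‖y - x₀‖| / ρ) ≤ 2 * (‖x - y‖ / (R / 2)) := by gcongr
      _ = _ := by field_simp; ring

/-- The cutoff has a corner on the sphere of radius `ρ`, its square does not. Only the square has to
be `C¹`, because the competitor subtracts a multiple of `η² (u - K)₊`. -/
theorem contDiff_quadCutoff_sq (x₀ : 𝔼) (ρ : ℝ) : ContDiff ℝ 1 fun x => quadCutoff x₀ ρ x ^ 2 := by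
  have h1 : ContDiff ℝ 1 fun x : 𝔼 => 1 - (‖x - x₀‖ / ρ) ^ 2 := by
    simp_rw [div_pow]
    exact contDiff_const.sub (((contDiff_id.sub contDiff_const).norm_sq ℝ).div_const _)
  exact contDiff_max_zero_sq.comp h1

theorem quadCutoff_eq_zero {x₀ x : 𝔼} {ρ : ℝ} (hρ : 0 < ρ) (hx : ρ ≤ ‖x - x₀‖) :
    quadCutoff x₀ ρ x = 0 := by
  have : 1 ≤ ‖x - x₀‖ / ρ := (one_le_div hρ).mpr hx
  exact max_eq_right (by nlinarith)

theorem le_quadCutoff {x₀ x : 𝔼} {ρ r' : ℝ} (hρ : 0 < ρ) (hr : r' ≤ ρ) (hx : ‖x - x₀‖ ≤ r') :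
    (ρ - r') / ρ ≤ quadCutoff x₀ ρ x := by
  refine le_max_of_le_left ?_
  have h1 : ‖x - x₀‖ / ρ ≤ r' / ρ := by gcongr
  have h2 : r' / ρ ≤ 1 := (div_le_one hρ).mpr hr
  have h3 : 0 ≤ ‖x - x₀‖ / ρ := by positivity
  rw [sub_div, div_self hρ.ne']
  nlinarith

/-- The nonlocal cross term in the Caccioppoli inequality, split into a near and a far part. -/
theorem lintegral_cross_term_le {σ J R : ℝ} (hσ : 0 < σ) (hR : 0 < R)
    (hJ : ∀ y : 𝔼, ∫⁻ x : 𝔼, kernelQuot σ (min 1 (16 * ‖x - y‖ ^ 2 / R ^ 2)) (x, y) ≤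
        ENNReal.ofReal (J * R ^ (-(2 * σ)))) {u w : 𝔼 → ℝ} (hum : Measurable u)
    (hwm : Measurable w) (hw0 : ∀ x, 0 ≤ w x) (hwu : ∀ x, w x ≤ u x) (x₀ : 𝔼) {r τ : ℝ}
    (hτ : 0 < τ) (hτ1 : τ ≤ 1 / 8) (hr : r ≤ R) (hρ : R / 2 ≤ r - τ * R) :
    ∫⁻ z : 𝔼 × 𝔼, kernelQuot σ
        ((quadCutoff x₀ (r - τ * R) z.1 - quadCutoff x₀ (r - τ * R) z.2) ^ 2 *
        (w z.1 * w z.2)) z ≤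
      2 * (ENNReal.ofReal (J * R ^ (-(2 * σ))) *
          (∫⁻ x in Metric.ball x₀ r, ENNReal.ofReal (w x ^ 2)) +
        ENNReal.ofReal ((3 / τ) ^ ((n : ℝ) + 2 * σ)) *
          (∫⁻ x in Metric.ball x₀ r, ENNReal.ofReal (w x)) *
          ∫⁻ y, ENNReal.ofReal (u y / (R + ‖y - x₀‖) ^ ((n : ℝ) + 2 * σ))) := by
  classical
  set p : ℝ := (n : ℝ) + 2 * σ with hp
  have hp0 : 0 < p := by positivity
  set ρ := r - τ * R with hρdef
  have hρ0 : 0 < ρ := by linarith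
  have hρr : ρ ≤ r := by nlinarith
  have hη := isCutoff_quadCutoff x₀ hR hρ
  set η := quadCutoff x₀ ρ with hηdef
  set B := Metric.ball x₀ r with hB
  have hBm : MeasurableSet B := Metric.isOpen_ball.measurableSet
  set W : 𝔼 → ℝ := B.indicator w with hW
  have hWm : Measurable W := hwm.indicator hBm
  set a1 : 𝔼 → ℝ≥0∞ := fun x => ENNReal.ofReal (W x) with ha1
  set a2 : 𝔼 → ℝ≥0∞ := fun y => ENNReal.ofReal (u y / (R + ‖y - x₀‖) ^ p) with ha2
  have ha1m : Measurable a1 := hWm.ennreal_ofReal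
  have ha2m : Measurable a2 := (hum.div (by fun_prop)).ennreal_ofReal
  set c := ENNReal.ofReal ((3 / τ) ^ p) with hc
  set f1 : 𝔼 × 𝔼 → ℝ≥0∞ := fun z =>
    kernelQuot σ (min 1 (16 * ‖z.1 - z.2‖ ^ 2 / R ^ 2) * W z.2 ^ 2) z with hf1
  have h2 : Measurable fun z : 𝔼 × 𝔼 => min 1 (16 * ‖z.1 - z.2‖ ^ 2 / R ^ 2) := by fun_prop
  have hW2 : Measurable fun z : 𝔼 × 𝔼 => W z.2 := hWm.comp measurable_snd
  have hf1m : Measurable f1 := Measurable.kernelQuot σ (h2.mul (hW2.pow_const 2))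
  set f2 : 𝔼 × 𝔼 → ℝ≥0∞ := fun z => c * (a1 z.1 * a2 z.2) with hf2
  have hf2m : Measurable f2 :=
    ((ha1m.comp measurable_fst).mul (ha2m.comp measurable_snd)).const_mul c
  set F : 𝔼 × 𝔼 → ℝ≥0∞ := fun z => f1 z + f2 z with hF
  have hFm : Measurable F := hf1m.add hf2m
  have hηB : ∀ x, x ∉ B → η x = 0 := fun x hx => by
    refine quadCutoff_eq_zero hρ0 (hρr.trans ?_)
    rw [hB, mem_ball_iff_norm, not_lt] at hx
    exact hx
  -- the far interaction
  have hfar : ∀ x y : 𝔼, η x ≠ 0 → y ∉ B →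
      ENNReal.ofReal ((η x - η y) ^ 2 * (w x * w y) / ‖x - y‖ ^ p) ≤ f2 (x, y) := by
    intro x y hx hy
    have hxρ : ‖x - x₀‖ < ρ := by by_contra! h; exact hx (quadCutoff_eq_zero hρ0 h)
    have hxB : x ∈ B := by rw [hB, mem_ball_iff_norm]; linarith
    rw [hB, mem_ball_iff_norm, not_lt] at hy
    have h1 : ‖y - x₀‖ - ‖x - x₀‖ ≤ ‖x - y‖ := by
      have := norm_sub_norm_le (y - x₀) (x - x₀)
      rwa [sub_sub_sub_cancel_right, norm_sub_rev y x] at this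
    have hD : 0 < R + ‖y - x₀‖ := by positivity
    -- Here `|x - x₀| < r - τR` and `|y - x₀| ≥ r`, so `|x - y| ≥ |y - x₀| - r + τR`; together with
    -- `r ≤ R` this dominates the left side. It replaces the kernel at `x` by the tail weight
    -- centred at `x₀`.
    have h3 : τ / 3 * (R + ‖y - x₀‖) ≤ ‖x - y‖ := by nlinarith
    have h4 : (τ / 3) ^ p * (R + ‖y - x₀‖) ^ p ≤ ‖x - y‖ ^ p := by
      rw [← Real.mul_rpow (by positivity) hD.le]
      exact Real.rpow_le_rpow (by positivity) h3 hp0.le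
    have h5 : (η x - η y) ^ 2 ≤ 1 := (hη.sq_sub_le x y).trans (min_le_left _ _)
    have hWx : W x = w x := Set.indicator_of_mem hxB w
    simp only [hf2, hc, ha1, ha2, hWx]
    rw [← ENNReal.ofReal_mul (hw0 x), ← ENNReal.ofReal_mul (by positivity)]
    refine ENNReal.ofReal_le_ofReal ?_
    have h6 : (η x - η y) ^ 2 * (w x * w y) ≤ w x * u y := by
      calc (η x - η y) ^ 2 * (w x * w y) ≤ 1 * (w x * w y) :=
            mul_le_mul_of_nonneg_right h5 (mul_nonneg (hw0 x) (hw0 y))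
        _ ≤ w x * u y := by
            rw [one_mul]; exact mul_le_mul_of_nonneg_left (hwu y) (hw0 x)
    have huy : 0 ≤ u y := (hw0 y).trans (hwu y)
    have h7 : 0 < (τ / 3) ^ p * (R + ‖y - x₀‖) ^ p := by positivity
    calc (η x - η y) ^ 2 * (w x * w y) / ‖x - y‖ ^ p ≤
          w x * u y / ((τ / 3) ^ p * (R + ‖y - x₀‖) ^ p) :=
          div_le_div₀ (mul_nonneg (hw0 x) huy) h6 h7 h4
      _ = (3 / τ) ^ p * (w x * (u y / (R + ‖y - x₀‖) ^ p)) := by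
          rw [show (3 / τ : ℝ) = (τ / 3)⁻¹ by rw [inv_div], Real.inv_rpow (by positivity)]
          field_simp
  -- Near pairs are covered by `w x * w y ≤ w x ^ 2 + w y ^ 2`, far pairs by `f2` in one of the two
  -- orders; symmetrizing under the swap causes the overall factor `2`.
  have hpt : ∀ z : 𝔼 × 𝔼, kernelQuot σ ((η z.1 - η z.2) ^ 2 * (w z.1 * w z.2)) z ≤
      F z + F z.swap := by
    rintro ⟨x, y⟩
    simp only [Prod.swap_prod_mk, hF]
    by_cases hx : x ∈ B <;> by_cases hy : y ∈ B
    · have hWx : W x = w x := Set.indicator_of_mem hx w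
      have hWy : W y = w y := Set.indicator_of_mem hy w
      have h1 : kernelQuot σ ((η x - η y) ^ 2 * (w x * w y)) (x, y) ≤ f1 (x, y) + f1 (y, x) := by
        have e : f1 (y, x) =
            kernelQuot σ (min 1 (16 * ‖x - y‖ ^ 2 / R ^ 2) * W x ^ 2) (x, y) := by
          simp only [hf1]
          rw [← kernelQuot_swap, norm_sub_rev y x]
          rfl
        rw [e]
        simp only [hf1]
        rw [← kernelQuot_add σ (by positivity) (by positivity), hWx, hWy]
        refine kernelQuot_mono σ ?_ _
        have h3 := hη.sq_sub_le x y
        have h4 : w x * w y ≤ w y ^ 2 + w x ^ 2 := by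
            nlinarith [sq_nonneg (w x - w y), sq_nonneg (w x), sq_nonneg (w y)]
        rw [← mul_add]
        exact mul_le_mul h3 h4 (mul_nonneg (hw0 x) (hw0 y)) (by positivity)
      refine h1.trans ?_
      exact add_le_add le_self_add le_self_add
    · by_cases h0 : η x = 0
      · rw [h0, hηB y hy]; simp [kernelQuot]
      · exact ((hfar x y h0 hy).trans le_add_self).trans le_self_add
    · by_cases h0 : η y = 0
      · rw [h0, hηB x hx]; simp [kernelQuot]
      · have h1 := hfar y x h0 hx
        have e : kernelQuot σ ((η x - η y) ^ 2 * (w x * w y)) (x, y) =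
            ENNReal.ofReal ((η y - η x) ^ 2 * (w y * w x) / ‖y - x‖ ^ p) := by
          rw [norm_sub_rev y x, mul_comm (w y), ← neg_sub (η x) (η y), neg_sq]; rfl
        rw [e]
        exact (h1.trans le_add_self).trans le_add_self
    · rw [hηB x hx, hηB y hy]; simp [kernelQuot]
  have hswap : ∫⁻ z : 𝔼 × 𝔼, F z.swap = ∫⁻ z, F z :=
    (Measure.measurePreserving_swap (μ := (volume : Measure 𝔼))
      (ν := (volume : Measure 𝔼))).lintegral_comp hFm
  have hI1 : ∫⁻ z, f1 z ≤ ENNReal.ofReal (J * R ^ (-(2 * σ))) *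
      ∫⁻ x in B, ENNReal.ofReal (w x ^ 2) := by
    refine (lintegral_kernelQuot_mul_le hJ hWm).trans (le_of_eq ?_)
    rw [← lintegral_indicator hBm]
    congr 1
    refine lintegral_congr fun x => ?_
    by_cases hx : x ∈ B <;> simp [hW, hx]
  have hI2 : ∫⁻ z, f2 z = c * (∫⁻ x in B, ENNReal.ofReal (w x)) * ∫⁻ y, a2 y := by
    simp only [hf2]
    rw [lintegral_const_mul' _ _ ENNReal.ofReal_ne_top, Measure.volume_eq_prod,
      lintegral_prod_mul ha1m.aemeasurable ha2m.aemeasurable, mul_assoc]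
    congr 2
    rw [← lintegral_indicator hBm]
    refine lintegral_congr fun x => ?_
    by_cases hx : x ∈ B <;> simp [ha1, hW, hx]
  calc _ ≤ ∫⁻ z : 𝔼 × 𝔼, (F z + F z.swap) := lintegral_mono hpt
    _ = 2 * ∫⁻ z, F z := by rw [lintegral_add_left hFm, hswap, two_mul]
    _ = 2 * ((∫⁻ z, f1 z) + ∫⁻ z, f2 z) := by rw [← lintegral_add_left hf1m]
    _ ≤ _ := by rw [hI2]; gcongr

end Step

section DeGiorgi

variable {n : ℕ}

local notation "𝔼" => EuclideanSpace ℝ (Fin n)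

/-- One De Giorgi step between the levels `h` and `h + d` and the radii `r` and `r - 2 τ R`. -/
theorem exists_deGiorgi_step (hn : 0 < n) {σ : ℝ} (hσ : 1 / 2 < σ) (hσ' : σ < 1) :
    ∃ C J : ℝ, 0 < C ∧ 0 < J ∧ ∀ (N Λ : ℝ) (u : 𝔼 → ℝ) (x₀ : 𝔼) (R r τ h d Θ α : ℝ),
      IsStrictMinimizer σ N u → 0 ≤ Λ → CensoredEnergy.m n σ N ≤ ENNReal.ofReal Λ → 0 < R →
      r ≤ R → R / 2 ≤ r - 2 * τ * R → 0 < τ → τ ≤ 1 / 8 → 0 ≤ h → 0 < d → 0 ≤ Θ → 0 < α →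
      ∫⁻ y, ENNReal.ofReal (u y / (R + ‖y - x₀‖) ^ ((n : ℝ) + 2 * σ)) ≤ ENNReal.ofReal Θ →
      ∫⁻ x in Metric.ball x₀ r, ENNReal.ofReal (max (u x - h) 0 ^ 2) ≤ ENNReal.ofReal α →
      ∫⁻ x in Metric.ball x₀ (r - 2 * τ * R), ENNReal.ofReal (max (u x - (h + d)) 0 ^ 2) ≤
        ENNReal.ofReal ((τ ^ 2)⁻¹ * (C * (2 * α / d ^ 2) ^ (2 * σ / n)) *
          (Λ * (1 + h / d) + 2 * (J * R ^ (-(2 * σ))) +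
            2 * ((3 / τ) ^ ((n : ℝ) + 2 * σ) * d⁻¹ * Θ)) * α) := by
  have hσ0 : 0 < σ := by linarith
  obtain ⟨C, hC, hFK⟩ := exists_faberKrahn_excess hn hσ hσ'
  obtain ⟨J, hJ0, hJ⟩ := exists_lintegral_kernelQuot_le hn hσ0 hσ'
  refine ⟨C, J, hC, hJ0,
    fun N Λ u x₀ R r τ h d Θ α hu hΛ hm hR hr hr' hτ hτ1 hh hd hΘ hα hT ha => ?_⟩
  have hum := hu.measurable
  set K := h + d with hK
  have hK0 : 0 < K := by linarith
  set ρ := r - τ * R with hρdef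
  have hτR : 0 < τ * R := by positivity
  have hρ : R / 2 ≤ ρ := by linarith
  have hρ0 : 0 < ρ := by linarith
  have hρr : ρ ≤ r := by linarith
  have hη := isCutoff_quadCutoff x₀ hR hρ
  have hηc := contDiff_quadCutoff_sq x₀ ρ
  set η := quadCutoff x₀ ρ with hηdef
  set B := Metric.ball x₀ r with hB
  have hBm : MeasurableSet B := Metric.isOpen_ball.measurableSet
  set w : 𝔼 → ℝ := fun x => max (u x - K) 0 with hw
  have hwm : Measurable w := (hum.sub_const K).max measurable_const
  have hw0 : ∀ x, 0 ≤ w x := fun x => le_max_right _ _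
  have hwu : ∀ x, w x ≤ u x := fun x => max_le (by linarith) (hu.nonneg x)
  set wh : 𝔼 → ℝ := fun x => max (u x - h) 0 with hwh
  have hwhm : Measurable wh := (hum.sub_const h).max measurable_const
  have hwwh : ∀ x, w x ≤ wh x := fun x => max_le_max_right 0 (by linarith)
  have hηB : ∀ x, η x ≠ 0 → x ∈ B := fun x hx => by
    rw [hB, mem_ball_iff_norm]
    by_contra! h'
    exact hx (quadCutoff_eq_zero hρ0 (hρr.trans h'))
  set a := ∫⁻ x in B, ENNReal.ofReal (wh x ^ 2) with hadef
  -- lower bound for the cutoff on the small ball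
  have h1 : ∫⁻ x in Metric.ball x₀ (r - 2 * τ * R), ENNReal.ofReal (w x ^ 2) ≤
      ENNReal.ofReal (τ ^ 2)⁻¹ * ∫⁻ x, ENNReal.ofReal ((η x * w x) ^ 2) := by
    rw [← lintegral_const_mul' _ _ ENNReal.ofReal_ne_top]
    refine le_trans ?_ (setLIntegral_le_lintegral (Metric.ball x₀ (r - 2 * τ * R)) _)
    refine setLIntegral_mono' Metric.isOpen_ball.measurableSet fun x hx => ?_
    rw [← ENNReal.ofReal_mul (by positivity)]
    refine ENNReal.ofReal_le_ofReal ?_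
    rw [mem_ball_iff_norm] at hx
    -- The quotient is `τR / ρ ≥ τ`, because `ρ ≤ R`; its square is the source of the factor `τ⁻²`.
    have h2 : (ρ - (r - 2 * τ * R)) / ρ ≤ η x := le_quadCutoff hρ0 (by linarith) hx.le
    have h3 : τ ≤ η x := by
      refine le_trans ?_ h2
      rw [le_div_iff₀ hρ0]
      have : τ * ρ ≤ τ * R := by gcongr; linarith
      linarith
    have h4 : τ ^ 2 ≤ η x ^ 2 := by gcongr
    rw [mul_pow, inv_mul_eq_div, le_div_iff₀ (by positivity), mul_comm]
    gcongr
  -- measure of the superlevel set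
  have h2 : volume ({x | K ≤ u x} ∩ {x | η x ≠ 0}) < ENNReal.ofReal (2 * α / d ^ 2) := by
    set S := {x | K ≤ u x} ∩ {x | η x ≠ 0} with hS
    have hSm : MeasurableSet S :=
      (measurableSet_le measurable_const hum).inter
        (hη.measurable (measurableSet_singleton 0).compl)
    have h3 : ENNReal.ofReal (d ^ 2) * volume S ≤ ENNReal.ofReal α := by
      refine le_trans ?_ ha
      rw [← setLIntegral_const]
      refine le_trans ?_ (lintegral_mono_set (fun x hx => hηB x hx.2 : S ⊆ B))
      refine setLIntegral_mono' hSm fun x hx => ENNReal.ofReal_le_ofReal ?_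
      have h4 : d ≤ wh x := le_max_of_le_left (by linarith [show K ≤ u x from hx.1])
      gcongr
    -- Chebyshev gives `α / d²`; doubling it provides the strict inequality required by the
    -- Faber–Krahn transfer.
    refine (le_ofReal_inv_mul (by positivity) h3).trans_lt ?_
    rw [← ENNReal.ofReal_mul (by positivity)]
    refine (ENNReal.ofReal_lt_ofReal_iff (by positivity)).mpr ?_
    rw [inv_mul_eq_div]
    gcongr
    linarith
  have h3 := hFK N u R η K (2 * α / d ^ 2) hu.isMinimizer.1.mem hum hη hK0 (by positivity) h2
  have h4 := hu.caccioppoli hn hσ0 hσ' hη hηc hK0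
  have h5 : ∫⁻ x, ENNReal.ofReal (η x ^ 2 * (u x * max (u x - K) 0)) ≤
      ENNReal.ofReal (1 + h / d) * a := by
    rw [hadef, ← lintegral_const_mul' _ _ ENNReal.ofReal_ne_top, ← lintegral_indicator hBm]
    refine lintegral_mono fun x => ?_
    by_cases hx : η x = 0
    · simp [hx]
    rw [Set.indicator_of_mem (hηB x hx), ← ENNReal.ofReal_mul (by positivity)]
    refine ENNReal.ofReal_le_ofReal ?_
    rcases le_total (u x) K with h6 | h6
    · rw [max_eq_right (sub_nonpos.mpr h6)]
      simp only [mul_zero]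
      positivity
    have e1 : wh x = u x - h := max_eq_left (by linarith)
    rw [max_eq_left (sub_nonneg.mpr h6), e1]
    -- Above the level `K = h + d` one has `u - h ≥ d`, so `u` itself is controlled by the excess
    -- over `h`.
    have e2 : h ≤ h / d * (u x - h) := by
      rw [div_mul_eq_mul_div, le_div_iff₀ hd]
      gcongr; linarith
    have e3 : u x ≤ (1 + h / d) * (u x - h) := by linarith
    calc η x ^ 2 * (u x * (u x - K)) ≤ 1 * (u x * (u x - K)) :=
          mul_le_mul_of_nonneg_right (hη.sq.le_one x)
            (mul_nonneg (hu.nonneg x) (sub_nonneg.mpr h6))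
      _ ≤ ((1 + h / d) * (u x - h)) * (u x - h) := by
          rw [one_mul]
          exact mul_le_mul e3 (by linarith) (sub_nonneg.mpr h6)
            (mul_nonneg (by positivity) (by linarith))
      _ = _ := by ring
  have h6 := lintegral_cross_term_le hσ0 hR (fun y => hJ R y hR) hum hwm hw0 hwu x₀ hτ hτ1 hr hρ
  have h7 : ∫⁻ x in B, ENNReal.ofReal (w x ^ 2) ≤ a :=
    lintegral_mono fun x => ENNReal.ofReal_le_ofReal (pow_le_pow_left₀ (hw0 x) (hwwh x) 2)
  -- Where `w` is positive, the lower excess is at least `d`, so the `L¹` norm costs `d⁻¹` times the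
  -- squared `L²` norm.
  have h8 : ∫⁻ x in B, ENNReal.ofReal (w x) ≤ ENNReal.ofReal d⁻¹ * a := by
    rw [hadef, ← lintegral_const_mul' _ _ ENNReal.ofReal_ne_top]
    refine lintegral_mono fun x => ?_
    rw [← ENNReal.ofReal_mul (by positivity)]
    refine ENNReal.ofReal_le_ofReal ?_
    rcases le_total (u x) K with h9 | h9
    · have : w x = 0 := max_eq_right (sub_nonpos.mpr h9)
      rw [this]; positivity
    · have e1 : wh x = u x - h := max_eq_left (by linarith)
      rw [inv_mul_eq_div, le_div_iff₀ hd, sq]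
      exact mul_le_mul (hwwh x) (by rw [e1]; linarith) hd.le (by rw [e1]; linarith)
  have hp0 : 0 < (n : ℝ) + 2 * σ := by positivity
  calc _ ≤ ENNReal.ofReal (τ ^ 2)⁻¹ * ∫⁻ x, ENNReal.ofReal ((η x * w x) ^ 2) := h1
    _ ≤ ENNReal.ofReal (τ ^ 2)⁻¹ * (ENNReal.ofReal (C * (2 * α / d ^ 2) ^ (2 * σ / n)) *
          (ENNReal.ofReal Λ * (ENNReal.ofReal (1 + h / d) * ENNReal.ofReal α) +
          2 * (ENNReal.ofReal (J * R ^ (-(2 * σ))) * ENNReal.ofReal α +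
            ENNReal.ofReal ((3 / τ) ^ ((n : ℝ) + 2 * σ)) * (ENNReal.ofReal d⁻¹ * ENNReal.ofReal α) *
              ENNReal.ofReal Θ))) := by
        refine mul_le_mul_right (h3.trans (mul_le_mul_right (h4.trans (add_le_add ?_ ?_)) _)) _
        · exact mul_le_mul' hm (h5.trans (mul_le_mul_right ha _))
        · refine (setLIntegral_le_lintegral _ _).trans (h6.trans ?_)
          refine mul_le_mul_right (add_le_add (mul_le_mul_right (h7.trans ha) _)
            (mul_le_mul' (mul_le_mul_right (h8.trans (mul_le_mul_right ha _)) _) hT)) _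
    _ = _ := by
        have e2 : (2 : ℝ≥0∞) = ENNReal.ofReal 2 := by norm_num
        rw [e2]
        have hc0 : 0 ≤ C * (2 * α / d ^ 2) ^ (2 * σ / n) := by positivity
        have hj0 : 0 ≤ J * R ^ (-(2 * σ)) := by positivity
        have ht0 : 0 ≤ (3 / τ) ^ ((n : ℝ) + 2 * σ) := by positivity
        have hl0 : 0 ≤ 1 + h / d := by positivity
        rw [← ENNReal.ofReal_mul hl0, ← ENNReal.ofReal_mul hΛ, ← ENNReal.ofReal_mul hj0,
          ← ENNReal.ofReal_mul (by positivity), ← ENNReal.ofReal_mul ht0,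
          ← ENNReal.ofReal_mul (by positivity),
          ← ENNReal.ofReal_add (by positivity) (by positivity),
          ← ENNReal.ofReal_mul (by positivity),
          ← ENNReal.ofReal_add (by positivity) (by positivity),
          ← ENNReal.ofReal_mul hc0, ← ENNReal.ofReal_mul (by positivity)]
        congr 1
        ring

end DeGiorgi

/-! ### The De Giorgi iteration. -/

/-- The level increment is `d = 4τk`. All three terms are brought to the common size `τ^(-(n + 2σ +
1)) R^(-2σ) ε⁻¹`: for the first two this uses `R, ε ≤ 1`, for the tail the condition `ε R^(2σ) Θ ≤
k`, from which `ε⁻¹` originates. -/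
theorem deGiorgi_factor_le {n : ℕ} (hn : 0 < n) {σ : ℝ} (hσ : 0 < σ) {τ k h R ε Θ Λ J : ℝ}
    (hτ : 0 < τ) (hτ1 : τ ≤ 1 / 8) (hk : 0 < k) (hhk : h ≤ k) (hR : 0 < R)
    (hR1 : R ≤ 1) (hε : 0 < ε) (hε1 : ε ≤ 1) (hΘ : ε * R ^ (2 * σ) * Θ ≤ k)
    (hΛ : 0 ≤ Λ) (hJ : 0 ≤ J) :
    Λ * (1 + h / (4 * τ * k)) + 2 * (J * R ^ (-(2 * σ))) +
        2 * ((3 / τ) ^ ((n : ℝ) + 2 * σ) * (4 * τ * k)⁻¹ * Θ) ≤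
      (Λ + 2 * J + 3 ^ ((n : ℝ) + 2 * σ)) * τ ^ (-((n : ℝ) + 2 * σ + 1)) *
        (R ^ (-(2 * σ)) * ε⁻¹) := by
  set p : ℝ := (n : ℝ) + 2 * σ with hp
  have hp0 : 0 < p := by have : (0 : ℝ) < n := by exact_mod_cast hn
                         positivity
  have hRσ : 1 ≤ R ^ (-(2 * σ)) := Real.one_le_rpow_of_pos_of_le_one_of_nonpos hR hR1 (by linarith)
  have hεi : 1 ≤ ε⁻¹ := (one_le_inv₀ hε).mpr hε1
  have hX : 1 ≤ R ^ (-(2 * σ)) * ε⁻¹ := one_le_mul_of_one_le_of_one_le hRσ hεi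
  have hτp : τ ^ (-(p + 1)) = τ ^ (-p) * τ⁻¹ := by
    rw [← Real.rpow_neg_one τ, ← Real.rpow_add hτ]; congr 1; ring
  have hτp1 : 1 ≤ τ ^ (-p) :=
    Real.one_le_rpow_of_pos_of_le_one_of_nonpos hτ (by linarith) (by linarith)
  have hτi : 1 ≤ τ⁻¹ := (one_le_inv₀ hτ).mpr (by linarith)
  have hY : τ⁻¹ ≤ τ ^ (-(p + 1)) := by
    rw [hτp]; exact le_mul_of_one_le_left (by positivity) hτp1
  have hY1 : 1 ≤ τ ^ (-(p + 1)) := hτi.trans hY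
  have t1 : 1 + h / (4 * τ * k) ≤ τ ^ (-(p + 1)) * (R ^ (-(2 * σ)) * ε⁻¹) := by
    have e1 : h / (4 * τ * k) ≤ τ⁻¹ / 4 := by
      rw [div_le_div_iff₀ (by positivity) (by norm_num)]
      have : τ⁻¹ * (4 * τ * k) = 4 * k := by field_simp
      linarith
    have e2 : 8 ≤ τ⁻¹ := by
      rw [le_inv_comm₀ (by norm_num) hτ]; linarith
    calc 1 + h / (4 * τ * k) ≤ τ⁻¹ := by linarith
      _ ≤ τ ^ (-(p + 1)) * 1 := by rw [mul_one]; exact hY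
      _ ≤ _ := by gcongr
  have t2 : J * R ^ (-(2 * σ)) ≤ J * (τ ^ (-(p + 1)) * (R ^ (-(2 * σ)) * ε⁻¹)) := by
    gcongr
    calc R ^ (-(2 * σ)) ≤ R ^ (-(2 * σ)) * ε⁻¹ := le_mul_of_one_le_right (by positivity) hεi
      _ ≤ _ := le_mul_of_one_le_left (by positivity) hY1
  have t3 : 2 * ((3 / τ) ^ p * (4 * τ * k)⁻¹ * Θ) ≤
      3 ^ p * (τ ^ (-(p + 1)) * (R ^ (-(2 * σ)) * ε⁻¹)) := by
    have e1 : Θ / k ≤ R ^ (-(2 * σ)) * ε⁻¹ := by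
      rw [Real.rpow_neg hR.le, ← mul_inv, ← one_div, div_le_div_iff₀ hk (by positivity)]
      linarith
    have e2 : 2 * ((3 / τ) ^ p * (4 * τ * k)⁻¹ * Θ) =
        1 / 2 * (3 ^ p * (τ ^ (-(p + 1)) * (Θ / k))) := by
      rw [hτp, Real.div_rpow (by norm_num) hτ.le, Real.rpow_neg hτ.le]
      field_simp
      norm_num
    rw [e2]
    have e3 : 3 ^ p * (τ ^ (-(p + 1)) * (Θ / k)) ≤
      3 ^ p * (τ ^ (-(p + 1)) * (R ^ (-(2 * σ)) * ε⁻¹)) := by gcongr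
    have e4 : 0 ≤ 3 ^ p * (τ ^ (-(p + 1)) * (R ^ (-(2 * σ)) * ε⁻¹)) := by positivity
    linarith
  have t1' := mul_le_mul_of_nonneg_left t1 hΛ
  nlinarith

/-- The mass is measured in units of `k² Rⁿ ε^(n/(2σ))`. Raised to the power `2σ/n`, the factor `Rⁿ
ε^(n/(2σ))` is `R^(2σ) ε`, cancelling `R^(-2σ) ε⁻¹`, while `k` cancels against the increment. The
recursion for `s` is thus free of `k`, `R` and `ε`. -/
theorem deGiorgi_bound_le {n : ℕ} (hn : 0 < n) {σ : ℝ} (hσ : 0 < σ) {τ k h R ε Θ Λ J C s : ℝ}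
    (hτ : 0 < τ) (hτ1 : τ ≤ 1 / 8) (hk : 0 < k) (hh : 0 ≤ h) (hhk : h ≤ k)
    (hR : 0 < R) (hR1 : R ≤ 1) (hε : 0 < ε) (hε1 : ε ≤ 1) (hΘ0 : 0 ≤ Θ)
    (hΘ : ε * R ^ (2 * σ) * Θ ≤ k) (hΛ : 0 ≤ Λ) (hJ : 0 ≤ J) (hC : 0 ≤ C) (hs : 0 < s) :
    (τ ^ 2)⁻¹ * (C * (2 * (k ^ 2 * R ^ (n : ℝ) * ε ^ ((n : ℝ) / (2 * σ)) * s) /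
        (4 * τ * k) ^ 2) ^ (2 * σ / n)) *
        (Λ * (1 + h / (4 * τ * k)) + 2 * (J * R ^ (-(2 * σ))) +
          2 * ((3 / τ) ^ ((n : ℝ) + 2 * σ) * (4 * τ * k)⁻¹ * Θ)) *
        (k ^ 2 * R ^ (n : ℝ) * ε ^ ((n : ℝ) / (2 * σ)) * s) ≤
      k ^ 2 * R ^ (n : ℝ) * ε ^ ((n : ℝ) / (2 * σ)) *
        (C * (Λ + 2 * J + 3 ^ ((n : ℝ) + 2 * σ)) *
          τ ^ (-((n : ℝ) + 2 * σ + 3 + 2 * (2 * σ / n))) * s ^ (1 + 2 * σ / n)) := by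
  have hn' : (0 : ℝ) < n := by exact_mod_cast hn
  have hF := deGiorgi_factor_le hn hσ hτ hτ1 hk hhk hR hR1 hε hε1 hΘ hΛ hJ
  set β : ℝ := 2 * σ / n with hβ
  have hβ0 : 0 < β := by positivity
  set M := Λ + 2 * J + 3 ^ ((n : ℝ) + 2 * σ) with hM
  have hM0 : 0 ≤ M := by positivity
  have h1 : (2 * (k ^ 2 * R ^ (n : ℝ) * ε ^ ((n : ℝ) / (2 * σ)) * s) / (4 * τ * k) ^ 2) ^ β ≤
      R ^ (2 * σ) * ε * (s ^ β * τ ^ (-(2 * β))) := by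
    have e1 : 2 * (k ^ 2 * R ^ (n : ℝ) * ε ^ ((n : ℝ) / (2 * σ)) * s) / (4 * τ * k) ^ 2 ≤
        R ^ (n : ℝ) * ε ^ ((n : ℝ) / (2 * σ)) * (s * (τ ^ (2 : ℝ))⁻¹) := by
      have : 2 * (k ^ 2 * R ^ (n : ℝ) * ε ^ ((n : ℝ) / (2 * σ)) * s) / (4 * τ * k) ^ 2 =
          1 / 8 * (R ^ (n : ℝ) * ε ^ ((n : ℝ) / (2 * σ)) * (s * (τ ^ (2 : ℝ))⁻¹)) := by
        rw [Real.rpow_two]; field_simp; norm_num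
      rw [this]
      have : 0 ≤ R ^ (n : ℝ) * ε ^ ((n : ℝ) / (2 * σ)) * (s * (τ ^ (2 : ℝ))⁻¹) := by positivity
      linarith
    refine (Real.rpow_le_rpow (by positivity) e1 hβ0.le).trans (le_of_eq ?_)
    rw [Real.mul_rpow (by positivity) (by positivity),
      Real.mul_rpow (by positivity) (by positivity),
      Real.mul_rpow (by positivity) (by positivity), ← Real.rpow_mul hR.le, ← Real.rpow_mul hε.le,
      ← Real.rpow_neg hτ.le, ← Real.rpow_mul hτ.le]
    have e2 : (n : ℝ) * β = 2 * σ := by rw [hβ]; field_simp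
    have e3 : (n : ℝ) / (2 * σ) * β = 1 := by rw [hβ]; field_simp
    rw [e2, e3, Real.rpow_one]
    congr 3; ring
  set Q := k ^ 2 * R ^ (n : ℝ) * ε ^ ((n : ℝ) / (2 * σ)) with hQ
  have hQ0 : 0 < Q := by positivity
  have hF0 : 0 ≤ M * τ ^ (-((n : ℝ) + 2 * σ + 1)) * (R ^ (-(2 * σ)) * ε⁻¹) := by positivity
  calc _ ≤ (τ ^ 2)⁻¹ * (C * (R ^ (2 * σ) * ε * (s ^ β * τ ^ (-(2 * β))))) *
        (M * τ ^ (-((n : ℝ) + 2 * σ + 1)) * (R ^ (-(2 * σ)) * ε⁻¹)) * (Q * s) := by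
        gcongr
    _ = (R ^ (2 * σ) * R ^ (-(2 * σ))) * (ε * ε⁻¹) * (Q * (C * M *
        ((τ ^ 2)⁻¹ * τ ^ (-(2 * β)) * τ ^ (-((n : ℝ) + 2 * σ + 1))) * (s * s ^ β))) := by ring
    _ = _ := by
        rw [← Real.rpow_add hR, add_neg_cancel, Real.rpow_zero, mul_inv_cancel₀ hε.ne', one_mul,
          one_mul, ← Real.rpow_two τ, ← Real.rpow_neg hτ.le, ← Real.rpow_add hτ, ← Real.rpow_add hτ,
          ← Real.rpow_one_add' hs.le (by positivity)]
        congr 4; ring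

/-- The sequence `c θ^j` solves the recursion exactly: `θ^β = 2^(-g)` offsets the growth `2^(jg)`
coming from the shrinking `τ`, and `c` is small enough for one step to gain the factor `θ`. -/
theorem deGiorgi_recursion {M g β c θ : ℝ} (hβ : 0 < β) (hc : 0 < c) (hθ : 0 < θ)
    (hθβ : θ ^ β = (1 / 2) ^ g) (hcβ : M * (1 / 8) ^ (-g) * c ^ β = θ) (j : ℕ) :
    M * (1 / 8 * (1 / 2) ^ j) ^ (-g) * (c * θ ^ j) ^ (1 + β) = c * θ ^ (j + 1) := by
  have hj0 : (0 : ℝ) < (1 / 2) ^ j := by positivity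
  have hs0 : 0 < c * θ ^ j := by positivity
  have e1 : (θ ^ j) ^ β = ((1 / 2) ^ j) ^ g := by
    rw [← Real.rpow_natCast, ← Real.rpow_natCast, ← Real.rpow_mul hθ.le, mul_comm,
      Real.rpow_mul hθ.le, hθβ, ← Real.rpow_mul (by norm_num), ← Real.rpow_mul (by norm_num),
      mul_comm]
  have e2 : (((1 : ℝ) / 2) ^ j) ^ (-g) * ((1 / 2) ^ j) ^ g = 1 := by
    rw [← Real.rpow_add hj0, neg_add_cancel, Real.rpow_zero]
  rw [Real.mul_rpow (by norm_num) hj0.le, Real.rpow_one_add' hs0.le (by positivity),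
    Real.mul_rpow hc.le (by positivity), e1]
  calc M * ((1 / 8) ^ (-g) * ((1 / 2) ^ j) ^ (-g)) * (c * θ ^ j * (c ^ β * ((1 / 2) ^ j) ^ g))
      = (M * (1 / 8) ^ (-g) * c ^ β) * (c * θ ^ j) *
        (((1 / 2) ^ j) ^ (-g) * ((1 / 2) ^ j) ^ g) := by ring
    _ = c * θ ^ (j + 1) := by rw [hcβ, e2, pow_succ]; ring

theorem ae_le_of_lintegral_excess_le {α : Type*} [MeasurableSpace α] {μ : Measure α} {u : α → ℝ}
    (hu : Measurable u) {k : ℝ} {b : ℕ → ℝ≥0∞} (hb : Tendsto b atTop (𝓝 0))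
    (hle : ∀ j, ∫⁻ x, ENNReal.ofReal (max (u x - k) 0 ^ 2) ∂μ ≤ b j) : ∀ᵐ x ∂μ, u x ≤ k := by
  have hzero := le_antisymm (ge_of_tendsto' hb hle) zero_le
  rw [lintegral_eq_zero_iff (((hu.sub_const k).max measurable_const).pow_const 2).ennreal_ofReal]
    at hzero
  filter_upwards [hzero] with x hx
  simp only [Pi.zero_apply, ENNReal.ofReal_eq_zero] at hx
  have h2 : max (u x - k) 0 = 0 := by
    have := le_antisymm hx (sq_nonneg _)
    exact pow_eq_zero_iff two_ne_zero |>.mp this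
  linarith [le_max_left (u x - k) 0]

section DeGiorgi

variable {n : ℕ}

local notation "𝔼" => EuclideanSpace ℝ (Fin n)

/-- The De Giorgi iteration: smallness of the `L²` norm at the right scale gives a pointwise
bound. -/
theorem exists_ae_le_of_small (hn : 0 < n) {σ : ℝ} (hσ : 1 / 2 < σ) (hσ' : σ < 1) {Λ : ℝ}
    (hΛ : 0 ≤ Λ) :
    ∃ c : ℝ, 0 < c ∧ ∀ (N : ℝ) (u : 𝔼 → ℝ) (x₀ : 𝔼) (R ε Θ k : ℝ),
      IsStrictMinimizer σ N u → CensoredEnergy.m n σ N ≤ ENNReal.ofReal Λ → 0 < R → R ≤ 1 →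
      0 < ε → ε ≤ 1 → 0 ≤ Θ → 0 < k →
      ∫⁻ y, ENNReal.ofReal (u y / (R + ‖y - x₀‖) ^ ((n : ℝ) + 2 * σ)) ≤ ENNReal.ofReal Θ →
      ε * R ^ (2 * σ) * Θ ≤ k →
      ∫⁻ x in Metric.ball x₀ R, ENNReal.ofReal (u x ^ 2) ≤
        ENNReal.ofReal (k ^ 2 * R ^ (n : ℝ) * ε ^ ((n : ℝ) / (2 * σ)) * c) →
      ∀ᵐ x ∂(volume.restrict (Metric.ball x₀ (R / 2))), u x ≤ k := by
  have hσ0 : 0 < σ := by linarith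
  have hn' : (0 : ℝ) < n := by exact_mod_cast hn
  obtain ⟨C, J, hC, hJ, hstep⟩ := exists_deGiorgi_step hn hσ hσ'
  set β : ℝ := 2 * σ / n with hβ
  have hβ0 : 0 < β := by positivity
  set M := C * (Λ + 2 * J + 3 ^ ((n : ℝ) + 2 * σ)) with hM
  have hM0 : 0 < M := by positivity
  set g : ℝ := (n : ℝ) + 2 * σ + 3 + 2 * β with hg
  have hg0 : 0 < g := by positivity
  set θ : ℝ := (1 / 2) ^ (g / β) with hθ
  have hθ0 : 0 < θ := by positivity
  have hθ1 : θ < 1 := Real.rpow_lt_one (by norm_num) (by norm_num) (by positivity)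
  have hθβ : θ ^ β = (1 / 2) ^ g := by
    rw [hθ, ← Real.rpow_mul (by norm_num), div_mul_cancel₀ _ hβ0.ne']
  set c : ℝ := (θ / (M * (1 / 8) ^ (-g))) ^ (1 / β) with hc
  have hc0 : 0 < c := by positivity
  have hcβ : M * (1 / 8) ^ (-g) * c ^ β = θ := by
    rw [hc, ← Real.rpow_mul (by positivity), one_div_mul_cancel hβ0.ne', Real.rpow_one]
    field_simp
  refine ⟨c, hc0, fun N u x₀ R ε Θ k hu hm hR hR1 hε hε1 hΘ hk hT hΘk h0 => ?_⟩
  have hum := hu.measurable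
  set Q := k ^ 2 * R ^ (n : ℝ) * ε ^ ((n : ℝ) / (2 * σ)) with hQ
  have hQ0 : 0 < Q := by positivity
  -- Radii decrease from `R` to `R / 2` and levels increase from `0` to `k`. With `τ = 2^(-j) / 8`,
  -- the radius drops by `2τR` and the level rises by `4τk` at each step.
  have hiter : ∀ j : ℕ, ∫⁻ x in Metric.ball x₀ (R / 2 * (1 + (1 / 2) ^ j)),
      ENNReal.ofReal (max (u x - k * (1 - (1 / 2) ^ j)) 0 ^ 2) ≤
        ENNReal.ofReal (Q * (c * θ ^ j)) := by
    intro j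
    induction j with
    | zero =>
      have : ∀ x, max (u x) 0 = u x := fun x => max_eq_left (hu.nonneg x)
      have e : R / 2 * (1 + 1) = R := by ring
      simpa [this, e] using h0
    | succ j ih =>
      have hj0 : (0 : ℝ) < (1 / 2) ^ j := by positivity
      have hj1 : ((1 : ℝ) / 2) ^ j ≤ 1 := pow_le_one₀ (by norm_num) (by norm_num)
      set τ : ℝ := 1 / 8 * (1 / 2) ^ j with hτ
      have hτ0 : 0 < τ := by positivity
      have hτ1 : τ ≤ 1 / 8 := by linarith
      have hs0 : 0 < c * θ ^ j := by positivity
      have h1 := hstep N Λ u x₀ R (R / 2 * (1 + (1 / 2) ^ j)) τ (k * (1 - (1 / 2) ^ j))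
        (4 * τ * k) Θ (Q * (c * θ ^ j)) hu hΛ hm hR (by nlinarith) (by rw [hτ]; nlinarith) hτ0 hτ1
        (mul_nonneg hk.le (by linarith)) (by positivity) hΘ (by positivity) hT ih
      have e1 : R / 2 * (1 + (1 / 2) ^ j) - 2 * τ * R = R / 2 * (1 + (1 / 2) ^ (j + 1)) := by
        rw [hτ, pow_succ]; ring
      have e2 : k * (1 - (1 / 2) ^ j) + 4 * τ * k = k * (1 - (1 / 2) ^ (j + 1)) := by
        rw [hτ, pow_succ]; ring
      rw [e1, e2] at h1
      refine h1.trans (ENNReal.ofReal_le_ofReal ?_)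
      refine (deGiorgi_bound_le hn hσ0 hτ0 hτ1 hk (mul_nonneg hk.le (by linarith))
        (by nlinarith) hR hR1 hε hε1 hΘ hΘk hΛ hJ.le hC.le
        hs0).trans ?_
      rw [← hQ]
      refine mul_le_mul_of_nonneg_left (le_of_eq ?_) hQ0.le
      exact deGiorgi_recursion hβ0 hc0 hθ0 hθβ hcβ j
  have hlim : Tendsto (fun j : ℕ => ENNReal.ofReal (Q * (c * θ ^ j))) atTop (𝓝 0) := by
    have h1 : Tendsto (fun j : ℕ => Q * (c * θ ^ j)) atTop (𝓝 (Q * (c * 0))) :=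
      ((tendsto_pow_atTop_nhds_zero_of_lt_one hθ0.le hθ1).const_mul c).const_mul Q
    rw [mul_zero, mul_zero] at h1
    rw [← ENNReal.ofReal_zero]
    exact ENNReal.tendsto_ofReal h1
  refine ae_le_of_lintegral_excess_le hum hlim fun j => le_trans ?_ (hiter j)
  have hj0 : (0 : ℝ) < (1 / 2) ^ j := by positivity
  have hRj : R / 2 ≤ R / 2 * (1 + (1 / 2) ^ j) := le_mul_of_one_le_right (by linarith) (by linarith)
  have hkj : k * (1 - (1 / 2) ^ j) ≤ k := mul_le_of_le_one_right hk.le (by linarith)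
  refine (lintegral_mono_set (Metric.ball_subset_ball hRj)).trans (lintegral_mono fun x => ?_)
  refine ENNReal.ofReal_le_ofReal (pow_le_pow_left₀ (le_max_right _ _) ?_ 2)
  exact max_le_max_right 0 (by linarith)

end DeGiorgi

/-! ### Uniform bound on `m(N)`, representatives and conclusion. -/

section Main

variable {n : ℕ}

local notation "𝔼" => EuclideanSpace ℝ (Fin n)

theorem CensoredEnergy.IsTest.memH0 {σ : ℝ} {Ω : Set 𝔼} {φ : 𝔼 → ℝ}
    (h : CensoredEnergy.IsTest Ω φ) : CensoredEnergy.MemH0 σ Ω φ where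
  memLp := h.contDiff.continuous.memLp_of_hasCompactSupport h.hasCompactSupport
  eq_zero := ae_of_all _ fun _ hx => h.eq_zero hx
  approx := ⟨fun _ => φ, fun _ => h, by simp [CensoredEnergy.energy], by simp⟩

/-- The infimum `m(N)` is bounded uniformly in `N ≥ N₀`. -/
theorem exists_m_le (hn : 0 < n) {σ : ℝ} (hσ : 0 < σ) (hσ' : σ < 1) {N₀ : ℝ} (hN₀ : 0 < N₀) :
    ∃ Λ : ℝ, 0 ≤ Λ ∧ ∀ N, N₀ ≤ N → CensoredEnergy.m n σ N ≤ ENNReal.ofReal Λ := by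
  let b : ContDiffBump (0 : 𝔼) := ⟨N₀ / 4, N₀ / 2, by positivity, by linarith⟩
  have hbc : Continuous (b : 𝔼 → ℝ) := b.continuous
  have htest : ∀ N, N₀ ≤ N → CensoredEnergy.IsTest (Metric.ball (0 : 𝔼) N) b := fun N hN =>
    ⟨b.contDiff, b.hasCompactSupport, by
      rw [b.tsupport_eq]
      exact Metric.closedBall_subset_ball (show N₀ / 2 < N by linarith)⟩
  have hb0 : (b : 𝔼 → ℝ) 0 = 1 := b.one_of_mem_closedBall (by simp [b]; linarith)
  have hne : ¬ (b : 𝔼 → ℝ) =ᵐ[volume] 0 := fun h => by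
    have h1 := (Continuous.ae_eq_iff_eq volume hbc continuous_zero).mp h
    have h2 := congrFun h1 0
    rw [hb0] at h2
    exact one_ne_zero h2
  have hadm : ∀ N, N₀ ≤ N → CensoredEnergy.Admissible σ N (b : 𝔼 → ℝ) := fun N hN =>
    ⟨(htest N hN).memH0, hne, ae_of_all _ fun x => b.nonneg⟩
  have hsub : {x | 0 < b x} ⊆ Metric.ball (0 : 𝔼) N₀ := fun x hx => by
    by_contra h
    exact (ne_of_gt hx) ((htest N₀ le_rfl).eq_zero h)
  have hvol : volume {x | 0 < b x} < ∞ := (measure_mono hsub).trans_lt measure_ball_lt_top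
  have hE : CensoredEnergy.energy σ {x | 0 < b x} b < ∞ :=
    energy_lt_top_of_isTest hn hσ hσ' (htest N₀ le_rfl) hvol
      (measurableSet_lt measurable_const hbc.measurable)
  have hD : ∫⁻ x in Metric.ball (0 : 𝔼) N₀, ENNReal.ofReal (b x ^ 2) ≠ 0 := by
    intro h0
    rw [lintegral_eq_zero_iff (hbc.measurable.pow_const 2).ennreal_ofReal, Filter.EventuallyEq,
      ae_restrict_iff' Metric.isOpen_ball.measurableSet] at h0
    refine hne ?_
    filter_upwards [h0] with x hx
    by_cases hxN : x ∈ Metric.ball (0 : 𝔼) N₀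
    · have := hx hxN
      simp only [Pi.zero_apply, ENNReal.ofReal_eq_zero] at this
      simpa using le_antisymm this (sq_nonneg _)
    · exact (htest N₀ le_rfl).eq_zero hxN
  have hfin : CensoredEnergy.functional σ N₀ (b : 𝔼 → ℝ) ≠ ∞ := by
    rw [functional_eq]
    exact ENNReal.add_ne_top.mpr ⟨ENNReal.div_ne_top hE.ne hD, hvol.ne⟩
  refine ⟨(CensoredEnergy.functional σ N₀ (b : 𝔼 → ℝ)).toReal, ENNReal.toReal_nonneg,
    fun N hN => ?_⟩
  rw [ENNReal.ofReal_toReal hfin]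
  -- For this fixed competitor `N` enters only through the domain of the denominator, which grows
  -- with `N`.
  refine (iInf₂_le (b : 𝔼 → ℝ) (hadm N hN)).trans ?_
  rw [functional_eq, functional_eq]
  gcongr

theorem energy_congr_ae {σ : ℝ} {A A' : Set 𝔼} {u u' : 𝔼 → ℝ} (hA : A =ᵐ[volume] A')
    (hu : u =ᵐ[volume] u') : CensoredEnergy.energy σ A u = CensoredEnergy.energy σ A' u' := by
  have h1 : (A ×ˢ A : Set (𝔼 × 𝔼)) =ᵐ[volume] (A' ×ˢ A' : Set (𝔼 × 𝔼)) := by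
    have := ae_prod_of_ae hA hA Set.univ
    rw [Measure.restrict_univ] at this
    filter_upwards [this] with z hz
    have h2 : z.1 ∈ A ↔ z.1 ∈ A' := iff_of_eq hz.1
    have h3 : z.2 ∈ A ↔ z.2 ∈ A' := iff_of_eq hz.2
    exact propext (and_congr h2 h3)
  rw [CensoredEnergy.energy, CensoredEnergy.energy, Measure.restrict_congr_set h1]
  refine lintegral_congr_ae ?_
  filter_upwards [ae_prod_of_ae hu hu (A' ×ˢ A')] with z hz
  rw [hz.1, hz.2]

theorem setOf_pos_congr_ae {u u' : 𝔼 → ℝ} (hu : u =ᵐ[volume] u') :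
    ({x | 0 < u x} : Set 𝔼) =ᵐ[volume] ({x | 0 < u' x} : Set 𝔼) := by
  filter_upwards [hu] with x hx
  exact propext (by
    change 0 < u x ↔ 0 < u' x
    rw [hx])

/-- Energy, norm and positivity set depend only on the almost everywhere class, so a minimizer may
be replaced by a representative for which the pointwise arguments work everywhere. -/
theorem CensoredEnergy.IsMinimizer.congr_ae {σ N : ℝ} {u u' : 𝔼 → ℝ}
    (h : CensoredEnergy.IsMinimizer σ N u) (hu : u =ᵐ[volume] u') :
    CensoredEnergy.IsMinimizer σ N u' := by
  obtain ⟨⟨⟨h1, h2, φ, h3, h4, h5⟩, h6, h7⟩, h8⟩ := h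
  have hsub : ∀ k, φ k - u =ᵐ[volume] φ k - u' := fun k => by
    filter_upwards [hu] with x hx
    simp [hx]
  refine ⟨⟨⟨h1.ae_eq hu, ?_, φ, h3, ?_, ?_⟩, fun h0 => h6 (hu.trans h0), ?_⟩, ?_⟩
  · filter_upwards [h2, hu] with x hx hx'
    rwa [← hx']
  · exact h4.congr fun k => energy_congr_ae (ae_eq_refl _) (hsub k)
  · exact h5.congr fun k => eLpNorm_congr_ae (hsub k)
  · filter_upwards [h7, hu] with x hx hx'
    rwa [← hx']
  · rw [← h8, CensoredEnergy.functional, CensoredEnergy.functional,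
      energy_congr_ae (setOf_pos_congr_ae hu) hu, measure_congr (setOf_pos_congr_ae hu),
      eLpNorm_congr_ae (ae_restrict_of_ae hu)]

theorem CensoredEnergy.IsMinimizer.exists_strict {σ N : ℝ} {u : 𝔼 → ℝ}
    (h : CensoredEnergy.IsMinimizer σ N u) : ∃ u', IsStrictMinimizer σ N u' ∧ u =ᵐ[volume] u' := by
  have hum := h.1.mem.memLp.1.aemeasurable
  have hBm : MeasurableSet (Metric.ball (0 : 𝔼) N) := Metric.isOpen_ball.measurableSet
  have hae : u =ᵐ[volume] (Metric.ball (0 : 𝔼) N).indicator fun x => max (hum.mk u x) 0 := by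
    filter_upwards [hum.ae_eq_mk, h.1.mem.eq_zero, h.1.nonneg] with x h1 h2 h3
    by_cases hx : x ∈ Metric.ball (0 : 𝔼) N
    · rw [Set.indicator_of_mem hx, ← h1, max_eq_left (show (0 : ℝ) ≤ u x from h3)]
    · rw [Set.indicator_of_notMem hx, h2 hx]
  refine ⟨_, ⟨h.congr_ae hae, (hum.measurable_mk.max measurable_const).indicator hBm,
    fun x => Set.indicator_nonneg (fun _ _ => le_max_right _ _) x,
    fun x hx => Set.indicator_of_notMem hx _⟩, hae⟩

theorem exists_local_bound (hn : 0 < n) {σ : ℝ} (hσ : 1 / 2 < σ) (hσ' : σ < 1) {Λ : ℝ}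
    (hΛ : 0 ≤ Λ) :
    ∃ C : ℝ, 0 < C ∧ ∀ (N : ℝ) (u : 𝔼 → ℝ), IsStrictMinimizer σ N u →
      CensoredEnergy.m n σ N ≤ ENNReal.ofReal Λ →
      ∀ (x₀ : 𝔼) (R ε : ℝ), 0 < R → R ≤ 1 → 0 < ε → ε ≤ 1 →
        eLpNorm u ∞ (volume.restrict (Metric.ball x₀ (R / 2))) ≤
          ENNReal.ofReal (ε * R ^ (2 * σ)) *
              (∫⁻ y, ENNReal.ofReal (u y / (R + ‖y - x₀‖) ^ ((n : ℝ) + 2 * σ))) +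
            ENNReal.ofReal (C * ε ^ (-((n : ℝ) / (4 * σ))) * R ^ (-((n : ℝ) / 2))) *
              eLpNorm u 2 (volume.restrict (Metric.ball x₀ R)) := by
  obtain ⟨c, hc, hloc⟩ := exists_ae_le_of_small (n := n) hn hσ hσ' hΛ
  have hσ0 : 0 < σ := by linarith
  -- The smallness condition bounds the squared `L²` norm by `c k² Rⁿ ε^(n/(2σ))`; solving it for
  -- `k` gives the factor `q`.
  refine ⟨c ^ (-(1 / 2 : ℝ)), by positivity, fun N u hu hm x₀ R ε hR hR1 hε hε1 => ?_⟩
  set T := ∫⁻ y, ENNReal.ofReal (u y / (R + ‖y - x₀‖) ^ ((n : ℝ) + 2 * σ)) with hT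
  set q : ℝ := c ^ (-(1 / 2 : ℝ)) * ε ^ (-((n : ℝ) / (4 * σ))) * R ^ (-((n : ℝ) / 2)) with hq
  have hq0 : 0 < q := by positivity
  by_cases hTtop : T = ∞
  · rw [hTtop, ENNReal.mul_top (by simp only [ne_eq, ENNReal.ofReal_eq_zero, not_le]; positivity),
      top_add]
    exact le_top
  set L := eLpNorm u 2 (volume.restrict (Metric.ball x₀ R)) with hL
  have hLtop : L ≠ ∞ := (hu.isMinimizer.1.mem.memLp.restrict _).2.ne
  refine ENNReal.le_of_forall_pos_le_add fun δ hδ _ => ?_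
  -- The first summand meets the tail condition, the second the smallness condition; `δ` secures `k
  -- > 0` and is removed at the end.
  set k : ℝ := ε * R ^ (2 * σ) * T.toReal + q * L.toReal + δ with hk
  have hδ' : (0 : ℝ) < δ := hδ
  have hT0 : 0 ≤ ε * R ^ (2 * σ) * T.toReal := by positivity
  have hL0 : 0 ≤ q * L.toReal := by positivity
  have hk0 : 0 < k := by positivity
  have hq2 : q ^ 2 * (R ^ (n : ℝ) * ε ^ ((n : ℝ) / (2 * σ)) * c) = 1 := by
    have e1 : (c ^ (-(1 / 2 : ℝ))) ^ 2 * c = 1 := by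
      rw [← Real.rpow_natCast, ← Real.rpow_mul hc.le]
      norm_num
      rw [Real.rpow_neg_one, inv_mul_cancel₀ hc.ne']
    have e2 : (ε ^ (-((n : ℝ) / (4 * σ)))) ^ 2 * ε ^ ((n : ℝ) / (2 * σ)) = 1 := by
      rw [← Real.rpow_natCast, ← Real.rpow_mul hε.le, ← Real.rpow_add hε]
      rw [show -((n : ℝ) / (4 * σ)) * ((2 : ℕ) : ℝ) + (n : ℝ) / (2 * σ) = 0 by
        push_cast; field_simp; ring, Real.rpow_zero]
    have e3 : (R ^ (-((n : ℝ) / 2))) ^ 2 * R ^ (n : ℝ) = 1 := by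
      rw [← Real.rpow_natCast, ← Real.rpow_mul hR.le, ← Real.rpow_add hR]
      rw [show -((n : ℝ) / 2) * ((2 : ℕ) : ℝ) + (n : ℝ) = 0 by push_cast; ring, Real.rpow_zero]
    calc q ^ 2 * (R ^ (n : ℝ) * ε ^ ((n : ℝ) / (2 * σ)) * c) =
        ((c ^ (-(1 / 2 : ℝ))) ^ 2 * c) * ((ε ^ (-((n : ℝ) / (4 * σ)))) ^ 2 *
          ε ^ ((n : ℝ) / (2 * σ))) * ((R ^ (-((n : ℝ) / 2))) ^ 2 * R ^ (n : ℝ)) := by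
          rw [hq]; ring
      _ = 1 := by rw [e1, e2, e3]; norm_num
  have hsmall : ∫⁻ x in Metric.ball x₀ R, ENNReal.ofReal (u x ^ 2) ≤
      ENNReal.ofReal (k ^ 2 * R ^ (n : ℝ) * ε ^ ((n : ℝ) / (2 * σ)) * c) := by
    rw [← eLpNorm_two_sq, ← hL, ← ENNReal.ofReal_toReal hLtop,
      ← ENNReal.ofReal_pow ENNReal.toReal_nonneg]
    refine ENNReal.ofReal_le_ofReal ?_
    calc L.toReal ^ 2 = (q * L.toReal) ^ 2 * (R ^ (n : ℝ) * ε ^ ((n : ℝ) / (2 * σ)) * c) := by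
          rw [mul_pow, mul_right_comm, hq2, one_mul]
      _ ≤ k ^ 2 * (R ^ (n : ℝ) * ε ^ ((n : ℝ) / (2 * σ)) * c) := by
          gcongr; linarith
      _ = _ := by ring
  have hae := hloc N u x₀ R ε T.toReal k hu hm hR hR1 hε hε1 ENNReal.toReal_nonneg hk0
    (ENNReal.ofReal_toReal hTtop).ge (by linarith) hsmall
  have h1 : eLpNorm u ∞ (volume.restrict (Metric.ball x₀ (R / 2))) ≤ ENNReal.ofReal k := by
    rw [eLpNorm_exponent_top]
    refine eLpNormEssSup_le_of_ae_bound ?_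
    filter_upwards [hae] with x hx
    rwa [Real.norm_of_nonneg (hu.nonneg x)]
  refine h1.trans (le_of_eq ?_)
  rw [hk, ENNReal.ofReal_add (by positivity) hδ'.le, ENNReal.ofReal_add hT0 hL0,
    ENNReal.ofReal_mul (by positivity), ENNReal.ofReal_mul hq0.le, ENNReal.ofReal_toReal hTtop,
    ENNReal.ofReal_toReal hLtop, ENNReal.ofReal_coe_nnreal]

/-- Cauchy–Schwarz: the squared weight `(1 + |y|)^(-2(n + 2σ))` is integrable, and its integral does
not depend on the centre. -/
theorem exists_tail_le (hn : 0 < n) {σ : ℝ} (hσ : 0 < σ) :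
    ∃ C : ℝ, 0 < C ∧ ∀ (u : 𝔼 → ℝ) (x₀ : 𝔼), Measurable u → (∀ x, 0 ≤ u x) →
      ∫⁻ y, ENNReal.ofReal (u y / (1 + ‖y - x₀‖) ^ ((n : ℝ) + 2 * σ)) ≤
        ENNReal.ofReal C * eLpNorm u 2 volume := by
  set p : ℝ := (n : ℝ) + 2 * σ with hp
  have hn' : (0 : ℝ) < n := by exact_mod_cast hn
  have hI : ∫⁻ x : 𝔼, ENNReal.ofReal ((1 + ‖x‖) ^ (-(2 * p))) < ∞ :=
    finite_integral_one_add_norm (by rw [finrank_euclideanSpace_fin]; linarith)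
  set I := ∫⁻ x : 𝔼, ENNReal.ofReal ((1 + ‖x‖) ^ (-(2 * p))) with hIdef
  have hI2 : I ^ (1 / 2 : ℝ) ≠ ∞ := ENNReal.rpow_ne_top_of_nonneg (by norm_num) hI.ne
  refine ⟨(I ^ (1 / 2 : ℝ)).toReal + 1, by positivity, fun u x₀ hum hu0 => ?_⟩
  have h1 : ∀ y, ENNReal.ofReal (u y / (1 + ‖y - x₀‖) ^ p) =
      ENNReal.ofReal (u y) * ENNReal.ofReal ((1 + ‖y - x₀‖) ^ (-p)) := fun y => by
    rw [← ENNReal.ofReal_mul (hu0 y), Real.rpow_neg (by positivity), div_eq_mul_inv]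
  simp_rw [h1]
  have hm2 : Measurable fun y : 𝔼 => ENNReal.ofReal ((1 + ‖y - x₀‖) ^ (-p)) := by fun_prop
  have h2 := ENNReal.lintegral_mul_le_Lp_mul_Lq volume (p := 2) (q := 2)
    (by constructor <;> norm_num) hum.ennreal_ofReal.aemeasurable hm2.aemeasurable
  refine h2.trans ?_
  have e1 : (∫⁻ y, ENNReal.ofReal (u y) ^ (2 : ℝ)) ^ (1 / 2 : ℝ) = eLpNorm u 2 volume := by
    have : ∀ y, ENNReal.ofReal (u y) ^ (2 : ℝ) = ENNReal.ofReal (u y ^ 2) := fun y => by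
      rw [ENNReal.rpow_two, ENNReal.ofReal_pow (hu0 y)]
    simp_rw [this]
    rw [← eLpNorm_two_sq, ← ENNReal.rpow_two, ← ENNReal.rpow_mul]
    norm_num
  have e2 : ∫⁻ y : 𝔼, ENNReal.ofReal ((1 + ‖y - x₀‖) ^ (-p)) ^ (2 : ℝ) = I := by
    have : ∀ y : 𝔼, ENNReal.ofReal ((1 + ‖y - x₀‖) ^ (-p)) ^ (2 : ℝ) =
        ENNReal.ofReal ((1 + ‖y - x₀‖) ^ (-(2 * p))) := fun y => by
      rw [ENNReal.rpow_two, ← ENNReal.ofReal_pow (by positivity), ← Real.rpow_natCast,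
        ← Real.rpow_mul (by positivity)]
      congr 2; push_cast; ring
    simp_rw [this]
    exact lintegral_sub_right_eq_self (fun y : 𝔼 => ENNReal.ofReal ((1 + ‖y‖) ^ (-(2 * p)))) x₀
  rw [mul_comm]
  refine mul_le_mul' ?_ e1.le
  rw [e2]
  exact (ENNReal.le_ofReal_iff_toReal_le hI2 (by positivity)).mpr (by linarith)

theorem eLpNorm_top_le_of_forall_ball {u : 𝔼 → ℝ} {K : ℝ≥0∞} {r : ℝ} (hr : 0 < r)
    (h : ∀ x₀, eLpNorm u ∞ (volume.restrict (Metric.ball x₀ r)) ≤ K) : eLpNorm u ∞ volume ≤ K := by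
  have hcover : ⋃ i, Metric.ball (TopologicalSpace.denseSeq 𝔼 i) r = Set.univ := by
    refine Set.eq_univ_of_forall fun x => ?_
    obtain ⟨y, hy, i, rfl⟩ := Metric.dense_iff.mp (TopologicalSpace.denseRange_denseSeq 𝔼) x r hr
    exact Set.mem_iUnion.mpr ⟨i, Metric.mem_ball_comm.mp hy⟩
  have h1 : ∀ᵐ x ∂(volume : Measure 𝔼), ‖u x‖ₑ ≤ K := by
    rw [← Measure.restrict_univ (μ := (volume : Measure 𝔼)), ← hcover, ae_restrict_iUnion_iff]
    intro i
    have h2 := h (TopologicalSpace.denseSeq 𝔼 i)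
    rw [eLpNorm_exponent_top] at h2
    filter_upwards [ae_le_eLpNormEssSup (f := u)
      (μ := volume.restrict (Metric.ball (TopologicalSpace.denseSeq 𝔼 i) r))] with x hx
    exact hx.trans h2
  rw [eLpNorm_exponent_top]
  exact essSup_le_of_ae_le _ h1

end Main

theorem mainTheorem4 (n : ℕ) (hn : 2 ≤ n) (σ : ℝ) (hσ : 1 / 2 < σ) (hσ' : σ < 1)
    (N₀ : ℝ) (hN₀ : 0 < N₀) :
    ∃ C : ℝ, 0 < C ∧
      ∀ N : ℝ, N₀ ≤ N → ∀ u : EuclideanSpace ℝ (Fin n) → ℝ, CensoredEnergy.IsMinimizer σ N u →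
        eLpNorm u ∞ volume ≤ ENNReal.ofReal C * eLpNorm u 2 volume ∧
        ∀ (x₀ : EuclideanSpace ℝ (Fin n)) (R ε : ℝ), 0 < R → R ≤ 1 → 0 < ε → ε ≤ 1 →
          eLpNorm u ∞ (volume.restrict (Metric.ball x₀ (R / 2))) ≤
            ENNReal.ofReal (ε * R ^ (2 * σ)) *
                (∫⁻ y, ENNReal.ofReal (u y / (R + ‖y - x₀‖) ^ ((n : ℝ) + 2 * σ))) +
              ENNReal.ofReal (C * ε ^ (-((n : ℝ) / (4 * σ))) * R ^ (-((n : ℝ) / 2))) *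
                eLpNorm u 2 (volume.restrict (Metric.ball x₀ R)) := by
  have hn0 : 0 < n := by omega
  have hσ0 : 0 < σ := by linarith
  obtain ⟨Λ, hΛ, hm⟩ := exists_m_le hn0 hσ0 hσ' hN₀
  obtain ⟨C₁, hC₁, hloc⟩ := exists_local_bound hn0 hσ hσ' hΛ
  obtain ⟨C₂, hC₂, htail⟩ := exists_tail_le hn0 hσ0
  refine ⟨C₂ + C₁, by positivity, fun N hN u hu => ?_⟩
  obtain ⟨v, hv, huv⟩ := hu.exists_strict
  have hloc' := hloc N v hv (hm N hN)
  have htop : eLpNorm u ∞ volume = eLpNorm v ∞ volume := eLpNorm_congr_ae huv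
  have htwo : eLpNorm u 2 volume = eLpNorm v 2 volume := eLpNorm_congr_ae huv
  refine ⟨?_, fun x₀ R ε hR hR1 hε hε1 => ?_⟩
  · rw [htop, htwo]
    refine eLpNorm_top_le_of_forall_ball (r := 1 / 2) (by norm_num) fun x₀ => ?_
    -- At `R = ε = 1` both terms are multiples of the global `L²` norm, with constants independent
    -- of the centre; hence the sum `C₂ + C₁`.
    refine (hloc' x₀ 1 1 one_pos le_rfl one_pos le_rfl).trans ?_
    simp only [Real.one_rpow, mul_one, ENNReal.ofReal_one, one_mul]
    rw [ENNReal.ofReal_add hC₂.le hC₁.le, add_mul]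
    refine add_le_add (htail v x₀ hv.measurable hv.nonneg) ?_
    gcongr
    exact Measure.restrict_le_self
  · rw [eLpNorm_congr_ae (ae_restrict_of_ae huv), eLpNorm_congr_ae (ae_restrict_of_ae huv)]
    have htl : ∫⁻ y, ENNReal.ofReal (u y / (R + ‖y - x₀‖) ^ ((n : ℝ) + 2 * σ)) =
        ∫⁻ y, ENNReal.ofReal (v y / (R + ‖y - x₀‖) ^ ((n : ℝ) + 2 * σ)) := by
      refine lintegral_congr_ae ?_
      filter_upwards [huv] with y hy
      rw [hy]
    rw [htl]
    refine (hloc' x₀ R ε hR hR1 hε hε1).trans ?_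
    gcongr
    linarith
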